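/- **Setting.** Let $(\xi_t)_{t\in\mathbb Z}$ be random variables on a probability space satisfying *INN.* The $\xi_t$ are i.i.d. with $E\xi_1=0$ and $\mathrm{Var}(\xi_1)=\sigma_\xi^2<\infty$; the law of $\xi_1$ is absolutely continuous, and its characteristic function $\psi_\xi$ satisfies $\int_{\mathbb R}|\psi_\xi(u)|^\theta\,du<\infty$ for some integer $\theta\ge1$. Given real coefficients $a_k(n)$ ($0\le k\le n-1$) and $a^-_{k,t}(n)$ ($1\le t\le n$, $k\ge t$), let for $1\le t\le n$ $$x_t(n)=x^+_t(n)+x_t^-(n),\qquad x_t^+(n)=\sum_{k=0}^{t-1}a_k(n)\xi_{t-k},\qquad x_t^-(n)=\sum_{k=t}^{\infty}a^-_{k,t}(n)\xi_{t-k},$$ where the infinite sum is the limit of its partial sums. Put $a_{k,t}(n)=a_k(n)$ for $k\le t-1$, $a_{k,t}(n)=a^-_{k,t}(n)$ for $k\ge t$, and let $\beta^{\pm}_{n,t},\beta_{n,t}\ge0$ be given by $$(\beta^+_{n,t})^2=\sigma_\xi^2\sum_{k=0}^{t-1}a_k(n)^2,\qquad (\beta^-_{n,t})^2=\sigma_\xi^2\sum_{k=t}^\infty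 a^-_{k,t}(n)^2,\qquad \beta_{n,t}^2=(\beta^+_{n,t})^2+(\beta^-_{n,t})^2,$$ $\beta_n:=\beta_{n,n}$. Let $\mathcal F_t=\sigma(\xi_r:r\le t)$. **Conditions on the coefficients and innovations.** * LP1: $\beta_{n,t}\in(0,\infty)$ for all $1\le t\le n$. * LP2: (a) $E|\xi_1|^\lambda<\infty$ for some $\lambda\in[2,\infty)$; (b) $\xi_1$ has a finite moment generating function near $0$. * LP3: for some $t_0\ge1$, $\liminf_{n}\inf_{t_0\le t\le n}\beta_t^{-1}\beta^+_{n,t}>0$; and $\limsup_{t\to\infty}\sup_{n\ge t}(\beta^+_{n,t})^{-1}\max_{0\le k\le t-1}|a_k(n)|=0$. * LP4: for every $t_0\in\mathbb N$ there are $\delta>0$ and $n_0$ such that for all $1\le t\le t_0$ and all $n\ge \max(n_0,t)$ there are $\theta$ distinct indices $k\ge0$ with $|a_{k,t}(n)|>\delta$. * LP5: $n^{-1/2}\beta_n^{-1}\sum_{k=0}^{n-1}|a_k(n)|\to0$. * LP6: (a) there are $\sigma_+>0$, $\sigma_-\ge0$ such that for every $\delta\in(0,1)$ and all integers $1\le t_n\le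 n$ with $t_n\ge\lfloor n\delta\rfloor$, $\beta_n^{-1}\beta^{+}_{n,t_n}\to\sigma_+$ and $\beta_n^{-1}\beta^-_{n,t_n}\to\sigma_-$; (b) $\beta_n^{-1}\big(\max_{0\le k\le n-1}|a_k(n)|+\sup_{1\le t\le n,\,k\ge t}|a^-_{k,t}(n)|\big)\to0$; (c) for all such $\delta$ and $(t_n)$, $\beta_n^{-2}\sum_{l=-\infty}^0\big[a^-_{t_n-l,t_n}(n)-a^-_{n-l,n}(n)\big]^2\to0$. * LP7: $\sup_{n\ge n_0,1\le t\le n}\beta_n^{-1}\beta_{n,t}<\infty$ for some $n_0$. **High-level conditions** on an array $X_t(n)$, $1\le t\le n$, a filtration $(\mathcal F_t)_{t\in\mathbb Z}$ and a sequence $(\beta_n)$. * HL0: $X_t(n)$ is $\mathcal F_t$-measurable for all $1\le t\le n$, $\beta_n>0$ for all $n\ge1$, and $\beta_n\to\infty$. * HL1: $X_t(n)=X_t^+(n)+X_t^-(n)+R_t(n)$, where $X^-_t(n)$ is $\mathcal F_0$-measurable and $\sup_{1\le t\le n}P\{\beta_n^{-1}|R_t(n)|>\epsilon\}\to0$ for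 every $\epsilon>0$. * HL2: there are random variables $X^+,X^-$, with $X^+$ having a bounded continuous density $\Phi$, such that for every $\delta\in(0,1)$ and all integers $1\le t_n\le n$ with $t_n\ge\lfloor n\delta\rfloor$: (a) $E[h(\beta_n^{-1}X^+_{t_n}(n))\mid\mathcal F_0]\to\int h\Phi$ in probability for every bounded continuous $h$; (b) $\beta_n^{-1}X^-_{t_n}(n)\to X^-$ in distribution and $\beta_n^{-1}[X^-_n(n)-X^-_{t_n}(n)]\to0$ in probability. * HL3 (with $t_0$): for all $1\le t\le n$, $\beta_t^{-1}X_t(n)$ has a density $D_{n,t}$, and $\sup_{n\ge n_0,\,t_0\le t\le n}\sup_xD_{n,t}(x)<\infty$ for some $n_0\ge t_0\ge1$. * HL4: for every bounded Lipschitz $g$, $\frac1n\sum_{t=1}^n g(\beta_n^{-1}X_t(n))-\frac1n\sum_{t=1}^nE[g(\beta_n^{-1}X_t(n))\mid\mathcal F_0]\to0$ in probability. * HL5 (with $\lambda>0$): for some $n_0\geq 1$, (a) $\sup_{n\ge n_0,1\le t\le n}E|\beta_n^{-1}X_t(n)|^\lambda<\infty$; (b) $\sup_{n\ge n_0,1\le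 t\le n}E\exp(\lambda|\beta_n^{-1}X_t(n)|)<\infty$. **Proposition.** Suppose INN and LP1 hold. Then for $1\le t\le n$ the series $x_t^-(n)$ converges almost surely, $x_t(n)$ is square-integrable and $\beta_{n,t}^2=\mathrm{Var}(x_t(n))$. With $X_t(n)=x_t(n)$, $X_t^\pm(n)=x_t^\pm(n)$, $R_t(n)=0$, and $\mathcal F_t$, $\beta_n$ as above: HL1 holds; $x_t(n)$ is $\mathcal F_t$-measurable for $1\le t\le n$ and $\beta_n>0$ for $n\ge1$, so that HL0 holds whenever $\beta_n\to\infty$. Moreover: 1. LP6 implies HL2 with $(X^+,X^-)\sim N[0,\mathrm{diag}\{\sigma_+^2,\sigma_-^2\}]$. 2. (a) LP3 implies HL3 for some $t_0$; (b) LP3 and LP4 imply HL3 with $t_0=1$. 3. LP5 implies HL4. 4. (a) LP2(a) (with $\lambda\ge2$) and LP7 imply HL5(a) with the same $\lambda$; (b) LP2(b), LP6(b) and LP7 imply HL5(b) for some $\lambda>0$. -/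

import Mathlib

open MeasureTheory ProbabilityTheory Filter Topology
open scoped ENNReal NNReal BoundedContinuousFunction

namespace WNP

noncomputable section

/-! ### High-level conditions

`X n t` stands for `X_t(n)`; the array is indexed by `1 ≤ t ≤ n`. -/

section HighLevel

variable {Ω : Type*} [mΩ : MeasurableSpace Ω]

/-- `X_t(n)` is `ℱ_t`-measurable for all `1 ≤ t ≤ n`. -/
def ArrayAdapted (ℱ : Filtration ℤ mΩ) (X : ℕ → ℕ → Ω → ℝ) : Prop :=
  ∀ n t : ℕ, 1 ≤ t → t ≤ n → Measurable[ℱ (t : ℤ)] (X n t)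

/-- HL0: adaptedness, and a positive normalising sequence that diverges. -/
def HL0 (ℱ : Filtration ℤ mΩ) (X : ℕ → ℕ → Ω → ℝ) (β : ℕ → ℝ) : Prop :=
  ArrayAdapted ℱ X ∧ (∀ n : ℕ, 1 ≤ n → 0 < β n) ∧ Tendsto β atTop atTop

/-- HL1: `X = X⁺ + X⁻ + R`, with `X⁻` measurable at time `0` and `R` uniformly negligible. -/
def HL1 (P : Measure Ω) (ℱ : Filtration ℤ mΩ) (X Xp Xm R : ℕ → ℕ → Ω → ℝ) (β : ℕ → ℝ) : Prop :=
  (∀ n t : ℕ, 1 ≤ t → t ≤ n → ∀ ω, X n t ω = Xp n t ω + Xm n t ω + R n t ω) ∧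
  (∀ n t : ℕ, 1 ≤ t → t ≤ n → Measurable[ℱ 0] (Xm n t)) ∧
  ∀ ε : ℝ, 0 < ε →
    Tendsto (fun n : ℕ => ⨆ t ∈ Finset.Icc 1 n, P {ω | ε < (β n)⁻¹ * |R n t ω|}) atTop (𝓝 0)

/-- Sequences `t_n ∈ {1, …, n}` with `⌊nδ⌋ ≤ t_n ≤ n`. -/
def AdmissibleTimes (δ : ℝ) (t : ℕ → ℕ) : Prop :=
  ∀ n : ℕ, ⌊(n : ℝ) * δ⌋₊ ≤ t n ∧ t n ≤ n ∧ (1 ≤ n → 1 ≤ t n)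

/-- HL2, with limiting random variables `Zp` (for `X⁺`) and `Zm` (for `X⁻`) that live on a
probability space `(Ω', P')`. -/
def HL2 (P : Measure Ω) [IsProbabilityMeasure P] (ℱ : Filtration ℤ mΩ)
    (Xp Xm : ℕ → ℕ → Ω → ℝ) (β : ℕ → ℝ)
    {Ω' : Type*} [MeasurableSpace Ω'] (P' : Measure Ω') [IsProbabilityMeasure P']
    (Zp Zm : Ω' → ℝ) : Prop :=
  Measurable Zp ∧ Measurable Zm ∧
  ∃ Φ : ℝ → ℝ, Continuous Φ ∧ (∃ C, ∀ x, Φ x ≤ C) ∧ (∀ x, 0 ≤ Φ x) ∧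
    P'.map Zp = volume.withDensity (fun x => ENNReal.ofReal (Φ x)) ∧
    ∀ δ ∈ Set.Ioo (0 : ℝ) 1, ∀ t : ℕ → ℕ, AdmissibleTimes δ t →
      (∀ h : ℝ →ᵇ ℝ,
        TendstoInMeasure P
          (fun n : ℕ => P[fun ω => h ((β n)⁻¹ * Xp n (t n) ω) | ℱ 0]) atTop
          (fun _ => ∫ x, h x * Φ x)) ∧
      TendstoInDistribution (fun (n : ℕ) ω => (β n)⁻¹ * Xm n (t n) ω) atTop Zm (fun _ => P) P' ∧
      TendstoInMeasure P (fun (n : ℕ) ω => (β n)⁻¹ * (Xm n n ω - Xm n (t n) ω)) atTop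
        (fun _ => (0 : ℝ))

/-- HL3 for a given `t₀`: every `β_t⁻¹ X_t(n)` has a density, and these densities are bounded
uniformly over `n ≥ n₀` and `t₀ ≤ t ≤ n`, for some `n₀ ≥ t₀ ≥ 1`. -/
def HL3 (P : Measure Ω) (X : ℕ → ℕ → Ω → ℝ) (β : ℕ → ℝ) (t₀ : ℕ) : Prop :=
  1 ≤ t₀ ∧ ∃ D : ℕ → ℕ → ℝ → ℝ≥0∞,
    (∀ n t : ℕ, 1 ≤ t → t ≤ n →
      Measurable (D n t) ∧
        P.map (fun ω => (β t)⁻¹ * X n t ω) = volume.withDensity (D n t)) ∧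
    ∃ n₀ : ℕ, t₀ ≤ n₀ ∧ (⨆ n ≥ n₀, ⨆ t ∈ Finset.Icc t₀ n, ⨆ x, D n t x) < ∞

/-- HL4. -/
def HL4 (P : Measure Ω) (ℱ : Filtration ℤ mΩ) (X : ℕ → ℕ → Ω → ℝ) (β : ℕ → ℝ) : Prop :=
  ∀ g : ℝ → ℝ, (∃ C, ∀ x, |g x| ≤ C) → (∃ K : ℝ≥0, LipschitzWith K g) →
    TendstoInMeasure P
      (fun (n : ℕ) ω =>
        (n : ℝ)⁻¹ * ∑ t ∈ Finset.Icc 1 n, g ((β n)⁻¹ * X n t ω) -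
        (n : ℝ)⁻¹ * ∑ t ∈ Finset.Icc 1 n, (P[fun ω' => g ((β n)⁻¹ * X n t ω') | ℱ 0]) ω)
      atTop (fun _ => (0 : ℝ))

/-- HL5(a) for a given `lam`. -/
def HL5a (P : Measure Ω) (X : ℕ → ℕ → Ω → ℝ) (β : ℕ → ℝ) (lam : ℝ) : Prop :=
  0 < lam ∧ ∃ n₀ : ℕ, 1 ≤ n₀ ∧
    (⨆ n ≥ n₀, ⨆ t ∈ Finset.Icc 1 n,
      ∫⁻ ω, ENNReal.ofReal (|(β n)⁻¹ * X n t ω| ^ lam) ∂P) < ∞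

/-- HL5(b) for a given `lam`. -/
def HL5b (P : Measure Ω) (X : ℕ → ℕ → Ω → ℝ) (β : ℕ → ℝ) (lam : ℝ) : Prop :=
  0 < lam ∧ ∃ n₀ : ℕ, 1 ≤ n₀ ∧
    (⨆ n ≥ n₀, ⨆ t ∈ Finset.Icc 1 n,
      ∫⁻ ω, ENNReal.ofReal (Real.exp (lam * |(β n)⁻¹ * X n t ω|)) ∂P) < ∞

end HighLevel

/-! ### Innovations and linear process arrays -/

section LinearProcess

variable {Ω : Type*} [mΩ : MeasurableSpace Ω]

/-- Assumption INN, with exponent `θ`. -/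
structure INN (P : Measure Ω) (ξ : ℤ → Ω → ℝ) (θ : ℕ) : Prop where
  measurable : ∀ i, Measurable (ξ i)
  indep : iIndepFun ξ P
  ident : ∀ i, IdentDistrib (ξ i) (ξ 1) P P
  memLp : MemLp (ξ 1) 2 P
  mean_zero : ∫ ω, ξ 1 ω ∂P = 0
  absCont : P.map (ξ 1) ≪ volume
  one_le : 1 ≤ θ
  charFun_integrable : Integrable (fun u : ℝ => ‖charFun (P.map (ξ 1)) u‖ ^ θ) volume

/-- `ℱ_t = σ(ξ_r : r ≤ t)`. -/
def innovFiltration (ξ : ℤ → Ω → ℝ) (hξ : ∀ i, Measurable (ξ i)) : Filtration ℤ mΩ :=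
  Filtration.natural ξ (fun i => (hξ i).stronglyMeasurable)

/-- `x_t⁺(n) = ∑_{k=0}^{t-1} a_k(n) ξ_{t-k}`, where `a n k` is `a_k(n)`. -/
def xPlus (ξ : ℤ → Ω → ℝ) (a : ℕ → ℕ → ℝ) (n t : ℕ) (ω : Ω) : ℝ :=
  ∑ k ∈ Finset.range t, a n k * ξ ((t : ℤ) - (k : ℤ)) ω

/-- The partial sum `∑_{k=t}^{N-1} a⁻_{k,t}(n) ξ_{t-k}`, where `am n t k` is `a⁻_{k,t}(n)`. -/
def xMinusPartial (ξ : ℤ → Ω → ℝ) (am : ℕ → ℕ → ℕ → ℝ) (n t N : ℕ) (ω : Ω) : ℝ :=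
  ∑ k ∈ Finset.Ico t N, am n t k * ξ ((t : ℤ) - (k : ℤ)) ω

/-- `x_t⁻(n) = ∑_{k=t}^∞ a⁻_{k,t}(n) ξ_{t-k}`, the pointwise limit of the partial sums (for
square-summable coefficients it exists almost surely, but in general not unconditionally, so
that `∑'` would not do). -/
def xMinus (ξ : ℤ → Ω → ℝ) (am : ℕ → ℕ → ℕ → ℝ) (n t : ℕ) (ω : Ω) : ℝ :=
  limUnder atTop (fun N : ℕ => xMinusPartial ξ am n t N ω)

/-- `x_t(n) = x_t⁺(n) + x_t⁻(n)`. -/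
def xProc (ξ : ℤ → Ω → ℝ) (a : ℕ → ℕ → ℝ) (am : ℕ → ℕ → ℕ → ℝ) (n t : ℕ) (ω : Ω) : ℝ :=
  xPlus ξ a n t ω + xMinus ξ am n t ω

/-- `a_{k,t}(n)`: equal to `a_k(n)` for `k ≤ t - 1` and to `a⁻_{k,t}(n)` for `k ≥ t`. -/
def coeff (a : ℕ → ℕ → ℝ) (am : ℕ → ℕ → ℕ → ℝ) (n t k : ℕ) : ℝ :=
  if k < t then a n k else am n t k

/-- `β⁺_{n,t}`, with `(β⁺_{n,t})² = σ_ξ² ∑_{k=0}^{t-1} a_k(n)²`. -/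
def betaPlus (P : Measure Ω) (ξ : ℤ → Ω → ℝ) (a : ℕ → ℕ → ℝ) (n t : ℕ) : ℝ :=
  Real.sqrt (Var[ξ 1; P] * ∑ k ∈ Finset.range t, a n k ^ 2)

/-- `β⁻_{n,t}`, with `(β⁻_{n,t})² = σ_ξ² ∑_{k=t}^∞ a⁻_{k,t}(n)²`. -/
def betaMinus (P : Measure Ω) (ξ : ℤ → Ω → ℝ) (am : ℕ → ℕ → ℕ → ℝ) (n t : ℕ) : ℝ :=
  Real.sqrt (Var[ξ 1; P] * ∑' j : ℕ, am n t (t + j) ^ 2)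

/-- `β_{n,t}`, with `β_{n,t}² = (β⁺_{n,t})² + (β⁻_{n,t})²`. -/
def betaArr (P : Measure Ω) (ξ : ℤ → Ω → ℝ) (a : ℕ → ℕ → ℝ) (am : ℕ → ℕ → ℕ → ℝ)
    (n t : ℕ) : ℝ :=
  Real.sqrt (betaPlus P ξ a n t ^ 2 + betaMinus P ξ am n t ^ 2)

/-- `β_n = β_{n,n}`. -/
def betaSeq (P : Measure Ω) (ξ : ℤ → Ω → ℝ) (a : ℕ → ℕ → ℝ) (am : ℕ → ℕ → ℕ → ℝ)
    (n : ℕ) : ℝ :=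
  betaArr P ξ a am n n

/-- LP1: `β_{n,t} ∈ (0, ∞)`, finiteness being square-summability of the coefficients. -/
def LP1 (P : Measure Ω) (ξ : ℤ → Ω → ℝ) (a : ℕ → ℕ → ℝ) (am : ℕ → ℕ → ℕ → ℝ) : Prop :=
  ∀ n t : ℕ, 1 ≤ t → t ≤ n →
    Summable (fun j : ℕ => am n t (t + j) ^ 2) ∧ 0 < betaArr P ξ a am n t

/-- LP2(a) for a given `lam ∈ [2, ∞)`. -/
def LP2a (P : Measure Ω) (ξ : ℤ → Ω → ℝ) (lam : ℝ) : Prop :=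
  2 ≤ lam ∧ Integrable (fun ω => |ξ 1 ω| ^ lam) P

/-- LP2(b): the moment generating function of `ξ₁` is finite in a neighbourhood of zero. -/
def LP2b (P : Measure Ω) (ξ : ℤ → Ω → ℝ) : Prop :=
  ∀ᶠ u in 𝓝 (0 : ℝ), Integrable (fun ω => Real.exp (u * ξ 1 ω)) P

/-- LP3 for a given `t₀`. Suprema and infima are taken in `[0, ∞]`. -/
def LP3 (P : Measure Ω) (ξ : ℤ → Ω → ℝ) (a : ℕ → ℕ → ℝ) (am : ℕ → ℕ → ℕ → ℝ)
    (t₀ : ℕ) : Prop :=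
  1 ≤ t₀ ∧
  0 < liminf (fun n : ℕ => ⨅ t ∈ Finset.Icc t₀ n,
    ENNReal.ofReal ((betaSeq P ξ a am t)⁻¹ * betaPlus P ξ a n t)) atTop ∧
  limsup (fun t : ℕ => ⨆ n ≥ t,
    (⨆ k ∈ Finset.range t, ENNReal.ofReal |a n k|) / ENNReal.ofReal (betaPlus P ξ a n t))
    atTop = 0

/-- LP4 for a given `t₀`: at each date `1 ≤ t ≤ t₀`, and for all large `n`, at least `θ`
coefficients exceed a common `δ > 0` in absolute value. -/
def LP4 (a : ℕ → ℕ → ℝ) (am : ℕ → ℕ → ℕ → ℝ) (θ t₀ : ℕ) : Prop :=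
  ∃ δ : ℝ, 0 < δ ∧ ∃ n₀ : ℕ, ∀ t n : ℕ, 1 ≤ t → t ≤ t₀ → n₀ ≤ n → t ≤ n →
    ∃ S : Finset ℕ, S.card = θ ∧ ∀ k ∈ S, δ < |coeff a am n t k|

/-- LP5. -/
def LP5 (P : Measure Ω) (ξ : ℤ → Ω → ℝ) (a : ℕ → ℕ → ℝ) (am : ℕ → ℕ → ℕ → ℝ) : Prop :=
  Tendsto (fun n : ℕ => (Real.sqrt n)⁻¹ * (betaSeq P ξ a am n)⁻¹ *
    ∑ k ∈ Finset.range n, |a n k|) atTop (𝓝 0)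

/-- LP6(a), with limits `σp > 0` and `σm ≥ 0`. -/
def LP6a (P : Measure Ω) (ξ : ℤ → Ω → ℝ) (a : ℕ → ℕ → ℝ) (am : ℕ → ℕ → ℕ → ℝ)
    (σp σm : ℝ) : Prop :=
  0 < σp ∧ 0 ≤ σm ∧
  ∀ δ ∈ Set.Ioo (0 : ℝ) 1, ∀ t : ℕ → ℕ, AdmissibleTimes δ t →
    Tendsto (fun n : ℕ => (betaSeq P ξ a am n)⁻¹ * betaPlus P ξ a n (t n)) atTop (𝓝 σp) ∧
    Tendsto (fun n : ℕ => (betaSeq P ξ a am n)⁻¹ * betaMinus P ξ am n (t n)) atTop (𝓝 σm)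

/-- LP6(b). Suprema are taken in `[0, ∞]`. -/
def LP6b (P : Measure Ω) (ξ : ℤ → Ω → ℝ) (a : ℕ → ℕ → ℝ) (am : ℕ → ℕ → ℕ → ℝ) : Prop :=
  Tendsto (fun n : ℕ =>
    ((⨆ k ∈ Finset.range n, ENNReal.ofReal |a n k|) +
      ⨆ t ∈ Finset.Icc 1 n, ⨆ k ≥ t, ENNReal.ofReal |am n t k|) /
      ENNReal.ofReal (betaSeq P ξ a am n)) atTop (𝓝 0)

/-- LP6(c), where the sum over `l ≤ 0` is written with `l = -j`. -/
def LP6c (P : Measure Ω) (ξ : ℤ → Ω → ℝ) (a : ℕ → ℕ → ℝ) (am : ℕ → ℕ → ℕ → ℝ) : Prop :=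
  ∀ δ ∈ Set.Ioo (0 : ℝ) 1, ∀ t : ℕ → ℕ, AdmissibleTimes δ t →
    Tendsto (fun n : ℕ => (betaSeq P ξ a am n ^ 2)⁻¹ *
      ∑' j : ℕ, (am n (t n) (t n + j) - am n n (n + j)) ^ 2) atTop (𝓝 0)

/-- LP6, with limiting standard deviations `σp` and `σm`. -/
def LP6 (P : Measure Ω) (ξ : ℤ → Ω → ℝ) (a : ℕ → ℕ → ℝ) (am : ℕ → ℕ → ℕ → ℝ)
    (σp σm : ℝ) : Prop :=
  LP6a P ξ a am σp σm ∧ LP6b P ξ a am ∧ LP6c P ξ a am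

/-- LP7. -/
def LP7 (P : Measure Ω) (ξ : ℤ → Ω → ℝ) (a : ℕ → ℕ → ℝ) (am : ℕ → ℕ → ℕ → ℝ) : Prop :=
  ∃ n₀ : ℕ, (⨆ n ≥ n₀, ⨆ t ∈ Finset.Icc 1 n,
    ENNReal.ofReal ((betaSeq P ξ a am n)⁻¹ * betaArr P ξ a am n t)) < ∞

end LinearProcess

end

end WNP

namespace WNP

set_option linter.unusedSectionVars false

/-! Each of $x_t^+(n)$, $x_t^-(n)$ and $x_t(n)$ is a series $\sum_k c_k\eta_k$ with square-summable
weights in a white noise $\eta$ obtained by reindexing the innovations. $L^2$-bounded martingale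
convergence gives almost sure convergence (`IsWhiteNoise.ae_exists_tendsto`), Fatou gives the
variance, and independence makes the characteristic function the limit of the products
$\prod_k\psi(c_ku)$. The conclusions are then statements about such series.

HL2: for negligible weights each $\psi(c_ku)$ can be replaced by a Gaussian factor at cost
$o(c_k^2)$ (`tendsto_charFun_weightedSum`). Since $x_t^+$ uses only innovations after time $0$, it
is independent of $\mathcal F_0$ and conditioning changes nothing. The difference $x_n^--x_{t_n}^-$
is again a weighted series, and LP6(c) says that its normalised variance vanishes.

HL3: it is enough to bound $\int|\hat\mu|$ for the law $\mu$, as an integrable characteristic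
function gives a bounded density (`measure_le_smul_volume_of_charFun`). Hölder with exponents equal
to the variance shares $p_k=\sigma_\xi^2b_k^2$ reduces the product to the integrals of
$|\psi(bu)|^{1/(\sigma_\xi^2b^2)}$, which are bounded uniformly in $b$
(`exists_bound_lintegral_charFun_rpow`). At early dates, where weights need not be negligible, LP4
supplies $\theta$ weights bounded below, and Hölder with exponents $1/\theta$ applies.

HL4: a conditional Efron–Stein inequality (`integral_sub_condExp_sq_le`). Removing $\xi_j$ with
$j\ge1$ moves $\sum_tg(\beta_n^{-1}x_t)$ by at most $K\beta_n^{-1}\sum_k|a_k||\xi_j|$, so the mean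
square error of the average is at most $K^2\sigma_\xi^2$ times the square of the quantity in LP5.

HL5: moments and exponential moments of partial sums are bounded by adding one independent centred
term at a time, in terms of $\sum c_k^2$ alone; LP7 bounds that sum and Fatou passes to the series.
-/

/-- Independent, centred, square-integrable random variables with common law `ν`. -/
structure IsWhiteNoise {Ω : Type*} [MeasurableSpace Ω] (P : Measure Ω) (ν : Measure ℝ)
    (η : ℕ → Ω → ℝ) : Prop where
  measurable : ∀ k, Measurable (η k)
  indep : iIndepFun η P
  map_eq : ∀ k, P.map (η k) = ν
  memLp_id : MemLp id 2 ν
  mean_zero : ∫ x, x ∂ν = 0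

/-- The partial sums of `∑ c_k η_k` converge almost surely to `X`. -/
def IsWeightedSum {Ω : Type*} [MeasurableSpace Ω] (P : Measure Ω) (η : ℕ → Ω → ℝ) (c : ℕ → ℝ)
    (X : Ω → ℝ) : Prop :=
  ∀ᵐ ω ∂P, Tendsto (fun N => ∑ k ∈ Finset.range N, c k * η k ω) atTop (𝓝 (X ω))

/-! ### Weighted series of white noise: convergence, second moments, characteristic functions. -/

section WhiteNoise

variable {Ω : Type*} [mΩ : MeasurableSpace Ω] {P : Measure Ω} [IsProbabilityMeasure P]
  {ν : Measure ℝ} {η : ℕ → Ω → ℝ} {c : ℕ → ℝ} {X : Ω → ℝ}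

namespace IsWhiteNoise

lemma isProbabilityMeasure (h : IsWhiteNoise P ν η) : IsProbabilityMeasure ν := by
  rw [← h.map_eq 0]
  exact Measure.isProbabilityMeasure_map (h.measurable 0).aemeasurable

lemma memLp_of_law (h : IsWhiteNoise P ν η) {p : ℝ≥0∞} (hp : MemLp id p ν) (k : ℕ) :
    MemLp (η k) p P := by
  have := hp
  rw [← h.map_eq k, memLp_map_measure_iff (by fun_prop) (h.measurable k).aemeasurable] at this
  simpa using this

lemma memLp (h : IsWhiteNoise P ν η) (k : ℕ) : MemLp (η k) 2 P := h.memLp_of_law h.memLp_id k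

lemma integral_comp (h : IsWhiteNoise P ν η) (k : ℕ) {f : ℝ → ℝ} (hf : Measurable f) :
    ∫ ω, f (η k ω) ∂P = ∫ x, f x ∂ν := by
  rw [← h.map_eq k, integral_map (h.measurable k).aemeasurable hf.aestronglyMeasurable]

lemma integral_eq_zero (h : IsWhiteNoise P ν η) (k : ℕ) : ∫ ω, η k ω ∂P = 0 := by
  rw [← h.mean_zero]
  exact h.integral_comp k measurable_id

lemma integral_sq (h : IsWhiteNoise P ν η) (k : ℕ) : ∫ ω, η k ω ^ 2 ∂P = ∫ x, x ^ 2 ∂ν :=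
  h.integral_comp k (f := fun x => x ^ 2) (by fun_prop)

lemma memLp_sum (h : IsWhiteNoise P ν η) (c : ℕ → ℝ) (s : Finset ℕ) :
    MemLp (fun ω => ∑ k ∈ s, c k * η k ω) 2 P :=
  memLp_finsetSum s fun k _ => (h.memLp k).const_mul (c k)

lemma measurable_sum (h : IsWhiteNoise P ν η) (c : ℕ → ℝ) (s : Finset ℕ) :
    Measurable (fun ω => ∑ k ∈ s, c k * η k ω) :=
  Finset.measurable_fun_sum s fun k _ => (h.measurable k).const_mul (c k)

lemma integral_sum (h : IsWhiteNoise P ν η) (c : ℕ → ℝ) (s : Finset ℕ) :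
    ∫ ω, ∑ k ∈ s, c k * η k ω ∂P = 0 := by
  rw [integral_finsetSum s fun k _ => ((h.memLp k).integrable one_le_two).const_mul (c k)]
  simp [integral_const_mul, h.integral_eq_zero]

lemma integral_sum_sq (h : IsWhiteNoise P ν η) (c : ℕ → ℝ) (s : Finset ℕ) :
    ∫ ω, (∑ k ∈ s, c k * η k ω) ^ 2 ∂P = (∫ x, x ^ 2 ∂ν) * ∑ k ∈ s, c k ^ 2 := by
  rw [← variance_of_integral_eq_zero (h.measurable_sum c s).aemeasurable (h.integral_sum c s)]
  have := IndepFun.variance_sum (μ := P) (X := fun k ω => c k * η k ω) (s := s)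
    (fun k _ => (h.memLp k).const_mul (c k)) (fun i _ j _ hij =>
      (h.indep.indepFun hij).comp (φ := fun x => c i * x) (ψ := fun x => c j * x)
        (by fun_prop) (by fun_prop))
  rw [show (∑ k ∈ s, fun ω => c k * η k ω) = fun ω => ∑ k ∈ s, c k * η k ω by
    ext ω; simp] at this
  rw [this, Finset.mul_sum]
  refine Finset.sum_congr rfl fun k _ => ?_
  rw [variance_const_mul, variance_of_integral_eq_zero (h.measurable k).aemeasurable
    (h.integral_eq_zero k), h.integral_sq k, mul_comm]

lemma eLpNorm_sum (h : IsWhiteNoise P ν η) (c : ℕ → ℝ) (s : Finset ℕ) :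
    eLpNorm (fun ω => ∑ k ∈ s, c k * η k ω) 2 P =
      ENNReal.ofReal √((∫ x, x ^ 2 ∂ν) * ∑ k ∈ s, c k ^ 2) := by
  rw [(h.memLp_sum c s).eLpNorm_eq_integral_rpow_norm (by simp) (by simp)]
  simp only [ENNReal.toReal_ofNat, Real.rpow_two, Real.norm_eq_abs, sq_abs]
  rw [h.integral_sum_sq, Real.sqrt_eq_rpow, one_div]

lemma second_moment_nonneg : 0 ≤ ∫ x, x ^ 2 ∂ν := integral_nonneg fun x => sq_nonneg x

/-- Square-summable weights give almost surely convergent series. -/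
theorem ae_exists_tendsto (h : IsWhiteNoise P ν η) (hc : Summable fun k => c k ^ 2) :
    ∀ᵐ ω ∂P, ∃ x, Tendsto (fun N => ∑ k ∈ Finset.range N, c k * η k ω) atTop (𝓝 x) := by
  have hsm : ∀ k, StronglyMeasurable (η k) := fun k => (h.measurable k).stronglyMeasurable
  have hint : ∀ N, Integrable (fun ω => ∑ k ∈ Finset.range N, c k * η k ω) P := fun N =>
    (h.memLp_sum c _).integrable one_le_two
  set 𝒢 := Filtration.natural η hsm with h𝒢
  -- The sums are shifted by one: the sum over `range (N + 1)` ends at `η N`, hence is `𝒢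
  -- N`-measurable, and the next increment is independent of `𝒢 N`.
  have hadapt : ∀ N, StronglyMeasurable[𝒢 N]
      (fun ω => ∑ k ∈ Finset.range (N + 1), c k * η k ω) := fun N =>
    Finset.stronglyMeasurable_fun_sum _ fun k hk =>
      (((Filtration.stronglyAdapted_natural hsm) k).mono
        (𝒢.mono (Nat.lt_succ_iff.1 (Finset.mem_range.1 hk)))).const_mul (c k)
  have hmart : Martingale (fun N ω => ∑ k ∈ Finset.range (N + 1), c k * η k ω) 𝒢 P := by
    refine martingale_nat hadapt (fun N => hint _) fun N => ?_
    have h1 : (fun ω => ∑ k ∈ Finset.range (N + 1 + 1), c k * η k ω) =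
        (fun ω => ∑ k ∈ Finset.range (N + 1), c k * η k ω) + c (N + 1) • η (N + 1) := by
      ext ω; simp [Finset.sum_range_succ _ (N + 1)]
    have hη : Integrable (η (N + 1)) P := (h.memLp _).integrable one_le_two
    simp only [h1]
    have h2 := condExp_add (hint (N + 1)) (hη.smul (c (N + 1))) (𝒢 N)
    have h3 := condExp_smul (μ := P) (c (N + 1)) (η (N + 1)) (𝒢 N)
    have h4 := iIndepFun.condExp_natural_ae_eq_of_lt hsm h.indep (Nat.lt_succ_self N)
    rw [condExp_of_stronglyMeasurable (𝒢.le N) (hadapt N) (hint _)] at h2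
    filter_upwards [h2, h3, h4] with ω w2 w3 w4
    rw [w2, Pi.add_apply, w3, Pi.smul_apply, w4, h.integral_eq_zero]
    simp
  have hbd : ∀ N, eLpNorm (fun ω => ∑ k ∈ Finset.range (N + 1), c k * η k ω) 1 P ≤
      ((√((∫ x, x ^ 2 ∂ν) * ∑' k, c k ^ 2)).toNNReal : ℝ≥0∞) := fun N => by
    refine (eLpNorm_le_eLpNorm_of_exponent_le one_le_two
      (h.measurable_sum c _).aestronglyMeasurable).trans ?_
    rw [h.eLpNorm_sum]
    refine ENNReal.ofReal_le_ofReal (Real.sqrt_le_sqrt ?_)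
    exact mul_le_mul_of_nonneg_left (hc.sum_le_tsum _ fun k _ => sq_nonneg _)
      second_moment_nonneg
  filter_upwards [hmart.submartingale.ae_tendsto_limitProcess hbd] with ω hω
  exact ⟨_, (tendsto_add_atTop_iff_nat 1).1 hω⟩

end IsWhiteNoise

namespace IsWeightedSum

lemma aemeasurable (hX : IsWeightedSum P η c X) (h : IsWhiteNoise P ν η) : AEMeasurable X P :=
  aemeasurable_of_tendsto_metrizable_ae atTop (fun _ => (h.measurable_sum c _).aemeasurable) hX

/-- Fatou along the partial sums beyond `M`. The case `M = 0` already gives square-integrability of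
the limit. -/
lemma eLpNorm_sub_le (hX : IsWeightedSum P η c X) (h : IsWhiteNoise P ν η)
    (hc : Summable fun k => c k ^ 2) (M : ℕ) :
    eLpNorm (fun ω => X ω - ∑ k ∈ Finset.range M, c k * η k ω) 2 P ≤
      ENNReal.ofReal √((∫ x, x ^ 2 ∂ν) * (∑' k, c k ^ 2 - ∑ k ∈ Finset.range M, c k ^ 2)) := by
  refine (Lp.eLpNorm_lim_le_liminf_eLpNorm
    (f := fun N ω => ∑ k ∈ Finset.range N, c k * η k ω - ∑ k ∈ Finset.range M, c k * η k ω)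
    (fun N => ((h.measurable_sum c _).sub (h.measurable_sum c _)).aestronglyMeasurable) _
    (hX.mono fun ω hω => hω.sub_const _)).trans ?_
  refine (liminf_le_liminf (v := fun _ : ℕ => ENNReal.ofReal √((∫ x, x ^ 2 ∂ν) *
    (∑' k, c k ^ 2 - ∑ k ∈ Finset.range M, c k ^ 2))) ?_).trans (by simp)
  filter_upwards [eventually_ge_atTop M] with N hN
  have h1 : (fun ω => ∑ k ∈ Finset.range N, c k * η k ω - ∑ k ∈ Finset.range M, c k * η k ω) =
      fun ω => ∑ k ∈ Finset.Ico M N, c k * η k ω := by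
    ext ω; rw [Finset.sum_Ico_eq_sub _ hN]
  rw [h1, h.eLpNorm_sum, Finset.sum_Ico_eq_sub _ hN]
  refine ENNReal.ofReal_le_ofReal (Real.sqrt_le_sqrt (mul_le_mul_of_nonneg_left ?_
    IsWhiteNoise.second_moment_nonneg))
  gcongr
  exact hc.sum_le_tsum _ fun k _ => sq_nonneg _

lemma tendsto_eLpNorm_sub (hX : IsWeightedSum P η c X) (h : IsWhiteNoise P ν η)
    (hc : Summable fun k => c k ^ 2) :
    Tendsto (fun M => eLpNorm (fun ω => X ω - ∑ k ∈ Finset.range M, c k * η k ω) 2 P) atTop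
      (𝓝 0) := by
  refine tendsto_of_tendsto_of_tendsto_of_le_of_le tendsto_const_nhds ?_ (fun _ => zero_le)
    (hX.eLpNorm_sub_le h hc)
  have h1 : Tendsto (fun M => (∫ x, x ^ 2 ∂ν) *
      (∑' k, c k ^ 2 - ∑ k ∈ Finset.range M, c k ^ 2)) atTop (𝓝 0) := by
    have h2 := (hc.hasSum.tendsto_sum_nat.const_sub (∑' k, c k ^ 2)).const_mul (∫ x, x ^ 2 ∂ν)
    rwa [sub_self, mul_zero] at h2
  simpa using ENNReal.tendsto_ofReal h1.sqrt

lemma memLp (hX : IsWeightedSum P η c X) (h : IsWhiteNoise P ν η)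
    (hc : Summable fun k => c k ^ 2) : MemLp X 2 P := by
  refine ⟨(hX.aemeasurable h).aestronglyMeasurable, ?_⟩
  have := hX.eLpNorm_sub_le h hc 0
  simp only [Finset.range_zero, Finset.sum_empty, sub_zero] at this
  exact this.trans_lt ENNReal.ofReal_lt_top

lemma integral_eq_zero (hX : IsWeightedSum P η c X) (h : IsWhiteNoise P ν η)
    (hc : Summable fun k => c k ^ 2) : ∫ ω, X ω ∂P = 0 := by
  have h1 : Tendsto (fun M => ∫ ω, ∑ k ∈ Finset.range M, c k * η k ω ∂P) atTop
      (𝓝 (∫ ω, X ω ∂P)) := by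
    refine tendsto_integral_of_L1' X ((hX.memLp h hc).integrable one_le_two).aestronglyMeasurable
      (Eventually.of_forall fun M => (h.memLp_sum c _).integrable one_le_two) ?_
    refine tendsto_of_tendsto_of_tendsto_of_le_of_le tendsto_const_nhds
      (hX.tendsto_eLpNorm_sub h hc) (fun _ => zero_le) fun M => ?_
    refine (eLpNorm_sub_comm _ _ _ _).trans_le ?_
    exact eLpNorm_le_eLpNorm_of_exponent_le one_le_two
      ((hX.aemeasurable h).aestronglyMeasurable.sub (h.measurable_sum c _).aestronglyMeasurable)
  simp only [h.integral_sum] at h1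
  exact tendsto_nhds_unique h1 tendsto_const_nhds

/-- The upper bound is Fatou. For the lower bound, $\|S_N\|\le\|X\|+\|X-S_N\|$ with the last term
tending to zero. -/
lemma eLpNorm_eq (hX : IsWeightedSum P η c X) (h : IsWhiteNoise P ν η)
    (hc : Summable fun k => c k ^ 2) :
    eLpNorm X 2 P = ENNReal.ofReal √((∫ x, x ^ 2 ∂ν) * ∑' k, c k ^ 2) := by
  refine le_antisymm (by simpa using hX.eLpNorm_sub_le h hc 0) ?_
  have h1 : Tendsto (fun N => ENNReal.ofReal √((∫ x, x ^ 2 ∂ν) * ∑ k ∈ Finset.range N, c k ^ 2))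
      atTop (𝓝 (ENNReal.ofReal √((∫ x, x ^ 2 ∂ν) * ∑' k, c k ^ 2))) :=
    ENNReal.tendsto_ofReal (hc.hasSum.tendsto_sum_nat.const_mul _).sqrt
  have h2 := (hX.tendsto_eLpNorm_sub h hc).const_add (eLpNorm X 2 P)
  rw [add_zero] at h2
  refine le_of_tendsto_of_tendsto' h1 h2 fun N => ?_
  rw [← h.eLpNorm_sum]
  have hXm := (hX.aemeasurable h).aestronglyMeasurable
  have := MeasureTheory.eLpNorm_sub_le hXm
    (hXm.sub (h.measurable_sum c (Finset.range N)).aestronglyMeasurable)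
    one_le_two
  rwa [sub_sub_cancel] at this

lemma integral_sq (hX : IsWeightedSum P η c X) (h : IsWhiteNoise P ν η)
    (hc : Summable fun k => c k ^ 2) :
    ∫ ω, X ω ^ 2 ∂P = (∫ x, x ^ 2 ∂ν) * ∑' k, c k ^ 2 := by
  have h1 := hX.eLpNorm_eq h hc
  rw [(hX.memLp h hc).eLpNorm_eq_integral_rpow_norm (by simp) (by simp)] at h1
  simp only [ENNReal.toReal_ofNat, Real.rpow_two, Real.norm_eq_abs, sq_abs, ← one_div,
    ← Real.sqrt_eq_rpow] at h1
  rw [ENNReal.ofReal_eq_ofReal_iff (by positivity) (by positivity)] at h1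
  exact (Real.sqrt_inj (integral_nonneg fun ω => sq_nonneg _)
    (mul_nonneg IsWhiteNoise.second_moment_nonneg (tsum_nonneg fun k => sq_nonneg _))).1 h1

/-- Independence turns the characteristic function of a partial sum into a product; dominated
convergence applies because the integrands have modulus one. -/
lemma tendsto_charFun (hX : IsWeightedSum P η c X) (h : IsWhiteNoise P ν η) (u : ℝ) :
    Tendsto (fun N => ∏ k ∈ Finset.range N, charFun ν (c k * u)) atTop
      (𝓝 (charFun (P.map X) u)) := by
  have h1 : ∀ N, ∏ k ∈ Finset.range N, charFun ν (c k * u) =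
      ∫ ω, Complex.exp (u * (∑ k ∈ Finset.range N, c k * η k ω : ℝ) * Complex.I) ∂P := fun N => by
    have h2 := iIndepFun.charFun_map_fun_finsetSum_eq_prod (P := P) (s := Finset.range N)
      (X := fun k ω => c k * η k ω) (fun k _ => ((h.measurable k).const_mul (c k)).aemeasurable)
      ((h.indep.comp (fun k x => c k * x) fun k => by fun_prop).restrict _)
    have h3 := congrFun h2 u
    rw [charFun_apply_real, integral_map (h.measurable_sum c _).aemeasurable (by fun_prop)] at h3
    rw [h3, Finset.prod_apply]
    refine Finset.prod_congr rfl fun k _ => ?_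
    rw [charFun_map_mul_comp (h.measurable k).aemeasurable, h.map_eq]
  simp only [h1]
  rw [charFun_apply_real, integral_map (hX.aemeasurable h) (by fun_prop)]
  refine tendsto_integral_of_dominated_convergence (fun _ => 1) (fun N => ?_)
    (integrable_const 1) (fun N => Eventually.of_forall fun ω => ?_) ?_
  · have := h.measurable_sum c (Finset.range N)
    exact Measurable.aestronglyMeasurable (by fun_prop)
  · rw [← Complex.ofReal_mul, Complex.norm_exp_ofReal_mul_I]
  · filter_upwards [hX] with ω hω
    exact ((Complex.continuous_exp.comp (by fun_prop : Continuous fun x : ℝ =>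
      (u : ℂ) * (x : ℂ) * Complex.I)).tendsto (X ω)).comp hω

lemma const_mul (hX : IsWeightedSum P η c X) (r : ℝ) :
    IsWeightedSum P η (fun k => r * c k) (fun ω => r * X ω) := by
  filter_upwards [hX] with ω hω
  simpa only [mul_assoc, Finset.mul_sum] using hω.const_mul r

lemma sub {c' : ℕ → ℝ} {X' : Ω → ℝ} (hX : IsWeightedSum P η c X) (hX' : IsWeightedSum P η c' X') :
    IsWeightedSum P η (fun k => c k - c' k) (fun ω => X ω - X' ω) := by
  filter_upwards [hX, hX'] with ω hω hω'
  simpa only [sub_mul, Finset.sum_sub_distrib] using hω.sub hω'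

end IsWeightedSum

end WhiteNoise

/-! ### Second-order expansion of characteristic functions at the origin. -/

section CharFun

variable {ν : Measure ℝ} [IsProbabilityMeasure ν]

lemma charFun_sub_quadratic_isLittleO (hν : MemLp id 2 ν) (h0 : ∫ x, x ∂ν = 0) :
    (fun t : ℝ => charFun ν t - (1 - ((∫ x, x ^ 2 ∂ν : ℝ) : ℂ) * t ^ 2 / 2)) =o[𝓝 0]
      fun t : ℝ => t ^ 2 := by
  have h1 : ∀ t : ℝ, 1 - ((∫ x, x ^ 2 ∂ν : ℝ) : ℂ) * t ^ 2 / 2 =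
      taylorWithinEval (charFun ν) 2 Set.univ 0 t := fun t => by
    have := taylorWithinEval_charFun_two_zero (P := ν) (X := id) aemeasurable_id
      (by simpa using hν) t
    simp only [Measure.map_id, id_eq, h0, Pi.pow_apply] at this
    rw [this]; simp
  simp only [h1]
  have h2 := taylor_isLittleO_univ (f := charFun ν) (x₀ := 0) (n := 2)
    (by exact_mod_cast contDiff_charFun hν)
  simpa using h2

/-- The Gaussian law with the same variance has the same second-order Taylor polynomial. -/
lemma charFun_sub_gaussian_isLittleO (hν : MemLp id 2 ν) (h0 : ∫ x, x ∂ν = 0) :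
    (fun t : ℝ => charFun ν t - charFun (gaussianReal 0 (∫ x, x ^ 2 ∂ν).toNNReal) t) =o[𝓝 0]
      fun t : ℝ => t ^ 2 := by
  set w := (∫ x, x ^ 2 ∂ν).toNNReal with hw
  have hv : (w : ℝ) = ∫ x, x ^ 2 ∂ν := Real.coe_toNNReal _ (integral_nonneg fun x => sq_nonneg x)
  have hg0 : ∫ x, x ∂(gaussianReal 0 w) = 0 := by simp
  have hg := charFun_sub_quadratic_isLittleO (ν := gaussianReal 0 w)
    (memLp_id_gaussianReal 2) hg0
  have hgv : ∫ x, x ^ 2 ∂(gaussianReal 0 w) = w := by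
    rw [← variance_id_gaussianReal (μ := 0) (v := w),
      variance_of_integral_eq_zero aemeasurable_id (by simp)]
    rfl
  rw [hgv, hv] at hg
  refine ((charFun_sub_quadratic_isLittleO hν h0).sub hg).congr_left fun t => ?_
  ring

/-- Factors of modulus at most one are exchanged one at a time, and the errors add up. -/
lemma norm_prod_sub_prod_le {ι : Type*} (s : Finset ι) (f g : ι → ℂ)
    (hf : ∀ i ∈ s, ‖f i‖ ≤ 1) (hg : ∀ i ∈ s, ‖g i‖ ≤ 1) :
    ‖∏ i ∈ s, f i - ∏ i ∈ s, g i‖ ≤ ∑ i ∈ s, ‖f i - g i‖ := by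
  classical
  induction s using Finset.induction_on with
  | empty => simp
  | insert i s hi ih =>
    rw [Finset.prod_insert hi, Finset.prod_insert hi, Finset.sum_insert hi]
    have h1 : f i * ∏ j ∈ s, f j - g i * ∏ j ∈ s, g j =
        (f i - g i) * ∏ j ∈ s, f j + g i * (∏ j ∈ s, f j - ∏ j ∈ s, g j) := by ring
    rw [h1]
    have h2 : ‖∏ j ∈ s, f j‖ ≤ 1 := by
      rw [norm_prod]
      exact Finset.prod_le_one (fun _ _ => norm_nonneg _) fun j hj =>
        hf j (Finset.mem_insert_of_mem hj)
    refine (norm_add_le _ _).trans (add_le_add ?_ ?_)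
    · rw [norm_mul]
      exact mul_le_of_le_one_right (norm_nonneg _) h2
    · rw [norm_mul]
      exact (mul_le_of_le_one_left (norm_nonneg _) (hg i (Finset.mem_insert_self _ _))).trans
        (ih (fun j hj => hf j (Finset.mem_insert_of_mem hj))
          fun j hj => hg j (Finset.mem_insert_of_mem hj))

end CharFun

/-! ### Central limit theorem for weighted series. -/

section CentralLimit

variable {Ω : Type*} [mΩ : MeasurableSpace Ω] {P : Measure Ω} [IsProbabilityMeasure P]
  {ν : Measure ℝ}

/-- Central limit theorem for weighted series of white noise with negligible weights, stated for
characteristic functions. -/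
theorem tendsto_charFun_weightedSum {η : ℕ → ℕ → Ω → ℝ} {c : ℕ → ℕ → ℝ} {X : ℕ → Ω → ℝ} {s : ℝ}
    (h : ∀ᶠ n in atTop, IsWhiteNoise P ν (η n)) (hv : 0 < ∫ x, x ^ 2 ∂ν)
    (hX : ∀ᶠ n in atTop, IsWeightedSum P (η n) (c n) (X n))
    (hc : ∀ᶠ n in atTop, Summable fun k => c n k ^ 2)
    (hs : Tendsto (fun n => (∫ x, x ^ 2 ∂ν) * ∑' k, c n k ^ 2) atTop (𝓝 (s ^ 2)))
    (hmax : ∀ ε : ℝ, 0 < ε → ∀ᶠ n in atTop, ∀ k, |c n k| ≤ ε) (u : ℝ) :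
    Tendsto (fun n => charFun (P.map (X n)) u) atTop
      (𝓝 (charFun (gaussianReal 0 (s ^ 2).toNNReal) u)) := by
  obtain ⟨n₀, hn₀⟩ := h.exists
  have := hn₀.isProbabilityMeasure
  set v := ∫ x, x ^ 2 ∂ν with hvdef
  have hlim : Tendsto (fun n => Complex.exp (-((v * ∑' k, c n k ^ 2 : ℝ) : ℂ) * u ^ 2 / 2)) atTop
      (𝓝 (charFun (gaussianReal 0 (s ^ 2).toNNReal) u)) := by
    rw [charFun_gaussianReal]
    have h1 : Continuous fun x : ℝ => Complex.exp (-(x : ℂ) * u ^ 2 / 2) := by fun_prop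
    convert! (h1.tendsto (s ^ 2)).comp hs using 2
    rw [Real.coe_toNNReal _ (sq_nonneg s)]
    congr 1; push_cast; ring
  have hdiff : Tendsto (fun n => charFun (P.map (X n)) u -
      Complex.exp (-((v * ∑' k, c n k ^ 2 : ℝ) : ℂ) * u ^ 2 / 2)) atTop (𝓝 0) := by
    rw [Metric.tendsto_nhds]
    intro ε hε
    -- Chosen so that the total error $\varepsilon'u^2\sum c_k^2\le\varepsilon'u^2(s^2+1)/v$ equals
    -- $\varepsilon\,u^2/(2(u^2+1))<\varepsilon$ in the worst case.
    set ε' := ε * v / (2 * (s ^ 2 + 1) * (u ^ 2 + 1)) with hε'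
    have hε'pos : 0 < ε' := by positivity
    have hlo := (charFun_sub_gaussian_isLittleO hn₀.memLp_id hn₀.mean_zero).def hε'pos
    obtain ⟨δ, hδ, hδ'⟩ := Metric.eventually_nhds_iff.1 hlo
    filter_upwards [h, hX, hc, hs.eventually_le_const (lt_add_one (s ^ 2)),
      hmax (δ / (|u| + 1)) (by positivity)] with n hn hXn hcn hsn hmn
    -- The bound does not depend on `N`, so it survives the passage from partial sums to the series.
    -- The bound $\delta/(|u|+1)$ on the weights keeps every $c_ku$ within the range $\delta$ of the
    -- expansion.
    have hstep : ∀ N, ‖∏ k ∈ Finset.range N, charFun ν (c n k * u) -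
        Complex.exp (-((v * ∑ k ∈ Finset.range N, c n k ^ 2 : ℝ) : ℂ) * u ^ 2 / 2)‖ ≤
        ε' * u ^ 2 * ∑' k, c n k ^ 2 := fun N => by
      have h2 : Complex.exp (-((v * ∑ k ∈ Finset.range N, c n k ^ 2 : ℝ) : ℂ) * u ^ 2 / 2) =
          ∏ k ∈ Finset.range N, charFun (gaussianReal 0 v.toNNReal) (c n k * u) := by
        simp only [charFun_gaussianReal]
        rw [← Complex.exp_sum, Real.coe_toNNReal _ hv.le]
        congr 1
        push_cast
        rw [Finset.mul_sum, ← Finset.sum_neg_distrib, Finset.sum_mul, Finset.sum_div]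
        refine Finset.sum_congr rfl fun k _ => ?_
        ring
      rw [h2]
      refine (norm_prod_sub_prod_le _ _ _ (fun k _ => norm_charFun_le_one _)
        fun k _ => norm_charFun_le_one _).trans ?_
      refine (Finset.sum_le_sum (g := fun k => ε' * u ^ 2 * c n k ^ 2) fun k _ => ?_).trans ?_
      · have h3 : dist (c n k * u) 0 < δ := by
          rw [dist_zero_right, Real.norm_eq_abs, abs_mul]
          calc |c n k| * |u| ≤ δ / (|u| + 1) * |u| := by gcongr; exact hmn k
            _ < δ := by
              rw [div_mul_eq_mul_div, div_lt_iff₀ (by positivity)]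
              nlinarith [abs_nonneg u]
        have h4 := hδ' h3
        rw [Real.norm_eq_abs, abs_of_nonneg (sq_nonneg _)] at h4
        refine h4.trans (le_of_eq ?_)
        ring
      · rw [← Finset.mul_sum]
        exact mul_le_mul_of_nonneg_left (hcn.sum_le_tsum _ fun k _ => sq_nonneg _)
          (by positivity)
    have hlim2 : Tendsto (fun N =>
        Complex.exp (-((v * ∑ k ∈ Finset.range N, c n k ^ 2 : ℝ) : ℂ) * u ^ 2 / 2)) atTop
        (𝓝 (Complex.exp (-((v * ∑' k, c n k ^ 2 : ℝ) : ℂ) * u ^ 2 / 2))) := by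
      have h1 : Continuous fun x : ℝ => Complex.exp (-(x : ℂ) * u ^ 2 / 2) := by fun_prop
      exact (h1.tendsto _).comp (hcn.hasSum.tendsto_sum_nat.const_mul v)
    have hfin := le_of_tendsto ((hXn.tendsto_charFun hn u).sub hlim2).norm
      (Eventually.of_forall hstep)
    rw [dist_zero_right]
    refine hfin.trans_lt ?_
    have h5 : ∑' k, c n k ^ 2 ≤ (s ^ 2 + 1) / v := by
      rw [le_div_iff₀ hv, mul_comm]; exact hsn
    calc ε' * u ^ 2 * ∑' k, c n k ^ 2 ≤ ε' * u ^ 2 * ((s ^ 2 + 1) / v) := by gcongr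
      _ = ε * (u ^ 2 / (2 * (u ^ 2 + 1))) := by rw [hε']; field_simp
      _ < ε * 1 := by
        gcongr
        rw [div_lt_one (by positivity)]
        nlinarith [sq_nonneg u]
      _ = ε := mul_one ε
  simpa using hdiff.add hlim

end CentralLimit

/-! ### Moments and exponential moments of weighted series. -/

/-- The linear term is kept exact so that it can vanish in expectation. For $|z|\le1/p$ use
$(1+z)^p\le e^{pz}$ and expand; for larger $|z|$, $|1+z|\le(p+1)|z|$, and $p^2z^2$ outweighs a
negative linear term. -/
lemma abs_one_add_rpow_le {p : ℝ} (hp : 2 ≤ p) (z : ℝ) :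
    |1 + z| ^ p ≤ 1 + p * z + ((p + 1) ^ p + p ^ 2) * (z ^ 2 + |z| ^ p) := by
  have hp0 : 0 < p := by linarith
  have hz : 0 ≤ |z| ^ p := by positivity
  have hC : 0 ≤ (p + 1) ^ p := by positivity
  rcases le_or_gt (|z|) (1 / p) with h | h
  · have h1 : |p * z| ≤ 1 := by
      rw [abs_mul, abs_of_pos hp0]
      rwa [le_div_iff₀' hp0] at h
    have hz1 : |z| ≤ 1 := h.trans (by rw [div_le_one hp0]; linarith)
    have h2 : 0 ≤ 1 + z := by linarith [neg_abs_le z]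
    have h3 := (abs_le.1 (Real.abs_exp_sub_one_sub_id_le h1)).2
    calc |1 + z| ^ p ≤ Real.exp z ^ p := by
          rw [abs_of_nonneg h2]
          exact Real.rpow_le_rpow h2 (by linarith [Real.add_one_le_exp z]) hp0.le
      _ = Real.exp (p * z) := by rw [← Real.exp_mul, mul_comm]
      _ ≤ 1 + p * z + p ^ 2 * z ^ 2 := by linarith [mul_pow p z 2]
      _ ≤ _ := by nlinarith [sq_nonneg z, mul_nonneg hC (sq_nonneg z), mul_nonneg hC hz,
          mul_nonneg (sq_nonneg p) hz]
  · have h1 : 1 ≤ p * |z| := by rw [div_lt_iff₀' hp0] at h; exact h.le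
    have h2 : |1 + z| ≤ (p + 1) * |z| := by
      calc |1 + z| ≤ |1| + |z| := abs_add_le _ _
        _ ≤ (p + 1) * |z| := by rw [abs_one]; linarith
    have h3 : |1 + z| ^ p ≤ (p + 1) ^ p * |z| ^ p := by
      rw [← Real.mul_rpow (by linarith) (abs_nonneg z)]
      exact Real.rpow_le_rpow (abs_nonneg _) h2 hp0.le
    have h4 : -(p * z) ≤ p ^ 2 * z ^ 2 := by
      have : -(p * z) ≤ p * |z| := by nlinarith [neg_abs_le z]
      have h5 : p * |z| ≤ (p * |z|) ^ 2 := by nlinarith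
      rw [mul_pow, sq_abs] at h5
      linarith
    nlinarith [mul_nonneg hC (sq_nonneg z), mul_nonneg (sq_nonneg p) hz]

lemma abs_add_rpow_le {p : ℝ} (hp : 2 ≤ p) (x y : ℝ) :
    |x + y| ^ p ≤ |x| ^ p + p * (|x| ^ (p - 2) * x * y) +
      ((p + 1) ^ p + p ^ 2) * (|x| ^ (p - 2) * y ^ 2 + |y| ^ p) := by
  have hp0 : 0 < p := by linarith
  -- Scaling by `x` fails at zero. There `|0| ^ (p - 2)` is `1` when `p = 2`, so only its
  -- nonnegativity is used.
  rcases eq_or_ne x 0 with rfl | hx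
  · have h1 : (1 : ℝ) ≤ (p + 1) ^ p := Real.one_le_rpow (by linarith) hp0.le
    have h2 : 0 ≤ |y| ^ p := by positivity
    have h3 : 0 ≤ |(0 : ℝ)| ^ (p - 2) * y ^ 2 := by positivity
    rw [zero_add, abs_zero, Real.zero_rpow hp0.ne']
    rw [abs_zero] at h3
    nlinarith [sq_nonneg p, mul_nonneg (sq_nonneg p) h2, mul_nonneg (sq_nonneg p) h3]
  · have hx' : 0 < |x| := abs_pos.2 hx
    have h1 := mul_le_mul_of_nonneg_left (abs_one_add_rpow_le hp (y / x))
      (Real.rpow_nonneg hx'.le p)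
    have h2 : |x| ^ p = |x| ^ (p - 2) * x ^ 2 := by
      rw [← sq_abs x, ← Real.rpow_two, ← Real.rpow_add hx']; congr 1; ring
    have h3 : |x| ^ p * |1 + y / x| ^ p = |x + y| ^ p := by
      rw [← Real.mul_rpow hx'.le (abs_nonneg _), ← abs_mul]
      congr 2; field_simp
    have h4 : |x| ^ p * |y / x| ^ p = |y| ^ p := by
      rw [← Real.mul_rpow hx'.le (abs_nonneg _), ← abs_mul]
      congr 2; field_simp
    rw [h3] at h1
    refine h1.trans (le_of_eq ?_)
    have h5 : |x| ^ p * (1 + p * (y / x) + ((p + 1) ^ p + p ^ 2) * ((y / x) ^ 2 + |y / x| ^ p)) =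
        |x| ^ p + p * (|x| ^ p * (y / x)) + ((p + 1) ^ p + p ^ 2) *
          (|x| ^ p * (y / x) ^ 2 + |x| ^ p * |y / x| ^ p) := by ring
    rw [h5, h4]
    have h6 : |x| ^ p * (y / x) = |x| ^ (p - 2) * x * y := by rw [h2]; field_simp
    have h7 : |x| ^ p * (y / x) ^ 2 = |x| ^ (p - 2) * y ^ 2 := by rw [h2]; field_simp
    rw [h6, h7]

lemma rpow_le_one_add_rpow {q p t : ℝ} (ht : 0 ≤ t) (hq : 0 ≤ q) (hqp : q ≤ p) :
    t ^ q ≤ 1 + t ^ p := by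
  rcases le_total t 1 with h | h
  · linarith [Real.rpow_le_one ht h hq, Real.rpow_nonneg ht p]
  · linarith [Real.rpow_le_rpow_of_exponent_le h hqp]

/-- Again the linear term is exact, so a centred variable contributes only at second order; the
factor `Real.exp |y|` makes the bound global. -/
lemma exp_le_one_add_add_sq_mul_exp_abs (y : ℝ) :
    Real.exp y ≤ 1 + y + y ^ 2 * Real.exp |y| := by
  have h1 : 1 ≤ Real.exp |y| := Real.one_le_exp (abs_nonneg y)
  rcases le_or_gt (|y|) 1 with h | h
  · have := (abs_le.1 (Real.abs_exp_sub_one_sub_id_le h)).2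
    nlinarith [sq_nonneg y]
  · rcases lt_abs.1 h with h2 | h2
    · rw [abs_of_pos (by linarith)] at h1 ⊢
      have : 1 * Real.exp y ≤ y ^ 2 * Real.exp y := by gcongr; nlinarith
      linarith
    · have : Real.exp y ≤ 1 := Real.exp_le_one_iff.2 (by linarith)
      nlinarith

section Moments

variable {Ω : Type*} [mΩ : MeasurableSpace Ω] {P : Measure Ω} [IsProbabilityMeasure P]
  {ν : Measure ℝ}

/-- One step of the recursion for moments of sums of independent centred variables. -/
lemma integral_abs_add_rpow_le {p : ℝ} (hp : 2 ≤ p) {S Y : Ω → ℝ} (hS : Measurable S)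
    (hY : Measurable Y) (hSp : Integrable (fun ω => |S ω| ^ p) P)
    (hYp : Integrable (fun ω => |Y ω| ^ p) P) (hSY : IndepFun S Y P) (hY0 : ∫ ω, Y ω ∂P = 0) :
    ∫ ω, |S ω + Y ω| ^ p ∂P ≤ ∫ ω, |S ω| ^ p ∂P + ((p + 1) ^ p + p ^ 2) *
      ((1 + ∫ ω, |S ω| ^ p ∂P) * ∫ ω, Y ω ^ 2 ∂P + ∫ ω, |Y ω| ^ p ∂P) := by
  have hp0 : 0 < p := by linarith
  have hYp1 : Integrable (fun ω => 1 + |Y ω| ^ p) P := (integrable_const 1).add hYp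
  have hSp1 : Integrable (fun ω => 1 + |S ω| ^ p) P := (integrable_const 1).add hSp
  have hY1 : Integrable Y P := by
    refine hYp1.mono' hY.aestronglyMeasurable (Eventually.of_forall fun ω => ?_)
    have := rpow_le_one_add_rpow (abs_nonneg (Y ω)) zero_le_one (by linarith : (1 : ℝ) ≤ p)
    simpa using this
  have hY2 : Integrable (fun ω => Y ω ^ 2) P := by
    refine hYp1.mono' (hY.pow_const 2).aestronglyMeasurable
      (Eventually.of_forall fun ω => ?_)
    have := rpow_le_one_add_rpow (abs_nonneg (Y ω)) zero_le_two hp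
    rw [Real.rpow_two, sq_abs] at this
    simpa using this
  have hS2 : Integrable (fun ω => |S ω| ^ (p - 2)) P := by
    refine hSp1.mono' (hS.abs.pow_const _).aestronglyMeasurable
      (Eventually.of_forall fun ω => ?_)
    rw [Real.norm_of_nonneg (by positivity)]
    exact rpow_le_one_add_rpow (abs_nonneg (S ω)) (by linarith) (by linarith)
  have hS1 : Integrable (fun ω => |S ω| ^ (p - 2) * S ω) P := by
    refine hSp1.mono' ((hS.abs.pow_const _).mul hS).aestronglyMeasurable
      (Eventually.of_forall fun ω => ?_)
    rw [norm_mul, Real.norm_of_nonneg (by positivity), Real.norm_eq_abs]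
    rcases (abs_nonneg (S ω)).eq_or_lt with h | h
    · rw [← h, mul_zero]; positivity
    · nth_rewrite 2 [← Real.rpow_one |S ω|]
      rw [← Real.rpow_add h]
      exact rpow_le_one_add_rpow (abs_nonneg (S ω)) (by linarith) (by linarith)
  have hi1 : IndepFun (fun ω => |S ω| ^ (p - 2) * S ω) Y P :=
    hSY.comp (φ := fun x => |x| ^ (p - 2) * x) (ψ := fun x => x) (by fun_prop) measurable_id
  have hi2 : IndepFun (fun ω => |S ω| ^ (p - 2)) (fun ω => Y ω ^ 2) P :=
    hSY.comp (φ := fun x => |x| ^ (p - 2)) (ψ := fun x => x ^ 2) (by fun_prop) (by fun_prop)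
  have hI1 : Integrable (fun ω => |S ω| ^ (p - 2) * S ω * Y ω) P := hi1.integrable_mul hS1 hY1
  have hI2 : Integrable (fun ω => |S ω| ^ (p - 2) * Y ω ^ 2) P := hi2.integrable_mul hS2 hY2
  -- The first-order term vanishes by independence and centring.
  have he1 : ∫ ω, |S ω| ^ (p - 2) * S ω * Y ω ∂P = 0 := by
    rw [hi1.integral_fun_mul_eq_mul_integral hS1.aestronglyMeasurable hY1.aestronglyMeasurable,
      hY0, mul_zero]
  -- Bounding $|S|^{p-2}$ by $1+|S|^p$ closes the recursion in the $p$-th moment alone.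
  have he2 : ∫ ω, |S ω| ^ (p - 2) * Y ω ^ 2 ∂P ≤
      (1 + ∫ ω, |S ω| ^ p ∂P) * ∫ ω, Y ω ^ 2 ∂P := by
    rw [hi2.integral_fun_mul_eq_mul_integral hS2.aestronglyMeasurable hY2.aestronglyMeasurable]
    refine mul_le_mul_of_nonneg_right ?_ (integral_nonneg fun ω => sq_nonneg _)
    have h1 : ∫ ω, (1 + |S ω| ^ p) ∂P = 1 + ∫ ω, |S ω| ^ p ∂P := by
      rw [integral_add (integrable_const _) hSp]; simp
    rw [← h1]
    exact integral_mono hS2 hSp1 fun ω =>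
      rpow_le_one_add_rpow (abs_nonneg (S ω)) (by linarith) (by linarith)
  have hR : Integrable (fun ω => |S ω| ^ p + p * (|S ω| ^ (p - 2) * S ω * Y ω) +
      ((p + 1) ^ p + p ^ 2) * (|S ω| ^ (p - 2) * Y ω ^ 2 + |Y ω| ^ p)) P :=
    (hSp.add (hI1.const_mul p)).add ((hI2.add hYp).const_mul _)
  calc ∫ ω, |S ω + Y ω| ^ p ∂P ≤ ∫ ω, (|S ω| ^ p + p * (|S ω| ^ (p - 2) * S ω * Y ω) +
      ((p + 1) ^ p + p ^ 2) * (|S ω| ^ (p - 2) * Y ω ^ 2 + |Y ω| ^ p)) ∂P :=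
        integral_mono_of_nonneg (Eventually.of_forall fun ω => by positivity) hR
          (Eventually.of_forall fun ω => abs_add_rpow_le hp (S ω) (Y ω))
    _ = ∫ ω, |S ω| ^ p ∂P + p * ∫ ω, |S ω| ^ (p - 2) * S ω * Y ω ∂P + ((p + 1) ^ p + p ^ 2) *
        (∫ ω, |S ω| ^ (p - 2) * Y ω ^ 2 ∂P + ∫ ω, |Y ω| ^ p ∂P) := by
      have e1 : ∫ ω, (|S ω| ^ (p - 2) * Y ω ^ 2 + |Y ω| ^ p) ∂P =
          ∫ ω, |S ω| ^ (p - 2) * Y ω ^ 2 ∂P + ∫ ω, |Y ω| ^ p ∂P := integral_add hI2 hYp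
      have e2 : ∫ ω, (|S ω| ^ p + p * (|S ω| ^ (p - 2) * S ω * Y ω)) ∂P =
          ∫ ω, |S ω| ^ p ∂P + ∫ ω, p * (|S ω| ^ (p - 2) * S ω * Y ω) ∂P :=
        integral_add hSp (hI1.const_mul p)
      rw [integral_const_mul] at e2
      have e3 := integral_add (hSp.add (hI1.const_mul p))
        ((hI2.add hYp).const_mul ((p + 1) ^ p + p ^ 2))
      simp only [Pi.add_apply] at e3
      rw [e3, e2, integral_const_mul, e1]
    _ ≤ _ := by
      rw [he1, mul_zero, add_zero]
      have : 0 ≤ (p + 1) ^ p + p ^ 2 := by positivity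
      gcongr

lemma IsWhiteNoise.integrable_abs_sum_rpow {η : ℕ → Ω → ℝ} (h : IsWhiteNoise P ν η) {p : ℝ}
    (hp : 2 ≤ p) (hν : Integrable (fun x => |x| ^ p) ν) (c : ℕ → ℝ) (s : Finset ℕ) :
    Integrable (fun ω => |∑ k ∈ s, c k * η k ω| ^ p) P := by
  have hp0 : 0 < p := by linarith
  have h1 : MemLp id (ENNReal.ofReal p) ν := by
    rw [← integrable_norm_rpow_iff aestronglyMeasurable_id (by simpa using hp0) (by simp),
      ENNReal.toReal_ofReal hp0.le]
    simpa using hν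
  have h2 : MemLp (fun ω => ∑ k ∈ s, c k * η k ω) (ENNReal.ofReal p) P :=
    memLp_finsetSum s fun k _ => (h.memLp_of_law h1 k).const_mul (c k)
  have h3 := h2.integrable_norm_rpow (by simpa using hp0) (by simp)
  rw [ENNReal.toReal_ofReal hp0.le] at h3
  simpa using h3

/-- A Rosenthal-type bound: moments of weighted sums of white noise are bounded in terms of a
bound for the sum of the squared weights. -/
lemma exists_bound_integral_abs_sum_rpow {p : ℝ} (hp : 2 ≤ p)
    (hν : Integrable (fun x => |x| ^ p) ν) (B : ℝ) :
    ∃ K : ℝ, ∀ (η : ℕ → Ω → ℝ) (c : ℕ → ℝ) (N : ℕ), IsWhiteNoise P ν η →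
      ∑ k ∈ Finset.range N, c k ^ 2 ≤ B →
        ∫ ω, |∑ k ∈ Finset.range N, c k * η k ω| ^ p ∂P ≤ K := by
  have hp0 : 0 < p := by linarith
  set C := (p + 1) ^ p + p ^ 2 with hCdef
  have hC : 0 ≤ C := by positivity
  set v := ∫ x, x ^ 2 ∂ν
  have hv : 0 ≤ v := IsWhiteNoise.second_moment_nonneg
  set κ := ∫ x, |x| ^ p ∂ν
  have hκ : 0 ≤ κ := integral_nonneg fun x => by positivity
  set A := (1 + |B|) ^ (p - 2)
  have hA : 0 ≤ A := by positivity
  set D := C * (v + A * κ) with hD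
  have hD0 : 0 ≤ D := by positivity
  -- The quantity $1+E|S_N|^p$ is multiplied at each step by at most $1+Dc_N^2\le e^{Dc_N^2}$, so
  -- the induction produces an exponential of the sum of squares.
  have main : ∀ (η : ℕ → Ω → ℝ) (c : ℕ → ℝ), IsWhiteNoise P ν η → ∀ N,
      ∑ k ∈ Finset.range N, c k ^ 2 ≤ B →
      1 + ∫ ω, |∑ k ∈ Finset.range N, c k * η k ω| ^ p ∂P ≤
        Real.exp (D * ∑ k ∈ Finset.range N, c k ^ 2) := by
    intro η c h N
    induction N with
    | zero => simp [Real.zero_rpow hp0.ne']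
    | succ N ih =>
      intro hB
      rw [Finset.sum_range_succ] at hB
      have hN0 : 0 ≤ ∑ k ∈ Finset.range N, c k ^ 2 := Finset.sum_nonneg fun k _ => sq_nonneg _
      have ih' := ih (by nlinarith [sq_nonneg (c N)])
      set m := ∫ ω, |∑ k ∈ Finset.range N, c k * η k ω| ^ p ∂P with hm
      have hm0 : 0 ≤ m := integral_nonneg fun ω => by positivity
      -- The bound on the sum of squares bounds each weight by $1+|B|$; hence $|c|^p$ is absorbed
      -- into a multiple of $c^2$.
      have hcp : |c N| ^ p ≤ A * c N ^ 2 := by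
        have h1 : |c N| ≤ 1 + |B| := by
          have : c N ^ 2 ≤ |B| := by linarith [le_abs_self B]
          rw [← sq_abs] at this
          nlinarith [abs_nonneg (c N)]
        rcases (abs_nonneg (c N)).eq_or_lt with h0 | h0
        · rw [← h0, Real.zero_rpow hp0.ne']; positivity
        · have : |c N| ^ p = |c N| ^ (p - 2) * c N ^ 2 := by
            rw [← sq_abs (c N), ← Real.rpow_two, ← Real.rpow_add h0]; congr 1; ring
          rw [this]
          exact mul_le_mul_of_nonneg_right (Real.rpow_le_rpow h0.le h1 (by linarith))
            (sq_nonneg _)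
      have hind : IndepFun (fun ω => ∑ k ∈ Finset.range N, c k * η k ω)
          (fun ω => c N * η N ω) P := by
        have := iIndepFun.indepFun_finsetSum_of_notMem (h.indep.comp (fun k x => c k * x)
          fun k => by fun_prop) (fun k => by have := h.measurable k; fun_prop)
          (Finset.notMem_range_self (n := N))
        convert! this using 1
        ext ω; simp
      have hYp : ∫ ω, |c N * η N ω| ^ p ∂P = |c N| ^ p * κ := by
        simp only [abs_mul, Real.mul_rpow (abs_nonneg _) (abs_nonneg _)]
        rw [integral_const_mul, h.integral_comp N (f := fun x => |x| ^ p) (by fun_prop)]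
      have hY2 : ∫ ω, (c N * η N ω) ^ 2 ∂P = c N ^ 2 * v := by
        simp only [mul_pow]
        rw [integral_const_mul, h.integral_sq]
      have hYi := h.integrable_abs_sum_rpow hp hν c {N}
      simp only [Finset.sum_singleton] at hYi
      have hstep := integral_abs_add_rpow_le hp (h.measurable_sum c (Finset.range N))
        ((h.measurable N).const_mul (c N))
        (h.integrable_abs_sum_rpow hp hν c _) hYi hind
        (by rw [integral_const_mul, h.integral_eq_zero, mul_zero])
      rw [hYp, hY2, ← hm] at hstep
      simp only [Finset.sum_range_succ]
      calc 1 + ∫ ω, |∑ k ∈ Finset.range N, c k * η k ω + c N * η N ω| ^ p ∂P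
          ≤ (1 + m) * (1 + D * c N ^ 2) := by
            have h1 : C * (|c N| ^ p * κ) ≤ C * (A * c N ^ 2 * κ) := by gcongr
            have h2 : 0 ≤ m * (C * (A * c N ^ 2 * κ)) := by positivity
            rw [hD]
            nlinarith
        _ ≤ Real.exp (D * ∑ k ∈ Finset.range N, c k ^ 2) * Real.exp (D * c N ^ 2) := by
            have h1 := Real.add_one_le_exp (D * c N ^ 2)
            refine mul_le_mul ih' (by linarith) (by positivity) (by positivity)
        _ = _ := by rw [← Real.exp_add]; ring_nf
  refine ⟨Real.exp (D * B), fun η c N h hB => ?_⟩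
  have h1 := main η c h N hB
  have h2 : Real.exp (D * ∑ k ∈ Finset.range N, c k ^ 2) ≤ Real.exp (D * B) := by gcongr
  linarith

/-- Fatou: bounds uniform over partial sums pass to the series. -/
lemma IsWeightedSum.lintegral_comp_le {η : ℕ → Ω → ℝ} {c : ℕ → ℝ} {X : Ω → ℝ}
    (hX : IsWeightedSum P η c X) (h : IsWhiteNoise P ν η) {f : ℝ → ℝ} (hf : Continuous f)
    {K : ℝ≥0∞}
    (hK : ∀ N, ∫⁻ ω, ENNReal.ofReal (f (∑ k ∈ Finset.range N, c k * η k ω)) ∂P ≤ K) :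
    ∫⁻ ω, ENNReal.ofReal (f (X ω)) ∂P ≤ K := by
  have h1 : ∫⁻ ω, ENNReal.ofReal (f (X ω)) ∂P = ∫⁻ ω, liminf (fun N =>
      ENNReal.ofReal (f (∑ k ∈ Finset.range N, c k * η k ω))) atTop ∂P := by
    refine lintegral_congr_ae ?_
    filter_upwards [hX] with ω hω
    exact (ENNReal.tendsto_ofReal ((hf.tendsto _).comp hω)).liminf_eq.symm
  rw [h1]
  refine (lintegral_liminf_le fun N => ?_).trans ?_
  · exact (hf.measurable.comp (h.measurable_sum c _)).ennreal_ofReal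
  · exact (liminf_le_liminf (Eventually.of_forall hK)).trans (by simp)

theorem exists_bound_lintegral_abs_rpow {p : ℝ} (hp : 2 ≤ p)
    (hν : Integrable (fun x => |x| ^ p) ν) (B : ℝ) :
    ∃ K : ℝ, ∀ (η : ℕ → Ω → ℝ) (c : ℕ → ℝ) (X : Ω → ℝ), IsWhiteNoise P ν η →
      IsWeightedSum P η c X → Summable (fun k => c k ^ 2) → ∑' k, c k ^ 2 ≤ B →
        ∫⁻ ω, ENNReal.ofReal (|X ω| ^ p) ∂P ≤ ENNReal.ofReal K := by
  obtain ⟨K, hK⟩ := exists_bound_integral_abs_sum_rpow (P := P) hp hν B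
  refine ⟨K, fun η c X h hX hc hB => ?_⟩
  refine hX.lintegral_comp_le h (f := fun x => |x| ^ p)
    (continuous_abs.rpow_const fun x => Or.inr (by linarith)) fun N => ?_
  rw [← ofReal_integral_eq_lintegral_ofReal (h.integrable_abs_sum_rpow hp hν c _)
    (Eventually.of_forall fun ω => by positivity)]
  exact ENNReal.ofReal_le_ofReal (hK η c N h
    ((hc.sum_le_tsum _ fun k _ => sq_nonneg _).trans hB))

/-- A sub-Gaussian bound near zero: the linear term integrates to zero, and $1+y\le e^y$ turns the
quadratic remainder into an exponential. -/
lemma integral_exp_mul_le {u₀ : ℝ}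
    (hν : IsProbabilityMeasure ν) (h1 : Integrable (fun x : ℝ => x) ν) (h0 : ∫ x, x ∂ν = 0)
    (h2 : Integrable (fun x => x ^ 2 * Real.exp (u₀ * |x|)) ν) {u : ℝ} (hu : |u| ≤ u₀) :
    ∫ x, Real.exp (u * x) ∂ν ≤ Real.exp ((∫ x, x ^ 2 * Real.exp (u₀ * |x|) ∂ν) * u ^ 2) := by
  have hi : Integrable (fun x => 1 + u * x + u ^ 2 * (x ^ 2 * Real.exp (u₀ * |x|))) ν :=
    ((integrable_const 1).add (h1.const_mul u)).add (h2.const_mul _)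
  have hle : ∀ x : ℝ, Real.exp (u * x) ≤ 1 + u * x + u ^ 2 * (x ^ 2 * Real.exp (u₀ * |x|)) := by
    intro x
    have h3 : Real.exp |u * x| ≤ Real.exp (u₀ * |x|) := by
      rw [abs_mul]; gcongr
    calc Real.exp (u * x) ≤ 1 + u * x + (u * x) ^ 2 * Real.exp |u * x| :=
          exp_le_one_add_add_sq_mul_exp_abs _
      _ ≤ 1 + u * x + (u * x) ^ 2 * Real.exp (u₀ * |x|) := by gcongr
      _ = _ := by ring
  have h3 := integral_mono_of_nonneg (Eventually.of_forall fun x => (Real.exp_pos (u * x)).le) hi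
    (Eventually.of_forall hle)
  have e1 : ∫ x, (1 + u * x) ∂ν = 1 := by
    have := integral_add (μ := ν) (integrable_const (1 : ℝ)) (h1.const_mul u)
    rw [this, integral_const_mul, h0]; simp
  have e2 := integral_add (μ := ν) ((integrable_const (1 : ℝ)).add (h1.const_mul u))
    (h2.const_mul (u ^ 2))
  simp only [Pi.add_apply] at e2
  rw [e2, e1, integral_const_mul] at h3
  have := Real.add_one_le_exp ((∫ x, x ^ 2 * Real.exp (u₀ * |x|) ∂ν) * u ^ 2)
  linarith

/-- Half of the exponential rate pays for the square: $y^2/2\le e^y$ at $y=u_1|x|/2$ gives the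
constant $8/u_1^2$. -/
lemma integrable_sq_mul_exp_abs {u₁ : ℝ} (hu₁ : 0 < u₁)
    (h : Integrable (fun x => Real.exp (u₁ * |x|)) ν) :
    Integrable (fun x => x ^ 2 * Real.exp (u₁ / 2 * |x|)) ν := by
  refine (h.const_mul (8 / u₁ ^ 2)).mono' (Measurable.aestronglyMeasurable (by fun_prop))
    (Eventually.of_forall fun x => ?_)
  rw [Real.norm_of_nonneg (by positivity)]
  have h1 := Real.quadratic_le_exp_of_nonneg (x := u₁ / 2 * |x|) (by positivity)
  have h2 : x ^ 2 ≤ 8 / u₁ ^ 2 * Real.exp (u₁ / 2 * |x|) := by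
    have h3 : u₁ ^ 2 * x ^ 2 ≤ 8 * Real.exp (u₁ / 2 * |x|) := by
      have h4 : (u₁ / 2 * |x|) ^ 2 = u₁ ^ 2 * x ^ 2 / 4 := by rw [mul_pow, sq_abs]; ring
      have : 0 ≤ u₁ / 2 * |x| := by positivity
      linarith
    rw [div_mul_eq_mul_div, le_div_iff₀ (by positivity)]
    linarith
  calc x ^ 2 * Real.exp (u₁ / 2 * |x|)
      ≤ 8 / u₁ ^ 2 * Real.exp (u₁ / 2 * |x|) * Real.exp (u₁ / 2 * |x|) := by gcongr
    _ = 8 / u₁ ^ 2 * Real.exp (u₁ * |x|) := by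
      rw [mul_assoc, ← Real.exp_add]; congr 2; ring

/-- Exponential moments of weighted series of white noise are bounded in terms of a bound for the
sum of the squared weights. -/
theorem exists_bound_lintegral_exp
    (hν : ∀ᶠ u in 𝓝 (0 : ℝ), Integrable (fun x => Real.exp (u * x)) ν) (B : ℝ) :
    ∃ r : ℝ, 0 < r ∧ ∃ K : ℝ, ∀ (η : ℕ → Ω → ℝ) (c : ℕ → ℝ) (X : Ω → ℝ), IsWhiteNoise P ν η →
      IsWeightedSum P η c X → Summable (fun k => c k ^ 2) → ∑' k, c k ^ 2 ≤ B →
        ∫⁻ ω, ENNReal.ofReal (Real.exp (r * |X ω|)) ∂P ≤ ENNReal.ofReal K := by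
  obtain ⟨ε, hε, hε'⟩ := Metric.eventually_nhds_iff.1 hν
  set u₁ := ε / 2 with hu₁
  have hu₁pos : 0 < u₁ := by positivity
  have hint : ∀ u : ℝ, |u| ≤ u₁ → Integrable (fun x => Real.exp (u * x)) ν := fun u hu =>
    hε' (by rw [dist_zero_right, Real.norm_eq_abs]; linarith)
  have habs : Integrable (fun x => Real.exp (u₁ * |x|)) ν :=
    integrable_exp_mul_abs (X := fun x => x) (hint u₁ (abs_of_pos hu₁pos).le)
      (hint (-u₁) (by rw [abs_neg, abs_of_pos hu₁pos]))
  have hsq := integrable_sq_mul_exp_abs hu₁pos habs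
  set D := ∫ x, x ^ 2 * Real.exp (u₁ / 2 * |x|) ∂ν
  have hD : 0 ≤ D := integral_nonneg fun x => by positivity
  -- Every weight is at most $1+|B|$, so this $r$ keeps $|rc_k|\le u_1/2$, where the sub-Gaussian
  -- bound is available.
  set r := u₁ / 2 / (1 + |B|) with hr
  have hrpos : 0 < r := by positivity
  -- Two equal terms, because $e^{r|x|}\le e^{rx}+e^{-rx}$.
  refine ⟨r, hrpos, Real.exp (D * (r ^ 2 * B)) + Real.exp (D * (r ^ 2 * B)),
    fun η c X h hX hc hB => ?_⟩
  have := h.isProbabilityMeasure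
  have hck : ∀ k, |c k| ≤ 1 + |B| := fun k => by
    have h1 : c k ^ 2 ≤ |B| :=
      ((hc.le_tsum k fun _ _ => sq_nonneg _).trans hB).trans (le_abs_self B)
    rw [← sq_abs] at h1
    nlinarith [abs_nonneg (c k)]
  have hrc : ∀ e : ℝ, |e| = r → ∀ k, |e * c k| ≤ u₁ / 2 := fun e he k => by
    rw [abs_mul, he, hr]
    calc u₁ / 2 / (1 + |B|) * |c k| ≤ u₁ / 2 / (1 + |B|) * (1 + |B|) := by gcongr; exact hck k
      _ = u₁ / 2 := by field_simp
  have hηint : ∀ e : ℝ, |e| = r → ∀ k, Integrable (fun ω => Real.exp (e * (c k * η k ω))) P := by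
    intro e he k
    have h1 : Integrable (fun x => Real.exp ((e * c k) * x)) (P.map (η k)) := by
      rw [h.map_eq k]
      exact hint _ ((hrc e he k).trans (by linarith))
    have h2 := h1.comp_measurable (h.measurable k)
    simpa [Function.comp_def, mul_assoc] using h2
  have hmeas : ∀ k, Measurable (fun ω => c k * η k ω) := fun k => (h.measurable k).const_mul _
  have hind : iIndepFun (fun k ω => c k * η k ω) P :=
    h.indep.comp (fun k x => c k * x) fun k => by fun_prop
  have hSint : ∀ e : ℝ, |e| = r → ∀ N,
      Integrable (fun ω => Real.exp (e * ∑ k ∈ Finset.range N, c k * η k ω)) P := fun e he N => by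
    simpa using hind.integrable_exp_mul_sum hmeas (s := Finset.range N)
      fun k _ => hηint e he k
  have hSle : ∀ e : ℝ, |e| = r → ∀ N,
      ∫ ω, Real.exp (e * ∑ k ∈ Finset.range N, c k * η k ω) ∂P ≤ Real.exp (D * (r ^ 2 * B)) := by
    intro e he N
    have h1 := hind.mgf_sum (t := e) hmeas (Finset.range N)
    simp only [mgf, Finset.sum_apply] at h1
    rw [h1]
    have h2 : ∀ k, ∫ ω, Real.exp (e * (c k * η k ω)) ∂P ≤ Real.exp (D * (e * c k) ^ 2) :=
      fun k => by
        have h3 := h.integral_comp k (f := fun x => Real.exp ((e * c k) * x)) (by fun_prop)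
        simp only [← mul_assoc]
        rw [h3]
        exact integral_exp_mul_le this (h.memLp_id.integrable one_le_two) h.mean_zero hsq
          (hrc e he k)
    calc ∏ k ∈ Finset.range N, ∫ ω, Real.exp (e * (c k * η k ω)) ∂P
        ≤ ∏ k ∈ Finset.range N, Real.exp (D * (e * c k) ^ 2) :=
          Finset.prod_le_prod (fun k _ => integral_nonneg fun ω => (Real.exp_pos _).le)
            fun k _ => h2 k
      _ = Real.exp (D * (r ^ 2 * ∑ k ∈ Finset.range N, c k ^ 2)) := by
          rw [← Real.exp_sum, ← Finset.mul_sum]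
          simp only [mul_pow, ← Finset.mul_sum, ← he, sq_abs]
      _ ≤ Real.exp (D * (r ^ 2 * B)) := by
          gcongr
          exact (hc.sum_le_tsum _ fun k _ => sq_nonneg _).trans hB
  refine hX.lintegral_comp_le h (f := fun x => Real.exp (r * |x|)) (by fun_prop) fun N => ?_
  have hp := hSint r (abs_of_pos hrpos) N
  have hm := hSint (-r) (by rw [abs_neg, abs_of_pos hrpos]) N
  rw [← ofReal_integral_eq_lintegral_ofReal (integrable_exp_mul_abs hp hm)
    (Eventually.of_forall fun ω => (Real.exp_pos _).le)]
  refine ENNReal.ofReal_le_ofReal ?_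
  refine (integral_mono (integrable_exp_mul_abs hp hm) (hp.add hm) fun ω => ?_).trans ?_
  · rcases abs_cases (∑ k ∈ Finset.range N, c k * η k ω) with ⟨hx, _⟩ | ⟨hx, _⟩ <;>
      simp only [hx, Pi.add_apply, mul_neg, neg_mul] <;>
      linarith [Real.exp_pos (r * ∑ k ∈ Finset.range N, c k * η k ω),
        Real.exp_pos (-(r * ∑ k ∈ Finset.range N, c k * η k ω))]
  · have := integral_add hp hm
    simp only [Pi.add_apply]
    rw [this]
    exact add_le_add (hSle r (abs_of_pos hrpos) N)
      (hSle (-r) (by rw [abs_neg, abs_of_pos hrpos]) N)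

end Moments

/-! ### Integrable characteristic functions and bounded densities. -/

section BoundedDensity

open scoped FourierTransform Manifold

lemma lintegral_comp_mul_left {f : ℝ → ℝ≥0∞} (hf : Measurable f) {r : ℝ} (hr : r ≠ 0) :
    ∫⁻ u, f (r * u) = ENNReal.ofReal |r⁻¹| * ∫⁻ u, f u := by
  rw [← lintegral_map hf (measurable_const_mul r), Real.map_volume_mul_left hr,
    lintegral_smul_measure, smul_eq_mul]

/-- Parseval's identity for a test function and the characteristic function of a law. -/
lemma norm_integral_le_of_charFun {μ : Measure ℝ} [IsProbabilityMeasure μ] {K : ℝ≥0∞}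
    (hK : ∫⁻ u, ‖charFun μ u‖ₑ ≤ K) {g : ℝ → ℝ} (hg : ContDiff ℝ ((⊤ : ℕ∞) : WithTop ℕ∞) g)
    (hgc : HasCompactSupport g) :
    ‖∫ x, g x ∂μ‖ₑ ≤ K * ∫⁻ x, ‖g x‖ₑ := by
  let gc : ℝ → ℂ := fun x => (g x : ℂ)
  have hgc' : HasCompactSupport gc := hgc.comp_left Complex.ofReal_zero
  have hgs : ContDiff ℝ ((⊤ : ℕ∞) : WithTop ℕ∞) gc := Complex.ofRealCLM.contDiff.comp hg
  let G : SchwartzMap ℝ ℂ := hgc'.toSchwartzMap hgs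
  have hG : ∀ x, G x = gc x := fun x => rfl
  let H : SchwartzMap ℝ ℂ := 𝓕⁻ G
  have hH : 𝓕 H = G := FourierTransform.fourier_fourierInv_eq G
  -- Writing the test function as the Fourier transform of `H` and moving the transform onto `μ`
  -- replaces $\int g\,d\mu$ by the integral of $\hat\mu(-2\pi w)H(w)$.
  have hflip := VectorFourier.integral_fourierIntegral_smul_eq_flip (μ := μ) (ν := volume)
    (e := Real.fourierChar) (L := innerₗ ℝ) (f := fun _ : ℝ => (1 : ℂ)) (g := H)
    Real.continuous_fourierChar (by exact continuous_inner) (integrable_const 1) H.integrable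
  have h1 : ∀ x : ℝ, VectorFourier.fourierIntegral Real.fourierChar volume (innerₗ ℝ).flip H x =
      gc x := fun x => by
    rw [flip_innerₗ, ← hG, ← hH, SchwartzMap.fourier_coe]
    rfl
  have h2 : ∀ w : ℝ, VectorFourier.fourierIntegral Real.fourierChar μ (innerₗ ℝ)
      (fun _ : ℝ => (1 : ℂ)) w = charFun μ (-(2 * Real.pi) * w) := fun w => by
    rw [charFun_eq_fourierIntegral']
    congr 1
    rw [smul_eq_mul]
    field_simp
  simp only [h1, h2, one_smul] at hflip
  have h3 : ∀ w, ‖H w‖ₑ ≤ ∫⁻ x, ‖g x‖ₑ := fun w => by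
    have : H w = ∫ v, 𝐞 (inner ℝ v w) • G v := by
      change (𝓕⁻ G) w = _
      rw [SchwartzMap.fourierInv_coe, Real.fourierInv_eq]
    rw [this]
    refine (enorm_integral_le_lintegral_enorm _).trans (le_of_eq ?_)
    refine lintegral_congr fun v => ?_
    rw [hG]
    have hc1 : ‖((𝐞 (inner ℝ v w) : Circle) : ℂ)‖ₑ = 1 := by
      rw [← ofReal_norm, Circle.norm_coe, ENNReal.ofReal_one]
    rw [Circle.smul_def, enorm_smul, hc1, one_mul]
    simp [gc, enorm_eq_nnnorm]
  have h4 : ‖∫ x, g x ∂μ‖ₑ = ‖∫ x, gc x ∂μ‖ₑ := by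
    have : ∫ x, gc x ∂μ = ((∫ x, g x ∂μ : ℝ) : ℂ) := integral_ofReal
    rw [this]
    simp [enorm_eq_nnnorm]
  rw [h4, ← hflip]
  refine (enorm_integral_le_lintegral_enorm _).trans ?_
  calc ∫⁻ w, ‖charFun μ (-(2 * Real.pi) * w) • H w‖ₑ
      ≤ ∫⁻ w, ‖charFun μ (-(2 * Real.pi) * w)‖ₑ * ∫⁻ x, ‖g x‖ₑ := by
        refine lintegral_mono fun w => ?_
        rw [enorm_smul]
        gcongr
        exact h3 w
    _ = (∫⁻ w, ‖charFun μ (-(2 * Real.pi) * w)‖ₑ) * ∫⁻ x, ‖g x‖ₑ := by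
        rw [lintegral_mul_const _ (by fun_prop)]
    _ ≤ K * ∫⁻ x, ‖g x‖ₑ := by
        gcongr
        -- The change of variables brings a factor $1/(2\pi)\le1$, which is discarded.
        rw [lintegral_comp_mul_left (f := fun u => ‖charFun μ u‖ₑ) (by fun_prop)
          (by simp [Real.pi_ne_zero])]
        refine le_trans ?_ hK
        refine mul_le_of_le_one_left zero_le ?_
        rw [ENNReal.ofReal_le_one, abs_inv, abs_neg, abs_of_pos Real.two_pi_pos]
        exact inv_le_one_of_one_le₀ (by linarith [Real.two_le_pi])

/-- A law with integrable characteristic function has a bounded density. -/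
theorem measure_le_smul_volume_of_charFun {μ : Measure ℝ} [IsProbabilityMeasure μ] {K : ℝ≥0∞}
    (hKtop : K ≠ ⊤) (hK : ∫⁻ u, ‖charFun μ u‖ₑ ≤ K) : μ ≤ K • volume := by
  -- Compact sets suffice by inner regularity. A smooth bump between $s$ and an open $U\supseteq s$
  -- gives $\mu(s)\le\int g\,d\mu\le K|U|$, and outer regularity shrinks $U$ to $s$.
  have hcompact : ∀ s : Set ℝ, IsCompact s → μ s ≤ K * volume s := by
    intro s hs
    have hopen : ∀ U : Set ℝ, s ⊆ U → IsOpen U → μ s ≤ K * volume U := by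
      intro U hsU hU
      -- Intersecting with a bounded thickening gives the bump compact support.
      have hV : IsOpen (U ∩ Metric.thickening 1 s) := hU.inter Metric.isOpen_thickening
      have hsV : s ⊆ U ∩ Metric.thickening 1 s :=
        Set.subset_inter hsU (Metric.self_subset_thickening one_pos s)
      obtain ⟨g, hg, hgr, hgsupp, hg1⟩ :=
        exists_contMDiff_support_eq_eq_one_iff 𝓘(ℝ, ℝ) hV hs.isClosed hsV
      have hgcs : HasCompactSupport g := by
        refine HasCompactSupport.intro (hs.cthickening (r := 1)) (fun x hx => ?_)
        by_contra hne
        have : x ∈ Function.support g := hne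
        rw [hgsupp] at this
        exact hx (Metric.thickening_subset_cthickening 1 s this.2)
      have hg01 : ∀ x, g x ∈ Set.Icc (0 : ℝ) 1 := fun x => hgr (Set.mem_range_self x)
      have hgi : Integrable g μ := hg.contDiff.continuous.integrable_of_hasCompactSupport hgcs
      have h1 := norm_integral_le_of_charFun hK hg.contDiff hgcs
      calc μ s = ∫⁻ x, s.indicator 1 x ∂μ := by
            rw [lintegral_indicator_one hs.measurableSet]
        _ ≤ ∫⁻ x, ENNReal.ofReal (g x) ∂μ := by
            refine lintegral_mono fun x => ?_
            by_cases hx : x ∈ s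
            · simp [hx, (hg1 x).1 hx]
            · simp [hx]
        _ = ‖∫ x, g x ∂μ‖ₑ := by
            rw [← ofReal_integral_eq_lintegral_ofReal hgi
              (Eventually.of_forall fun x => (hg01 x).1),
              Real.enorm_of_nonneg (integral_nonneg fun x => (hg01 x).1)]
        _ ≤ K * ∫⁻ x, ‖g x‖ₑ := h1
        _ ≤ K * ∫⁻ x, U.indicator 1 x := by
            gcongr with x
            by_cases hx : x ∈ U
            · rw [Set.indicator_of_mem hx, Real.enorm_of_nonneg (hg01 x).1]
              exact ENNReal.ofReal_le_one.2 (hg01 x).2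
            · have : g x = 0 := by
                by_contra hne
                have : x ∈ Function.support g := hne
                rw [hgsupp] at this
                exact hx this.1
              simp [this]
        _ = K * volume U := by rw [lintegral_indicator_one hU.measurableSet]
    refine ENNReal.le_of_forall_pos_le_add fun ε hε _ => ?_
    obtain ⟨U, hsU, hU, hUlt⟩ := s.exists_isOpen_lt_add (hs.measure_lt_top (μ := volume)).ne
      (ENNReal.div_pos (ENNReal.coe_ne_zero.2 hε.ne') hKtop).ne'
    calc μ s ≤ K * volume U := hopen U hsU hU
      _ ≤ K * (volume s + ε / K) := by gcongr
      _ ≤ K * volume s + ε := by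
        rw [mul_add]
        gcongr
        exact ENNReal.mul_div_le
  refine Measure.le_iff.2 fun s hs => ?_
  rw [hs.measure_eq_iSup_isCompact, Measure.smul_apply, smul_eq_mul]
  refine iSup₂_le fun k hk => iSup_le fun hkc => (hcompact k hkc).trans ?_
  gcongr

/-- The Radon–Nikodym derivative is bounded by `K` only almost everywhere; truncation at `K` makes
the bound pointwise, as the supremum in `HL3` requires. -/
lemma exists_density_le {μ : Measure ℝ} [IsProbabilityMeasure μ] {K : ℝ≥0∞}
    (hK : μ ≤ K • volume) :
    ∃ D : ℝ → ℝ≥0∞, Measurable D ∧ μ = volume.withDensity D ∧ ∀ x, D x ≤ K := by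
  have hac : μ ≪ volume := by
    intro s hs
    have := hK s
    rw [Measure.smul_apply, hs, smul_zero] at this
    exact le_antisymm this zero_le
  refine ⟨fun x => min (μ.rnDeriv volume x) K,
    (Measure.measurable_rnDeriv _ _).min measurable_const, ?_, fun x => min_le_right _ _⟩
  have h1 : μ.rnDeriv volume ≤ᵐ[volume] fun _ => K := by
    refine ae_le_of_forall_setLIntegral_le_of_sigmaFinite (Measure.measurable_rnDeriv _ _)
      fun s hs _ => ?_
    rw [setLIntegral_const]
    exact (Measure.setLIntegral_rnDeriv_le s).trans (hK s)
  rw [← Measure.withDensity_rnDeriv_eq μ volume hac]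
  refine withDensity_congr_ae ?_
  rw [Measure.withDensity_rnDeriv_eq μ volume hac]
  filter_upwards [h1] with x hx
  exact (min_eq_left hx).symm

end BoundedDensity

/-! ### Decay of the characteristic function of an absolutely continuous law. -/

section Decay

variable {ν : Measure ℝ} [IsProbabilityMeasure ν]

/-- Equality would make $e^{itx}$ almost surely constant, putting all the mass on a countable
lattice, which is a null set. -/
lemma norm_charFun_lt_one (hac : ν ≪ volume) {t : ℝ} (ht : t ≠ 0) : ‖charFun ν t‖ < 1 := by
  have hle : ∀ᵐ x : ℝ ∂ν, ‖Complex.exp (t * x * Complex.I)‖ ≤ 1 := Eventually.of_forall fun x => by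
    rw [← Complex.ofReal_mul, Complex.norm_exp_ofReal_mul_I]
  rcases ae_eq_const_or_norm_integral_lt_of_norm_le_const hle with h | h
  · exfalso
    set z := ⨍ x : ℝ, Complex.exp (t * x * Complex.I) ∂ν
    have hnull : ν {x : ℝ | Complex.exp (t * x * Complex.I) = z} = 0 := by
      refine hac (Set.Countable.measure_zero ?_ _)
      rcases Set.eq_empty_or_nonempty {x : ℝ | Complex.exp (t * x * Complex.I) = z} with he | he
      · rw [he]; exact Set.countable_empty
      · obtain ⟨x₀, hx₀⟩ := he
        refine (Set.countable_range fun k : ℤ => x₀ + k * (2 * Real.pi) / t).mono ?_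
        intro x hx
        rw [Set.mem_ofPred_eq] at hx hx₀
        obtain ⟨k, hk⟩ := Complex.exp_eq_exp_iff_exists_int.1 (hx.trans hx₀.symm)
        refine ⟨k, ?_⟩
        have hk' : (t * x * Complex.I : ℂ) = (t * x₀ + k * (2 * Real.pi)) * Complex.I := by
          rw [hk]; ring
        have hk'' := mul_right_cancel₀ Complex.I_ne_zero hk'
        have : t * x = t * x₀ + k * (2 * Real.pi) := by exact_mod_cast hk''
        field_simp
        linarith
    have huniv : ∀ᵐ x ∂ν, x ∈ {x : ℝ | Complex.exp (t * x * Complex.I) = z} := h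
    obtain ⟨x, hx, hx'⟩ := (huniv.and (measure_eq_zero_iff_ae_notMem.1 hnull)).exists
    exact hx' hx
  · rw [charFun_apply_real]
    simpa using h

/-- Riemann–Lebesgue for the density; the factor $-(2\pi)^{-1}$ reconciles the two Fourier
conventions. -/
lemma tendsto_charFun_cocompact (hac : ν ≪ volume) :
    Tendsto (charFun ν) (cocompact ℝ) (𝓝 0) := by
  have hc : -(2 * Real.pi)⁻¹ ≠ 0 := by simp [Real.pi_ne_zero]
  have h1 := (Real.tendsto_integral_exp_smul_cocompact
    (fun x : ℝ => ((ν.rnDeriv volume x).toReal : ℂ))).comp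
    (Homeomorph.mulLeft₀ _ hc).isClosedEmbedding.tendsto_cocompact
  refine h1.congr fun t => ?_
  rw [charFun_apply_real, ← integral_rnDeriv_smul hac]
  refine integral_congr_ae (Eventually.of_forall fun x => ?_)
  simp only [Homeomorph.coe_mulLeft₀, Circle.smul_def, Real.fourierChar_apply, smul_eq_mul,
    Complex.real_smul]
  rw [mul_comm]
  congr 2
  push_cast
  have : (Real.pi : ℂ) ≠ 0 := by exact_mod_cast Real.pi_ne_zero
  field_simp

/-- Near zero the expansion $1-vt^2/2$ with error at most $vt^2/4$ gives $e^{-vt^2/4}$. Away from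
zero, strict inequality, continuity and decay at infinity give a uniform $\rho<1$, and $\rho\le
e^{-(1-\rho)}$. -/
lemma exists_norm_charFun_le_exp (hac : ν ≪ volume) (hν : MemLp id 2 ν) (h0 : ∫ x, x ∂ν = 0)
    (hv : 0 < ∫ x, x ^ 2 ∂ν) :
    ∃ r : ℝ, 0 < r ∧ ∀ t : ℝ, ‖charFun ν t‖ ≤ Real.exp (-(r * min (t ^ 2) 1)) := by
  set v := ∫ x, x ^ 2 ∂ν with hvdef
  have hlo := (charFun_sub_quadratic_isLittleO hν h0).def (c := v / 4) (by positivity)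
  obtain ⟨δ₁, hδ₁, hδ₁'⟩ := Metric.eventually_nhds_iff.1 hlo
  have hsmall : ∀ᶠ t : ℝ in 𝓝 0, v * t ^ 2 / 2 ≤ 1 := by
    have h1 : Tendsto (fun t : ℝ => v * t ^ 2 / 2) (𝓝 0) (𝓝 0) := by
      have : Continuous fun t : ℝ => v * t ^ 2 / 2 := by fun_prop
      simpa using this.tendsto 0
    exact h1.eventually_le_const one_pos
  obtain ⟨δ₂, hδ₂, hδ₂'⟩ := Metric.eventually_nhds_iff.1 hsmall
  set δ := min δ₁ δ₂
  have hδ : 0 < δ := lt_min hδ₁ hδ₂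
  have hnear : ∀ t : ℝ, |t| < δ → ‖charFun ν t‖ ≤ Real.exp (-(v / 4 * t ^ 2)) := by
    intro t ht
    have h1 := @hδ₁' t (by rw [dist_zero_right]; exact ht.trans_le (min_le_left _ _))
    have h2 := @hδ₂' t (by rw [dist_zero_right]; exact ht.trans_le (min_le_right _ _))
    rw [Real.norm_of_nonneg (sq_nonneg t)] at h1
    have h3 : ‖(1 - (v : ℂ) * t ^ 2 / 2)‖ = 1 - v * t ^ 2 / 2 := by
      have : (1 - (v : ℂ) * t ^ 2 / 2) = ((1 - v * t ^ 2 / 2 : ℝ) : ℂ) := by push_cast; ring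
      rw [this, Complex.norm_real, Real.norm_of_nonneg (by linarith)]
    have h4 : ‖charFun ν t‖ ≤ ‖charFun ν t - (1 - (v : ℂ) * t ^ 2 / 2)‖ +
        ‖(1 - (v : ℂ) * t ^ 2 / 2)‖ := by
      have := norm_add_le (charFun ν t - (1 - (v : ℂ) * t ^ 2 / 2)) (1 - (v : ℂ) * t ^ 2 / 2)
      rwa [sub_add_cancel] at this
    rw [h3] at h4
    have h5 := Real.add_one_le_exp (-(v / 4 * t ^ 2))
    linarith
  obtain ⟨ρ, hρ1, hρ⟩ : ∃ ρ : ℝ, ρ < 1 ∧ ∀ t : ℝ, δ ≤ |t| → ‖charFun ν t‖ ≤ ρ := by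
    have hinf : ∀ᶠ t in cocompact ℝ, ‖charFun ν t‖ ≤ 1 / 2 := by
      have := (tendsto_charFun_cocompact hac).norm
      rw [norm_zero] at this
      exact this.eventually_le_const (by norm_num)
    obtain ⟨T, hT, hTc⟩ := mem_cocompact.1 hinf
    have hT' : IsCompact (T ∩ {t : ℝ | δ ≤ |t|}) :=
      hT.inter_right (isClosed_le continuous_const continuous_abs)
    rcases (T ∩ {t : ℝ | δ ≤ |t|}).eq_empty_or_nonempty with he | he
    · refine ⟨1 / 2, by norm_num, fun t ht => hTc fun htT => ?_⟩
      exact (he ▸ (⟨htT, ht⟩ : t ∈ T ∩ {t : ℝ | δ ≤ |t|}) : t ∈ (∅ : Set ℝ))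
    · obtain ⟨t₁, ht₁, hmax⟩ := hT'.exists_isMaxOn he
        (continuous_charFun (μ := ν)).norm.continuousOn
      have ht₁0 : t₁ ≠ 0 := by
        have h6 : δ ≤ |t₁| := ht₁.2
        exact abs_pos.1 (hδ.trans_le h6)
      refine ⟨max (1 / 2) ‖charFun ν t₁‖, max_lt (by norm_num) (norm_charFun_lt_one hac ht₁0),
        fun t ht => ?_⟩
      by_cases htT : t ∈ T
      · exact (hmax ⟨htT, ht⟩).trans (le_max_right _ _)
      · exact le_trans (hTc htT) (le_max_left _ _)
  refine ⟨min (v / 4) (1 - ρ), lt_min (by positivity) (by linarith), fun t => ?_⟩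
  have hm0 : 0 ≤ min (t ^ 2) 1 := le_min (sq_nonneg t) zero_le_one
  rcases lt_or_ge |t| δ with ht | ht
  · refine (hnear t ht).trans (Real.exp_le_exp.2 (neg_le_neg ?_))
    exact mul_le_mul (min_le_left _ _) (min_le_left _ _) hm0 (by positivity)
  · refine (hρ t ht).trans ?_
    have h1 := Real.add_one_le_exp (-(min (v / 4) (1 - ρ) * min (t ^ 2) 1))
    have h2 : min (v / 4) (1 - ρ) * min (t ^ 2) 1 ≤ (1 - ρ) * 1 :=
      mul_le_mul (min_le_right _ _) (min_le_right _ _) hm0 (by linarith)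
    linarith

end Decay

/-! ### Hölder bounds for integrals of products of characteristic functions. -/

section Hoelder

variable {ν : Measure ℝ} [IsProbabilityMeasure ν]

lemma lintegral_prod_charFun_le {ι : Type*} {s : Finset ι} {b p : ι → ℝ}
    (hp0 : ∀ k ∈ s, 0 ≤ p k) (hp1 : ∑ k ∈ s, p k = 1) {K : ℝ≥0∞}
    (hK : ∀ k ∈ s, 0 < p k → ∫⁻ u : ℝ, ‖charFun ν (b k * u)‖ₑ ^ (1 / p k) ≤ K) :
    ∫⁻ u : ℝ, ∏ k ∈ s, ‖charFun ν (b k * u)‖ₑ ≤ K := by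
  have h1 := ENNReal.lintegral_prod_norm_pow_le (μ := (volume : Measure ℝ)) s
    (f := fun k u => ‖charFun ν (b k * u)‖ₑ ^ (1 / p k))
    (fun k _ => Measurable.aemeasurable (by fun_prop)) hp1 hp0
  have hle1 : ∀ t : ℝ, ‖charFun ν t‖ₑ ≤ 1 := fun t => by
    rw [← ofReal_norm]
    exact ENNReal.ofReal_le_one.2 (norm_charFun_le_one t)
  refine (lintegral_mono fun u => ?_).trans (h1.trans ?_)
  · refine Finset.prod_le_prod' fun k hk => ?_
    -- When `p k = 0` the Hölder factor is `1`, and the corresponding characteristic function is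
    -- dropped since its modulus is at most one.
    rcases (hp0 k hk).eq_or_lt with h | h
    · rw [← h, ENNReal.rpow_zero]; exact hle1 _
    · rw [← ENNReal.rpow_mul, one_div_mul_cancel h.ne', ENNReal.rpow_one]
  · calc ∏ k ∈ s, (∫⁻ u : ℝ, ‖charFun ν (b k * u)‖ₑ ^ (1 / p k)) ^ p k ≤ ∏ k ∈ s, K ^ p k := by
          refine Finset.prod_le_prod' fun k hk => ?_
          rcases (hp0 k hk).eq_or_lt with h | h
          · rw [← h, ENNReal.rpow_zero, ENNReal.rpow_zero]
          · exact ENNReal.rpow_le_rpow (hK k hk h) h.le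
      _ = K := by
          have hsum : ∀ t : Finset ι, (∀ k ∈ t, 0 ≤ p k) →
              ∏ k ∈ t, K ^ p k = K ^ ∑ k ∈ t, p k := by
            classical
            intro t
            induction t using Finset.induction_on with
            | empty => simp
            | insert i t hi ih =>
              intro ht
              have ht' : ∀ k ∈ t, 0 ≤ p k := fun k hk => ht k (Finset.mem_insert_of_mem hk)
              rw [Finset.prod_insert hi, Finset.sum_insert hi, ih ht',
                ENNReal.rpow_add_of_nonneg _ _ (ht i (Finset.mem_insert_self _ _))
                  (Finset.sum_nonneg ht')]
          rw [hsum s hp0, hp1, ENNReal.rpow_one]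

variable {θ : ℕ}

lemma lintegral_enorm_charFun_pow_lt_top (hθ : Integrable (fun u => ‖charFun ν u‖ ^ θ)) :
    ∫⁻ u, ‖charFun ν u‖ₑ ^ θ < ∞ := by
  have := hθ.lintegral_lt_top
  refine lt_of_le_of_lt (lintegral_mono fun u => ?_) this
  rw [← ofReal_norm, ENNReal.ofReal_pow (norm_nonneg _)]

/-- If `θ` weights exceed `δ`, the product of the corresponding characteristic functions has a
controlled integral. -/
lemma lintegral_prod_charFun_le_of_card (hθ1 : 1 ≤ θ) {ι : Type*} {s : Finset ι} {c : ι → ℝ}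
    (hs : s.card = θ) {δ : ℝ} (hδ : 0 < δ) (hc : ∀ k ∈ s, δ < |c k|) :
    ∫⁻ u : ℝ, ∏ k ∈ s, ‖charFun ν (c k * u)‖ₑ ≤
      ENNReal.ofReal δ⁻¹ * ∫⁻ u, ‖charFun ν u‖ₑ ^ θ := by
  have hθ0 : (θ : ℝ) ≠ 0 := by positivity
  -- Equal exponents $1/\theta$ turn each factor into $\int|\psi(cu)|^\theta
  -- du=|c|^{-1}\int|\psi|^\theta$.
  refine lintegral_prod_charFun_le (p := fun _ => (1 : ℝ) / θ) (fun k _ => by positivity) ?_ ?_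
  · rw [Finset.sum_const, hs, nsmul_eq_mul]
    field_simp
  · intro k hk _
    have hck : c k ≠ 0 := abs_pos.1 (hδ.trans (hc k hk))
    simp only [one_div_one_div, ENNReal.rpow_natCast]
    rw [lintegral_comp_mul_left (f := fun u => ‖charFun ν u‖ₑ ^ θ) (by fun_prop) hck]
    gcongr
    rw [abs_inv]
    exact inv_anti₀ hδ (hc k hk).le

/-- Let $q=1/(vb^2)\ge\theta$ and $t=bu$. Where $|t|\le1$, $|\psi(t)|^q\le
e^{-rqt^2}=e^{-(r/v)u^2}$, a Gaussian free of $b$. Where $|t|\ge1$, $|\psi|^q\le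
e^{-r(q-\theta)}|\psi|^\theta$; rescaling costs $1/|b|$, which $e^{-rq}\le1/(rq)=vb^2/r$ more than
repays. -/
lemma exists_bound_lintegral_charFun_rpow (hac : ν ≪ volume) (hν : MemLp id 2 ν)
    (h0 : ∫ x, x ∂ν = 0) (hv : 0 < ∫ x, x ^ 2 ∂ν) (hθ1 : 1 ≤ θ)
    (hθ : Integrable (fun u => ‖charFun ν u‖ ^ θ)) :
    ∃ K : ℝ≥0∞, K ≠ ⊤ ∧ ∀ b : ℝ, b ≠ 0 → θ * ((∫ x, x ^ 2 ∂ν) * b ^ 2) ≤ 1 →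
      ∫⁻ u : ℝ, ‖charFun ν (b * u)‖ₑ ^ (1 / ((∫ x, x ^ 2 ∂ν) * b ^ 2)) ≤ K := by
  obtain ⟨r, hr, hdecay⟩ := exists_norm_charFun_le_exp hac hν h0 hv
  set v := ∫ x, x ^ 2 ∂ν with hvdef
  set I := ∫⁻ u, ‖charFun ν u‖ₑ ^ θ with hI
  have hItop : I < ∞ := lintegral_enorm_charFun_pow_lt_top hθ
  set G := ∫⁻ u : ℝ, ENNReal.ofReal (Real.exp (-(r / v) * u ^ 2)) with hG
  have hGtop : G < ∞ := (integrable_exp_neg_mul_sq (by positivity)).lintegral_lt_top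
  set M := 1 + 1 / v with hM
  refine ⟨G + ENNReal.ofReal (Real.exp (r * θ) * (v * M / r)) * I,
    (ENNReal.add_lt_top.2 ⟨hGtop, ENNReal.mul_lt_top ENNReal.ofReal_lt_top hItop⟩).ne,
    fun b hb hbθ => ?_⟩
  have hb2 : 0 < v * b ^ 2 := by positivity
  set q := 1 / (v * b ^ 2) with hq
  have hq0 : 0 < q := by positivity
  have hqθ : (θ : ℝ) ≤ q := by rw [hq, le_div_iff₀ hb2]; exact hbθ
  have hpt : ∀ t : ℝ, ‖charFun ν t‖ ^ q ≤ Real.exp (-(r * q * t ^ 2)) +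
      Real.exp (-(r * (q - θ))) * ‖charFun ν t‖ ^ θ := by
    intro t
    have hn := norm_nonneg (charFun ν t)
    rcases le_total (t ^ 2) 1 with h | h
    · have h1 := Real.rpow_le_rpow hn (hdecay t) hq0.le
      rw [min_eq_left h, ← Real.exp_mul] at h1
      have h2 : -(r * t ^ 2) * q = -(r * q * t ^ 2) := by ring
      rw [h2] at h1
      have : 0 ≤ Real.exp (-(r * (q - θ))) * ‖charFun ν t‖ ^ θ := by positivity
      linarith
    · have h1 := Real.rpow_le_rpow hn (hdecay t) (sub_nonneg.2 hqθ)
      rw [min_eq_right h, ← Real.exp_mul] at h1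
      have h2 : -(r * 1) * (q - θ) = -(r * (q - θ)) := by ring
      rw [h2] at h1
      have h3 : ‖charFun ν t‖ ^ q = ‖charFun ν t‖ ^ (q - θ) * ‖charFun ν t‖ ^ θ := by
        rcases hn.eq_or_lt with h4 | h4
        · rw [← h4, Real.zero_rpow hq0.ne', zero_pow (by lia), mul_zero]
        · rw [← Real.rpow_natCast, ← Real.rpow_add h4]; congr 1; ring
      rw [h3]
      have h5 : ‖charFun ν t‖ ^ (q - θ) * ‖charFun ν t‖ ^ θ ≤
          Real.exp (-(r * (q - θ))) * ‖charFun ν t‖ ^ θ := by gcongr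
      linarith [Real.exp_pos (-(r * q * t ^ 2))]
  have hpt' : ∀ u : ℝ, ‖charFun ν (b * u)‖ₑ ^ q ≤
      ENNReal.ofReal (Real.exp (-(r / v) * u ^ 2)) +
        ENNReal.ofReal (Real.exp (-(r * (q - θ)))) * ‖charFun ν (b * u)‖ₑ ^ θ := by
    intro u
    rw [← ofReal_norm, ENNReal.ofReal_rpow_of_nonneg (norm_nonneg _) hq0.le,
      ← ENNReal.ofReal_pow (norm_nonneg _), ← ENNReal.ofReal_mul (Real.exp_pos _).le,
      ← ENNReal.ofReal_add (Real.exp_pos _).le (by positivity)]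
    refine ENNReal.ofReal_le_ofReal ((hpt (b * u)).trans (le_of_eq ?_))
    congr 2
    rw [hq]; field_simp
  refine (lintegral_mono hpt').trans ?_
  rw [lintegral_add_left (by fun_prop), lintegral_const_mul _ (by fun_prop),
    lintegral_comp_mul_left (f := fun u => ‖charFun ν u‖ₑ ^ θ) (by fun_prop) hb, ← mul_assoc,
    ← ENNReal.ofReal_mul (Real.exp_pos _).le]
  refine add_le_add le_rfl (mul_le_mul' (ENNReal.ofReal_le_ofReal ?_) le_rfl)
  have hy : 0 < r * q := by positivity
  have h1 : Real.exp (-(r * q)) ≤ 1 / (r * q) := by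
    rw [Real.exp_neg, ← one_div]
    exact one_div_le_one_div_of_le hy (by linarith [Real.add_one_le_exp (r * q)])
  -- Since $\theta\ge1$, the constraint gives $vb^2\le1$, hence $|b|\le1+1/v$.
  have hbM : |b| ≤ M := by
    have hθ1' : (1 : ℝ) ≤ θ := by exact_mod_cast hθ1
    have h2 : b ^ 2 ≤ 1 / v := by
      rw [le_div_iff₀ hv]
      nlinarith
    have h3 : 0 < 1 / v := by positivity
    rw [← sq_abs] at h2
    nlinarith [abs_nonneg b]
  have hb0 : 0 < |b| := abs_pos.2 hb
  calc Real.exp (-(r * (q - θ))) * |b⁻¹| = Real.exp (r * θ) * (Real.exp (-(r * q)) * |b|⁻¹) := by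
        rw [show -(r * (q - θ)) = r * θ + -(r * q) by ring, Real.exp_add, abs_inv]; ring
    _ ≤ Real.exp (r * θ) * (1 / (r * q) * |b|⁻¹) := by gcongr
    _ = Real.exp (r * θ) * (v * |b| / r) := by
        congr 1
        rw [hq, ← sq_abs b]
        field_simp
    _ ≤ Real.exp (r * θ) * (v * M / r) := by gcongr

/-- The product of the characteristic functions of normalised, individually negligible weighted
innovations has a uniformly bounded integral. -/
theorem exists_bound_lintegral_prod_charFun (hac : ν ≪ volume) (hν : MemLp id 2 ν)
    (h0 : ∫ x, x ∂ν = 0) (hv : 0 < ∫ x, x ^ 2 ∂ν) (hθ1 : 1 ≤ θ)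
    (hθ : Integrable (fun u => ‖charFun ν u‖ ^ θ)) :
    ∃ K : ℝ≥0∞, K ≠ ⊤ ∧ ∀ (s : Finset ℕ) (b : ℕ → ℝ),
      (∫ x, x ^ 2 ∂ν) * ∑ k ∈ s, b k ^ 2 = 1 →
      (∀ k ∈ s, θ * ((∫ x, x ^ 2 ∂ν) * b k ^ 2) ≤ 1) →
      ∫⁻ u : ℝ, ∏ k ∈ s, ‖charFun ν (b k * u)‖ₑ ≤ K := by
  obtain ⟨K, hKtop, hK⟩ := exists_bound_lintegral_charFun_rpow hac hν h0 hv hθ1 hθ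
  refine ⟨K, hKtop, fun s b hb hbθ => ?_⟩
  -- The Hölder exponents are the variance shares of the terms; they sum to one by normalisation.
  refine lintegral_prod_charFun_le (p := fun k => (∫ x, x ^ 2 ∂ν) * b k ^ 2)
    (fun k _ => by positivity) (by rw [← Finset.mul_sum]; exact hb) fun k hk hpk => ?_
  refine hK (b k) (fun hb0 => ?_) (hbθ k hk)
  simp [hb0] at hpk

end Hoelder

/-! ### Laws of weighted series: domination and absolute continuity. -/

section Density

variable {Ω : Type*} [mΩ : MeasurableSpace Ω] {P : Measure Ω} [IsProbabilityMeasure P]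
  {ν : Measure ℝ} {η : ℕ → Ω → ℝ} {c : ℕ → ℝ} {X : Ω → ℝ}

namespace IsWeightedSum

/-- All factors have modulus at most one, so any finite selection of them bounds the limiting
product. -/
lemma enorm_charFun_le (hX : IsWeightedSum P η c X) (h : IsWhiteNoise P ν η) (s : Finset ℕ)
    (u : ℝ) : ‖charFun (P.map X) u‖ₑ ≤ ∏ k ∈ s, ‖charFun ν (c k * u)‖ₑ := by
  have := h.isProbabilityMeasure
  have hle1 : ∀ t : ℝ, ‖charFun ν t‖ₑ ≤ 1 := fun t => by
    rw [← ofReal_norm]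
    exact ENNReal.ofReal_le_one.2 (norm_charFun_le_one t)
  refine le_of_tendsto (hX.tendsto_charFun h u).enorm ?_
  obtain ⟨N₀, hN₀⟩ := s.exists_nat_subset_range
  filter_upwards [eventually_ge_atTop N₀] with N hN
  have hsub : s ⊆ Finset.range N := hN₀.trans (Finset.range_subset_range.2 hN)
  have h1 : ‖∏ k ∈ Finset.range N, charFun ν (c k * u)‖ₑ =
      ∏ k ∈ Finset.range N, ‖charFun ν (c k * u)‖ₑ := by
    simp [enorm_eq_nnnorm, nnnorm_prod]
  rw [h1]
  exact Finset.prod_le_prod_of_subset_of_le_one' hsub fun k _ _ => hle1 _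

lemma map_le_smul_volume (hX : IsWeightedSum P η c X) (h : IsWhiteNoise P ν η) {s : Finset ℕ}
    {K : ℝ≥0∞} (hKtop : K ≠ ⊤)
    (hK : ∫⁻ u : ℝ, ∏ k ∈ s, ‖charFun ν (c k * u)‖ₑ ≤ K) : P.map X ≤ K • volume := by
  have := Measure.isProbabilityMeasure_map (hX.aemeasurable h)
  exact measure_le_smul_volume_of_charFun hKtop
    ((lintegral_mono fun u => hX.enorm_charFun_le h s u).trans hK)

/-- One nonzero weight is enough: the series is $c_j\eta_j$ plus an independent remainder, and
convolution with any law preserves absolute continuity. -/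
lemma map_absolutelyContinuous (hX : IsWeightedSum P η c X) (h : IsWhiteNoise P ν η)
    (hac : ν ≪ volume) {j : ℕ} (hj : c j ≠ 0) : P.map X ≪ volume := by
  have hle : ∀ k, MeasurableSpace.comap (η k) inferInstance ≤ mΩ := fun k =>
    (h.measurable k).comap_le
  have hmle : ⨆ k ∈ ({j}ᶜ : Set ℕ), MeasurableSpace.comap (η k) inferInstance ≤ mΩ :=
    iSup₂_le fun k _ => hle k
  let S : ℕ → Ω → ℝ := fun N ω => ∑ k ∈ (Finset.range N).erase j, c k * η k ω
  have hSm : ∀ N, StronglyMeasurable[⨆ k ∈ ({j}ᶜ : Set ℕ),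
      MeasurableSpace.comap (η k) inferInstance] (S N) := fun N => by
    refine Finset.stronglyMeasurable_fun_sum _ fun k hk => ?_
    have h1 : Measurable[⨆ k ∈ ({j}ᶜ : Set ℕ), MeasurableSpace.comap (η k) inferInstance]
        (η k) := (comap_measurable (η k)).mono
      (le_iSup₂_of_le k (by simpa using (Finset.mem_erase.1 hk).1) le_rfl) le_rfl
    exact (h1.const_mul (c k)).stronglyMeasurable
  -- Taking the limit of the sums without index `j`, rather than subtracting from `X`, makes `Y`
  -- measurable with respect to the other variables everywhere, which yields independence.
  let Y : Ω → ℝ := fun ω => limUnder atTop fun N => S N ω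
  have hYm : Measurable[⨆ k ∈ ({j}ᶜ : Set ℕ), MeasurableSpace.comap (η k) inferInstance] Y :=
    (@StronglyMeasurable.limUnder _ _ _
      (⨆ k ∈ ({j}ᶜ : Set ℕ), MeasurableSpace.comap (η k) inferInstance) _ _ _ _ _ _ _ hSm).measurable
  have hXY : X =ᵐ[P] (fun ω => c j * η j ω) + Y := by
    filter_upwards [hX] with ω hω
    have h1 : Tendsto (fun N => S N ω) atTop (𝓝 (X ω - c j * η j ω)) := by
      refine (hω.sub_const (c j * η j ω)).congr' ?_
      filter_upwards [eventually_gt_atTop j] with N hN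
      rw [← Finset.add_sum_erase _ _ (Finset.mem_range.2 hN)]
      simp [S]
    have h2 : Y ω = X ω - c j * η j ω := h1.limUnder_eq
    simp [h2]
  have hind : IndepFun (fun ω => c j * η j ω) Y P := by
    have h1 := indep_iSup_of_disjoint hle h.indep (S := {j}) (T := {j}ᶜ) disjoint_compl_right
    rw [iSup_singleton] at h1
    refine indep_of_indep_of_le_left (indep_of_indep_of_le_right h1 hYm.comap_le) ?_
    exact ((comap_measurable (η j)).const_mul (c j)).comap_le
  have hjm : Measurable (fun ω => c j * η j ω) := (h.measurable j).const_mul _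
  rw [Measure.map_congr hXY, hind.map_add_eq_map_conv_map hjm (hYm.mono hmle le_rfl),
    Measure.conv_comm]
  have := Measure.isProbabilityMeasure_map (μ := P) hjm.aemeasurable
  refine Measure.conv_absolutelyContinuous ?_
  have h3 : P.map (fun ω => c j * η j ω) = ν.map (fun x => c j * x) := by
    rw [← h.map_eq j, Measure.map_map (measurable_const_mul _) (h.measurable j)]
    rfl
  rw [h3]
  refine (hac.map (measurable_const_mul (c j))).trans ?_
  rw [Real.map_volume_mul_left hj]
  exact Measure.smul_absolutelyContinuous

end IsWeightedSum

end Density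

/-! ### Conditional expectations and a conditional Efron–Stein inequality. -/

section CondExp

variable {Ω : Type*} {mΩ : MeasurableSpace Ω} {P : Measure Ω} [IsProbabilityMeasure P]

lemma setIntegral_eq_measureReal_mul {m₂ m₃ : MeasurableSpace Ω} (h₂ : m₂ ≤ mΩ) (h₃ : m₃ ≤ mΩ)
    (hind : Indep m₃ m₂ P) {f : Ω → ℝ} (hf : StronglyMeasurable[m₃] f) (hfi : Integrable f P)
    {B : Set Ω} (hB : MeasurableSet[m₂] B) : ∫ ω in B, f ω ∂P = P.real B * ∫ ω, f ω ∂P := by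
  rw [← setIntegral_condExp h₂ hfi hB, setIntegral_congr_ae (h₂ B hB)
    ((condExp_indep_eq h₃ h₂ hf hind).mono fun ω hω _ => hω), setIntegral_const, smul_eq_mul]

/-- Conditioning additionally on an independent σ-algebra does not change a conditional
expectation. -/
theorem condExp_sup_of_indep {m₁ m₂ m₃ : MeasurableSpace Ω} (h₁₃ : m₁ ≤ m₃) (h₂ : m₂ ≤ mΩ)
    (h₃ : m₃ ≤ mΩ) (hind : Indep m₃ m₂ P) {Y : Ω → ℝ} (hY : StronglyMeasurable[m₃] Y)
    (hYi : Integrable Y P) : P[Y | m₁ ⊔ m₂] =ᵐ[P] P[Y | m₁] := by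
  have h₁ : m₁ ≤ mΩ := h₁₃.trans h₃
  have h₁₂ : m₁ ⊔ m₂ ≤ mΩ := sup_le h₁ h₂
  have hgen : m₁ ⊔ m₂ = MeasurableSpace.generateFrom
      {s | ∃ A B, MeasurableSet[m₁] A ∧ MeasurableSet[m₂] B ∧ s = A ∩ B} := by
    refine le_antisymm (sup_le ?_ ?_) (MeasurableSpace.generateFrom_le ?_)
    · exact fun A hA => MeasurableSpace.measurableSet_generateFrom
        ⟨A, Set.univ, hA, MeasurableSet.univ, by simp⟩
    · exact fun B hB => MeasurableSpace.measurableSet_generateFrom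
        ⟨Set.univ, B, MeasurableSet.univ, hB, by simp⟩
    · rintro _ ⟨A, B, hA, hB, rfl⟩
      exact MeasurableSet.inter ((le_sup_left : m₁ ≤ m₁ ⊔ m₂) A hA)
        ((le_sup_right : m₂ ≤ m₁ ⊔ m₂) B hB)
  have hpi : IsPiSystem {s | ∃ A B, MeasurableSet[m₁] A ∧ MeasurableSet[m₂] B ∧ s = A ∩ B} := by
    rintro _ ⟨A, B, hA, hB, rfl⟩ _ ⟨A', B', hA', hB', rfl⟩ _
    exact ⟨A ∩ A', B ∩ B', MeasurableSet.inter hA hA', MeasurableSet.inter hB hB',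
      Set.inter_inter_inter_comm _ _ _ _⟩
  have hZi : Integrable (P[Y | m₁]) P := integrable_condExp
  refine (ae_eq_condExp_of_forall_setIntegral_eq h₁₂ hYi (fun s _ _ => hZi.integrableOn)
    (fun s hs _ => ?_)
    ⟨_, stronglyMeasurable_condExp.mono le_sup_left, EventuallyEq.rfl⟩).symm
  induction s, hs using MeasurableSpace.induction_on_inter hgen hpi with
  | empty => simp
  | basic t ht =>
    obtain ⟨A, B, hA, hB, rfl⟩ := ht
    -- For $A\in m_1\subseteq m_3$ and $B\in m_2$, independence pulls out $P(B)$. This applies to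
    -- both `Y` and `P[Y | m₁]`, as both are `m₃`-measurable; what is left is the defining property
    -- on `A`.
    have key : ∀ f : Ω → ℝ, StronglyMeasurable[m₃] f → Integrable f P →
        ∫ ω in A ∩ B, f ω ∂P = P.real B * ∫ ω in A, f ω ∂P := fun f hf hfi => by
      rw [Set.inter_comm, ← setIntegral_indicator (h₁ A hA),
        setIntegral_eq_measureReal_mul h₂ h₃ hind (hf.indicator (h₁₃ A hA))
          (hfi.indicator (h₁ A hA)) hB, integral_indicator (h₁ A hA)]
    rw [key _ (stronglyMeasurable_condExp.mono h₁₃) hZi, key _ hY hYi,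
      setIntegral_condExp h₁ hYi hA]
  | compl t ht ih =>
    have hZ := integral_add_compl (h₁₂ t ht) hZi
    have hY' := integral_add_compl (h₁₂ t ht) hYi
    rw [integral_condExp h₁] at hZ
    linarith [ih (measure_lt_top P t)]
  | iUnion f hd hf ih =>
    rw [integral_iUnion (fun i => h₁₂ _ (hf i)) hd hZi.integrableOn,
      integral_iUnion (fun i => h₁₂ _ (hf i)) hd hYi.integrableOn]
    exact tsum_congr fun i => ih i (measure_lt_top P _)

lemma integral_sub_condExp_sq {m : MeasurableSpace Ω} (hm : m ≤ mΩ) {Y : Ω → ℝ}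
    (hY : MemLp Y 2 P) :
    ∫ ω, (Y ω - (P[Y | m]) ω) ^ 2 ∂P = ∫ ω, Y ω ^ 2 ∂P - ∫ ω, (P[Y | m]) ω ^ 2 ∂P := by
  have h1 : ∫ ω, (Var[Y; P | m]) ω ∂P = ∫ ω, (Y ω - (P[Y | m]) ω) ^ 2 ∂P := by
    rw [condVar, integral_condExp hm]; rfl
  rw [← h1, integral_congr_ae (condVar_ae_eq_condExp_sq_sub_sq_condExp hm hY),
    integral_sub' (g := (P[Y | m]) ^ 2) integrable_condExp (hY.condExp one_le_two).integrable_sq,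
    integral_condExp hm]
  rfl

/-- Pythagoras applied to the finer projection, combined with the tower property. -/
lemma integral_condExp_sub_condExp_sq {m m' : MeasurableSpace Ω} (hmm' : m ≤ m') (hm' : m' ≤ mΩ)
    {Y : Ω → ℝ} (hY : MemLp Y 2 P) :
    ∫ ω, ((P[Y | m']) ω - (P[Y | m]) ω) ^ 2 ∂P =
      ∫ ω, (P[Y | m']) ω ^ 2 ∂P - ∫ ω, (P[Y | m]) ω ^ 2 ∂P := by
  have h1 := integral_sub_condExp_sq (hmm'.trans hm') (hY.condExp (m := m') one_le_two)
  have h2 : P[P[Y | m'] | m] =ᵐ[P] P[Y | m] := condExp_condExp_of_le hmm' hm'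
  rw [integral_congr_ae (g := fun ω => ((P[Y | m']) ω - (P[Y | m]) ω) ^ 2)
    (h2.mono fun ω hω => by simp only [hω]),
    integral_congr_ae (f := fun ω => (P[P[Y | m'] | m]) ω ^ 2)
      (g := fun ω => (P[Y | m]) ω ^ 2) (h2.mono fun ω hω => by simp only [hω])] at h1
  exact h1

/-- A conditional Efron–Stein inequality: if at each step of a filtration `S` is close in `L²` to a
variable whose conditional expectation does not change at that step, then `S` is close in `L²` to
its conditional expectation given the initial σ-algebra. -/
theorem integral_sub_condExp_sq_le {ℱ : ℕ → MeasurableSpace Ω} (hmono : Monotone ℱ)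
    (hle : ∀ i, ℱ i ≤ mΩ) {n : ℕ} {S : Ω → ℝ} (hS : MemLp S 2 P)
    (hSm : StronglyMeasurable[ℱ n] S) {T : ℕ → Ω → ℝ} {b : ℝ}
    (hT : ∀ i < n, MemLp (T i) 2 P)
    (hTc : ∀ i < n, P[T i | ℱ (i + 1)] =ᵐ[P] P[T i | ℱ i])
    (hb : ∀ i < n, ∫ ω, (S ω - T i ω) ^ 2 ∂P ≤ b) :
    ∫ ω, (S ω - (P[S | ℱ 0]) ω) ^ 2 ∂P ≤ n * b := by
  -- `T i` has equal projections at steps `i` and `i + 1`, so the martingale increment of `S` is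
  -- that of `S - T i`, whose norm is at most that of `S - T i`. By orthogonality these squared
  -- increments telescope.
  have hstep : ∀ i < n,
      ∫ ω, (P[S | ℱ (i + 1)]) ω ^ 2 ∂P - ∫ ω, (P[S | ℱ i]) ω ^ 2 ∂P ≤ b := by
    intro i hi
    have hU : MemLp (S - T i) 2 P := hS.sub (hT i hi)
    have h1 := integral_condExp_sub_condExp_sq (hmono (Nat.le_succ i)) (hle (i + 1)) hS
    have h2 := integral_condExp_sub_condExp_sq (hmono (Nat.le_succ i)) (hle (i + 1)) hU
    have hSi := hS.integrable one_le_two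
    have hTi := (hT i hi).integrable one_le_two
    have h3 : ∫ ω, ((P[S | ℱ (i + 1)]) ω - (P[S | ℱ i]) ω) ^ 2 ∂P =
        ∫ ω, ((P[S - T i | ℱ (i + 1)]) ω - (P[S - T i | ℱ i]) ω) ^ 2 ∂P := by
      refine integral_congr_ae ?_
      filter_upwards [condExp_sub hSi hTi (ℱ (i + 1)), condExp_sub hSi hTi (ℱ i), hTc i hi]
        with ω w1 w2 w3
      simp only [Pi.sub_apply] at w1 w2
      rw [w1, w2, w3]
      ring
    have h4 := integral_sub_condExp_sq (hle (i + 1)) hU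
    have h5 : 0 ≤ ∫ ω, ((S - T i) ω - (P[S - T i | ℱ (i + 1)]) ω) ^ 2 ∂P :=
      integral_nonneg fun ω => sq_nonneg _
    have h6 : 0 ≤ ∫ ω, (P[S - T i | ℱ i]) ω ^ 2 ∂P := integral_nonneg fun ω => sq_nonneg _
    have h7 : ∫ ω, (S - T i) ω ^ 2 ∂P ≤ b := hb i hi
    simp only [Nat.succ_eq_add_one] at h1 h2
    linarith
  have hsum := Finset.sum_le_sum fun i (hi : i ∈ Finset.range n) =>
    hstep i (Finset.mem_range.1 hi)
  rw [Finset.sum_range_sub (fun i => ∫ ω, (P[S | ℱ i]) ω ^ 2 ∂P), Finset.sum_const,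
    Finset.card_range, nsmul_eq_mul, condExp_of_stronglyMeasurable (hle n) hSm
      (hS.integrable one_le_two)] at hsum
  rw [integral_sub_condExp_sq (hle 0) hS]
  exact hsum

lemma tendstoInMeasure_zero_of_integral_sq {f : ℕ → Ω → ℝ}
    (hf : ∀ n, AEStronglyMeasurable (f n) P) (hf2 : ∀ᶠ n in atTop, MemLp (f n) 2 P)
    (h : Tendsto (fun n => ∫ ω, f n ω ^ 2 ∂P) atTop (𝓝 0)) :
    TendstoInMeasure P f atTop (fun _ => (0 : ℝ)) := by
  refine tendstoInMeasure_of_tendsto_eLpNorm (p := 2) (by simp) hf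
    aestronglyMeasurable_const ?_
  have h1 : Tendsto (fun n => ENNReal.ofReal √(∫ ω, f n ω ^ 2 ∂P)) atTop (𝓝 0) := by
    simpa using ENNReal.tendsto_ofReal h.sqrt
  refine h1.congr' ?_
  filter_upwards [hf2] with n hn
  have h2 : (f n - fun _ => (0 : ℝ)) = f n := by ext; simp
  rw [h2, hn.eLpNorm_eq_integral_rpow_norm (by simp) (by simp)]
  simp only [ENNReal.toReal_ofNat, Real.rpow_two, Real.norm_eq_abs, sq_abs]
  rw [Real.sqrt_eq_rpow, one_div]

end CondExp

/-! ### The linear process array as weighted series. -/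

section LinearProcessBasics

variable {Ω : Type*} [mΩ : MeasurableSpace Ω] {P : Measure Ω} [IsProbabilityMeasure P]
  {ξ : ℤ → Ω → ℝ} {θ : ℕ} {a : ℕ → ℕ → ℝ} {am : ℕ → ℕ → ℕ → ℝ}

namespace INN

lemma memLp_id_map (h : INN P ξ θ) : MemLp id 2 (P.map (ξ 1)) := by
  rw [memLp_map_measure_iff (by fun_prop) (h.measurable 1).aemeasurable]
  simpa using h.memLp

lemma integral_id_map (h : INN P ξ θ) : ∫ x, x ∂(P.map (ξ 1)) = 0 := by
  rw [integral_map (h.measurable 1).aemeasurable (by fun_prop)]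
  exact h.mean_zero

lemma isWhiteNoise (h : INN P ξ θ) {f : ℕ → ℤ} (hf : f.Injective) :
    IsWhiteNoise P (P.map (ξ 1)) (fun k => ξ (f k)) where
  measurable _ := h.measurable _
  indep := h.indep.precomp hf
  map_eq _ := (h.ident _).map_eq
  memLp_id := h.memLp_id_map
  mean_zero := h.integral_id_map

lemma integral_sq_map (h : INN P ξ θ) : ∫ x, x ^ 2 ∂(P.map (ξ 1)) = Var[ξ 1; P] := by
  rw [integral_map (h.measurable 1).aemeasurable (by fun_prop),
    variance_of_integral_eq_zero (h.measurable 1).aemeasurable h.mean_zero]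

lemma isWhiteNoise_sub (h : INN P ξ θ) (t : ℕ) :
    IsWhiteNoise P (P.map (ξ 1)) (fun k => ξ ((t : ℤ) - (k : ℤ))) :=
  h.isWhiteNoise (f := fun k => (t : ℤ) - (k : ℤ)) fun i j hij => by
    simp only at hij; lia

lemma isWhiteNoise_neg (h : INN P ξ θ) :
    IsWhiteNoise P (P.map (ξ 1)) (fun k => ξ (-(k : ℤ))) :=
  h.isWhiteNoise (f := fun k => -(k : ℤ)) fun i j hij => by
    simp only at hij; lia

end INN

lemma xMinusPartial_add (n t J : ℕ) (ω : Ω) :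
    xMinusPartial ξ am n t (J + t) ω =
      ∑ j ∈ Finset.range J, am n t (t + j) * ξ (-(j : ℤ)) ω := by
  rw [xMinusPartial, Finset.sum_Ico_eq_sum_range, Nat.add_sub_cancel]
  refine Finset.sum_congr rfl fun j _ => ?_
  congr 2
  push_cast; ring

lemma ae_tendsto_xMinus (h : INN P ξ θ) {n t : ℕ}
    (hs : Summable fun j => am n t (t + j) ^ 2) :
    ∀ᵐ ω ∂P, Tendsto (fun N => xMinusPartial ξ am n t N ω) atTop (𝓝 (xMinus ξ am n t ω)) := by
  filter_upwards [h.isWhiteNoise_neg.ae_exists_tendsto hs] with ω hω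
  obtain ⟨x, hx⟩ := hω
  refine tendsto_nhds_limUnder ⟨x, (tendsto_add_atTop_iff_nat t).1 ?_⟩
  simpa only [xMinusPartial_add] using hx

/-- Indexing by $j=k-t$ uses the noise $(\xi_{-j})_{j\ge0}$, the same for every `t`; this lets
$x_n^-$ and $x_{t_n}^-$ be subtracted termwise. -/
lemma isWeightedSum_xMinus (h : INN P ξ θ) {n t : ℕ}
    (hs : Summable fun j => am n t (t + j) ^ 2) :
    IsWeightedSum P (fun k => ξ (-(k : ℤ))) (fun j => am n t (t + j)) (xMinus ξ am n t) := by
  filter_upwards [ae_tendsto_xMinus h hs] with ω hω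
  have := (tendsto_add_atTop_iff_nat t).2 hω
  simpa only [xMinusPartial_add] using this

lemma isWeightedSum_xPlus (n t : ℕ) :
    IsWeightedSum P (fun k => ξ ((t : ℤ) - (k : ℤ))) (fun k => if k < t then a n k else 0)
      (xPlus ξ a n t) := by
  refine Eventually.of_forall fun ω => tendsto_const_nhds.congr' ?_
  filter_upwards [eventually_ge_atTop t] with N hN
  simp only [ite_mul, zero_mul]
  rw [← Finset.sum_filter, xPlus]
  refine Finset.sum_congr ?_ fun _ _ => rfl
  ext k
  simp only [Finset.mem_range, Finset.mem_filter]
  lia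

lemma isWeightedSum_xProc (h : INN P ξ θ) {n t : ℕ}
    (hs : Summable fun j => am n t (t + j) ^ 2) :
    IsWeightedSum P (fun k => ξ ((t : ℤ) - (k : ℤ))) (coeff a am n t) (xProc ξ a am n t) := by
  filter_upwards [ae_tendsto_xMinus h hs] with ω hω
  refine (hω.const_add (xPlus ξ a n t ω)).congr' ?_
  filter_upwards [eventually_ge_atTop t] with N hN
  rw [← Finset.sum_range_add_sum_Ico _ hN, xPlus, xMinusPartial]
  congr 1
  · refine Finset.sum_congr rfl fun k hk => ?_
    rw [coeff, if_pos (Finset.mem_range.1 hk)]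
  · refine Finset.sum_congr rfl fun k hk => ?_
    rw [coeff, if_neg (not_lt.2 (Finset.mem_Ico.1 hk).1)]

lemma coeff_add (n t j : ℕ) : coeff a am n t (j + t) = am n t (t + j) := by
  rw [coeff, if_neg (by lia), add_comm]

lemma coeff_of_lt {n t k : ℕ} (hk : k < t) : coeff a am n t k = a n k := if_pos hk

lemma summable_coeff_sq {n t : ℕ} (hs : Summable fun j => am n t (t + j) ^ 2) :
    Summable fun k => coeff a am n t k ^ 2 := by
  rw [← summable_nat_add_iff t]
  simpa only [coeff_add] using hs

lemma tsum_coeff_sq {n t : ℕ} (hs : Summable fun j => am n t (t + j) ^ 2) :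
    ∑' k, coeff a am n t k ^ 2 =
      ∑ k ∈ Finset.range t, a n k ^ 2 + ∑' j, am n t (t + j) ^ 2 := by
  rw [← (summable_coeff_sq (a := a) hs).sum_add_tsum_nat_add t]
  simp only [coeff_add]
  congr 1
  exact Finset.sum_congr rfl fun k hk => by rw [coeff_of_lt (Finset.mem_range.1 hk)]

lemma sq_betaPlus (n t : ℕ) :
    betaPlus P ξ a n t ^ 2 = Var[ξ 1; P] * ∑ k ∈ Finset.range t, a n k ^ 2 :=
  Real.sq_sqrt (mul_nonneg (variance_nonneg _ _) (Finset.sum_nonneg fun _ _ => sq_nonneg _))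

lemma sq_betaMinus (n t : ℕ) :
    betaMinus P ξ am n t ^ 2 = Var[ξ 1; P] * ∑' j, am n t (t + j) ^ 2 :=
  Real.sq_sqrt (mul_nonneg (variance_nonneg _ _) (tsum_nonneg fun _ => sq_nonneg _))

lemma sq_betaArr (n t : ℕ) :
    betaArr P ξ a am n t ^ 2 = betaPlus P ξ a n t ^ 2 + betaMinus P ξ am n t ^ 2 :=
  Real.sq_sqrt (by positivity)

lemma sq_betaArr_eq_tsum {n t : ℕ} (hs : Summable fun j => am n t (t + j) ^ 2) :
    betaArr P ξ a am n t ^ 2 = Var[ξ 1; P] * ∑' k, coeff a am n t k ^ 2 := by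
  rw [sq_betaArr, sq_betaPlus, sq_betaMinus, tsum_coeff_sq hs, mul_add]

lemma betaArr_nonneg (n t : ℕ) : 0 ≤ betaArr P ξ a am n t := Real.sqrt_nonneg _

lemma LP1.betaSeq_pos (h1 : LP1 P ξ a am) {n : ℕ} (hn : 1 ≤ n) : 0 < betaSeq P ξ a am n :=
  (h1 n n hn le_rfl).2

lemma LP1.variance_pos (h1 : LP1 P ξ a am) : 0 < Var[ξ 1; P] := by
  refine (variance_nonneg _ _).lt_of_ne' fun h0 => ?_
  have := (h1 1 1 le_rfl le_rfl).2
  simp [betaArr, betaPlus, betaMinus, h0] at this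

/-- The variance of the array, as a sum of the squared normalised weights. -/
lemma variance_xProc (h : INN P ξ θ) {n t : ℕ} (hs : Summable fun j => am n t (t + j) ^ 2) :
    betaArr P ξ a am n t ^ 2 = Var[xProc ξ a am n t; P] := by
  have hX := isWeightedSum_xProc (a := a) h hs
  have hc := summable_coeff_sq (a := a) hs
  have hη := h.isWhiteNoise_sub t
  rw [variance_of_integral_eq_zero (hX.aemeasurable hη) (hX.integral_eq_zero hη hc),
    hX.integral_sq hη hc, h.integral_sq_map, sq_betaArr_eq_tsum hs]

section Measurability

/-- Only innovations up to time $0$ occur, and `limUnder` is measurable even where the series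
diverges. The σ-algebra is left free for use with $\mathcal F_t$ and with sub-σ-algebras omitting
one innovation. -/
lemma measurable_xMinus {m : MeasurableSpace Ω} (hm : ∀ i ≤ 0, Measurable[m] (ξ i))
    (n t : ℕ) : Measurable[m] (xMinus ξ am n t) := by
  refine (StronglyMeasurable.limUnder (l := atTop)
    (f := fun N ω => xMinusPartial ξ am n t N ω) fun N => ?_).measurable
  refine Finset.stronglyMeasurable_fun_sum _ fun k hk => ?_
  refine (Measurable.const_mul (hm _ ?_) _).stronglyMeasurable
  have := (Finset.mem_Ico.1 hk).1
  lia

lemma measurable_xPlus {m : MeasurableSpace Ω} {n t : ℕ}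
    (hm : ∀ i : ℤ, 1 ≤ i → i ≤ t → Measurable[m] (ξ i)) : Measurable[m] (xPlus ξ a n t) := by
  refine Finset.measurable_fun_sum _ fun k hk => ?_
  have := Finset.mem_range.1 hk
  exact Measurable.const_mul (hm _ (by lia) (by lia)) _

end Measurability

lemma measurable_innovFiltration (hξ : ∀ i, Measurable (ξ i)) {i j : ℤ} (hij : i ≤ j) :
    Measurable[innovFiltration ξ hξ j] (ξ i) :=
  (comap_measurable (ξ i)).mono (le_iSup₂_of_le i hij le_rfl) le_rfl

lemma arrayAdapted_xProc (hξ : ∀ i, Measurable (ξ i)) (a : ℕ → ℕ → ℝ) (am : ℕ → ℕ → ℕ → ℝ) :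
    ArrayAdapted (innovFiltration ξ hξ) (xProc ξ a am) := by
  intro n t _ _
  refine Measurable.add (measurable_xPlus fun i _ hi => measurable_innovFiltration hξ hi)
    (measurable_xMinus (fun i hi => measurable_innovFiltration hξ ?_) n t)
  lia

lemma measurable_xProc (hξ : ∀ i, Measurable (ξ i)) (n t : ℕ) :
    Measurable (xProc ξ a am n t) :=
  (measurable_xPlus fun i _ _ => hξ i).add (measurable_xMinus (fun i _ => hξ i) n t)

lemma hl1_xProc (hξ : ∀ i, Measurable (ξ i)) (a : ℕ → ℕ → ℝ) (am : ℕ → ℕ → ℕ → ℝ) (β : ℕ → ℝ) :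
    HL1 P (innovFiltration ξ hξ) (xProc ξ a am) (xPlus ξ a) (xMinus ξ am) (fun _ _ _ => 0) β := by
  refine ⟨fun n t _ _ ω => by simp [xProc], fun n t _ _ =>
    measurable_xMinus (fun i hi => measurable_innovFiltration hξ hi) n t,
    fun ε hε => ?_⟩
  simp [not_lt.2 hε.le]

end LinearProcessBasics

/-! ### HL5: moment bounds for the array. -/

section MomentBounds

variable {Ω : Type*} [mΩ : MeasurableSpace Ω] {P : Measure Ω} [IsProbabilityMeasure P]
  {ξ : ℤ → Ω → ℝ} {θ : ℕ} {a : ℕ → ℕ → ℝ} {am : ℕ → ℕ → ℕ → ℝ}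

/-- Dividing LP7 by the innovation variance gives the sum-of-squares bound that the moment estimates
take as input. -/
lemma LP7.exists_tsum_le (h7 : LP7 P ξ a am) (h1 : LP1 P ξ a am) :
    ∃ B : ℝ, ∃ n₀ : ℕ, 1 ≤ n₀ ∧ ∀ n t, n₀ ≤ n → 1 ≤ t → t ≤ n →
      ∑' k, ((betaSeq P ξ a am n)⁻¹ * coeff a am n t k) ^ 2 ≤ B := by
  obtain ⟨n₀, hn₀⟩ := h7
  set M := ⨆ n ≥ n₀, ⨆ t ∈ Finset.Icc 1 n,
    ENNReal.ofReal ((betaSeq P ξ a am n)⁻¹ * betaArr P ξ a am n t) with hM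
  refine ⟨M.toReal ^ 2 / Var[ξ 1; P], max n₀ 1, le_max_right _ _, fun n t hn ht htn => ?_⟩
  have hβ := h1.betaSeq_pos (le_trans (le_max_right n₀ 1) hn)
  have hle : ENNReal.ofReal ((betaSeq P ξ a am n)⁻¹ * betaArr P ξ a am n t) ≤ M :=
    le_iSup₂_of_le n (le_trans (le_max_left n₀ 1) hn)
      (le_iSup₂_of_le t (Finset.mem_Icc.2 ⟨ht, htn⟩) le_rfl)
  have hle' := (ENNReal.ofReal_le_iff_le_toReal hn₀.ne).1 hle
  have hnn : 0 ≤ (betaSeq P ξ a am n)⁻¹ * betaArr P ξ a am n t :=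
    mul_nonneg (inv_nonneg.2 hβ.le) (betaArr_nonneg n t)
  simp only [mul_pow]
  rw [tsum_mul_left, le_div_iff₀ h1.variance_pos, mul_assoc, mul_comm (∑' k, _),
    ← sq_betaArr_eq_tsum (h1 n t ht htn).1, ← mul_pow]
  exact pow_le_pow_left₀ hnn hle' 2

lemma summable_const_mul_coeff_sq {n t : ℕ} (hs : Summable fun j => am n t (t + j) ^ 2) (r : ℝ) :
    Summable fun k => (r * coeff a am n t k) ^ 2 := by
  simp only [mul_pow]
  exact (summable_coeff_sq hs).mul_left _

theorem hl5a_xProc (h : INN P ξ θ) (h1 : LP1 P ξ a am) {lam : ℝ} (h2 : LP2a P ξ lam)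
    (h7 : LP7 P ξ a am) : HL5a P (xProc ξ a am) (betaSeq P ξ a am) lam := by
  obtain ⟨B, n₀, hn₀, hB⟩ := h7.exists_tsum_le h1
  obtain ⟨hlam, hint⟩ := h2
  have hν : Integrable (fun x => |x| ^ lam) (P.map (ξ 1)) := by
    rw [integrable_map_measure (Measurable.aestronglyMeasurable (by fun_prop))
      (h.measurable 1).aemeasurable]
    exact hint
  obtain ⟨K, hK⟩ := exists_bound_lintegral_abs_rpow (P := P) hlam hν B
  refine ⟨by linarith, n₀, hn₀, lt_of_le_of_lt (iSup₂_le fun n hn => iSup₂_le fun t ht => ?_)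
    (ENNReal.ofReal_lt_top (r := K))⟩
  obtain ⟨ht1, htn⟩ := Finset.mem_Icc.1 ht
  have hs := (h1 n t ht1 htn).1
  exact hK _ _ _ (h.isWhiteNoise_sub t) ((isWeightedSum_xProc h hs).const_mul _)
    (summable_const_mul_coeff_sq hs _) (hB n t hn ht1 htn)

theorem hl5b_xProc (h : INN P ξ θ) (h1 : LP1 P ξ a am) (h2 : LP2b P ξ) (h7 : LP7 P ξ a am) :
    ∃ lam : ℝ, HL5b P (xProc ξ a am) (betaSeq P ξ a am) lam := by
  obtain ⟨B, n₀, hn₀, hB⟩ := h7.exists_tsum_le h1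
  have hν : ∀ᶠ u in 𝓝 (0 : ℝ), Integrable (fun x => Real.exp (u * x)) (P.map (ξ 1)) := by
    filter_upwards [h2] with u hu
    rw [integrable_map_measure (Measurable.aestronglyMeasurable (by fun_prop))
      (h.measurable 1).aemeasurable]
    exact hu
  obtain ⟨lam, hlam, K, hK⟩ := exists_bound_lintegral_exp (P := P) hν B
  refine ⟨lam, hlam, n₀, hn₀, lt_of_le_of_lt
    (iSup₂_le fun n hn => iSup₂_le fun t ht => ?_) (ENNReal.ofReal_lt_top (r := K))⟩
  obtain ⟨ht1, htn⟩ := Finset.mem_Icc.1 ht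
  have hs := (h1 n t ht1 htn).1
  exact hK _ _ _ (h.isWhiteNoise_sub t) ((isWeightedSum_xProc h hs).const_mul _)
    (summable_const_mul_coeff_sq hs _) (hB n t hn ht1 htn)

end MomentBounds

/-! ### HL2: limit laws of the two components. -/

section LimitLaws

variable {Ω : Type*} [mΩ : MeasurableSpace Ω] {P : Measure Ω} [IsProbabilityMeasure P]
  {ξ : ℤ → Ω → ℝ} {θ : ℕ} {a : ℕ → ℕ → ℝ} {am : ℕ → ℕ → ℕ → ℝ}

lemma LP6b.eventually_abs_le (h6 : LP6b P ξ a am) (h1 : LP1 P ξ a am) {ε : ℝ} (hε : 0 < ε) :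
    ∀ᶠ n in atTop, (∀ k < n, |(betaSeq P ξ a am n)⁻¹ * a n k| ≤ ε) ∧
      ∀ t, 1 ≤ t → t ≤ n → ∀ k ≥ t, |(betaSeq P ξ a am n)⁻¹ * am n t k| ≤ ε := by
  have h := (ENNReal.tendsto_nhds_zero.1 h6) (ENNReal.ofReal ε) (by simpa using hε)
  filter_upwards [h, eventually_ge_atTop 1] with n hn hn1
  have hβ := h1.betaSeq_pos hn1
  have key : ∀ x : ℝ, ENNReal.ofReal |x| ≤ (⨆ k ∈ Finset.range n, ENNReal.ofReal |a n k|) +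
      (⨆ t ∈ Finset.Icc 1 n, ⨆ k ≥ t, ENNReal.ofReal |am n t k|) →
      |(betaSeq P ξ a am n)⁻¹ * x| ≤ ε := fun x hx => by
    have h3 := (ENNReal.div_le_div_right hx (ENNReal.ofReal (betaSeq P ξ a am n))).trans hn
    rw [← ENNReal.ofReal_div_of_pos hβ, ENNReal.ofReal_le_ofReal_iff hε.le] at h3
    rwa [abs_mul, abs_of_pos (inv_pos.2 hβ), inv_mul_eq_div]
  refine ⟨fun k hk => key _ ?_, fun t ht htn k hk => key _ ?_⟩
  · exact le_add_right (le_iSup₂_of_le k (Finset.mem_range.2 hk) le_rfl)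
  · exact le_add_left (le_iSup₂_of_le t (Finset.mem_Icc.2 ⟨ht, htn⟩)
      (le_iSup₂_of_le k hk le_rfl))

lemma AdmissibleTimes.eventually {δ : ℝ} {t : ℕ → ℕ} (ht : AdmissibleTimes δ t) :
    ∀ᶠ n in atTop, 1 ≤ n ∧ 1 ≤ t n ∧ t n ≤ n := by
  filter_upwards [eventually_ge_atTop 1] with n hn
  exact ⟨hn, (ht n).2.2 hn, (ht n).2.1⟩

lemma tendsto_charFun_xPlus (h : INN P ξ θ) (h1 : LP1 P ξ a am) {σp σm : ℝ}
    (h6 : LP6 P ξ a am σp σm) {δ : ℝ} (hδ : δ ∈ Set.Ioo (0 : ℝ) 1) {t : ℕ → ℕ}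
    (ht : AdmissibleTimes δ t) (u : ℝ) :
    Tendsto (fun n => charFun (P.map fun ω => (betaSeq P ξ a am n)⁻¹ * xPlus ξ a n (t n) ω) u)
      atTop (𝓝 (charFun (gaussianReal 0 (σp ^ 2).toNNReal) u)) := by
  have htsum : ∀ n, ∑' k, ((betaSeq P ξ a am n)⁻¹ * if k < t n then a n k else 0) ^ 2 =
      ∑ k ∈ Finset.range (t n), ((betaSeq P ξ a am n)⁻¹ * a n k) ^ 2 := fun n => by
    rw [tsum_eq_sum (s := Finset.range (t n)) fun k hk => by
      rw [if_neg (by simpa using hk)]; simp]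
    exact Finset.sum_congr rfl fun k hk => by rw [if_pos (Finset.mem_range.1 hk)]
  refine tendsto_charFun_weightedSum (ν := P.map (ξ 1))
    (η := fun n k => ξ ((t n : ℤ) - (k : ℤ)))
    (c := fun n k => (betaSeq P ξ a am n)⁻¹ * if k < t n then a n k else 0)
    (Eventually.of_forall fun n => h.isWhiteNoise_sub (t n))
    (by rw [h.integral_sq_map]; exact h1.variance_pos)
    (Eventually.of_forall fun n => (isWeightedSum_xPlus n (t n)).const_mul _)
    (Eventually.of_forall fun n => ?_) ?_ (fun ε hε => ?_) u
  · refine summable_of_ne_finset_zero (s := Finset.range (t n)) fun k hk => ?_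
    rw [if_neg (by simpa using hk)]; simp
  · have h2 := ((h6.1.2.2 δ hδ t ht).1).pow 2
    refine h2.congr fun n => ?_
    rw [htsum, h.integral_sq_map, mul_pow, sq_betaPlus]
    simp only [mul_pow]
    rw [← Finset.mul_sum]
    ring
  · filter_upwards [h6.2.1.eventually_abs_le h1 hε, ht.eventually] with n hn hn' k
    by_cases hk : k < t n
    · rw [if_pos hk]; exact hn.1 k (by lia)
    · rw [if_neg hk, mul_zero, abs_zero]; exact hε.le

lemma tendsto_charFun_xMinus (h : INN P ξ θ) (h1 : LP1 P ξ a am) {σp σm : ℝ}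
    (h6 : LP6 P ξ a am σp σm) {δ : ℝ} (hδ : δ ∈ Set.Ioo (0 : ℝ) 1) {t : ℕ → ℕ}
    (ht : AdmissibleTimes δ t) (u : ℝ) :
    Tendsto (fun n => charFun (P.map fun ω => (betaSeq P ξ a am n)⁻¹ * xMinus ξ am n (t n) ω) u)
      atTop (𝓝 (charFun (gaussianReal 0 (σm ^ 2).toNNReal) u)) := by
  refine tendsto_charFun_weightedSum (ν := P.map (ξ 1)) (η := fun n k => ξ (-(k : ℤ)))
    (c := fun n k => (betaSeq P ξ a am n)⁻¹ * am n (t n) (t n + k))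
    (Eventually.of_forall fun n => h.isWhiteNoise_neg)
    (by rw [h.integral_sq_map]; exact h1.variance_pos) ?_ ?_ ?_ (fun ε hε => ?_) u
  · filter_upwards [ht.eventually] with n hn
    exact (isWeightedSum_xMinus h (h1 n (t n) hn.2.1 hn.2.2).1).const_mul _
  · filter_upwards [ht.eventually] with n hn
    simp only [mul_pow]
    exact (h1 n (t n) hn.2.1 hn.2.2).1.mul_left _
  · have h2 := ((h6.1.2.2 δ hδ t ht).2).pow 2
    refine h2.congr fun n => ?_
    rw [h.integral_sq_map, mul_pow, sq_betaMinus]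
    simp only [mul_pow]
    rw [tsum_mul_left]
    ring
  · filter_upwards [h6.2.1.eventually_abs_le h1 hε, ht.eventually] with n hn hn' k
    exact hn.2 (t n) hn'.2.1 hn'.2.2 _ (Nat.le_add_right _ _)

/-- $x_t^+$ involves only $\xi_1,\dots,\xi_t$, which are independent of $\mathcal F_0$; thus HL2(a)
reduces to unconditional weak convergence. -/
lemma condExp_xPlus (h : INN P ξ θ) (g : ℝ → ℝ) (hg : Measurable g) (n t : ℕ) :
    P[fun ω => g (xPlus ξ a n t ω) | innovFiltration ξ h.measurable 0] =ᵐ[P]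
      fun _ => ∫ ω, g (xPlus ξ a n t ω) ∂P := by
  have hle : ∀ k, MeasurableSpace.comap (ξ k) inferInstance ≤ mΩ := fun k =>
    (h.measurable k).comap_le
  have hind := indep_iSup_of_disjoint hle h.indep (S := {k : ℤ | 1 ≤ k}) (T := {k : ℤ | k ≤ 0})
    (Set.disjoint_left.2 fun k (hk : 1 ≤ k) (hk' : k ≤ 0) => by lia)
  refine condExp_indep_eq (m₁ := ⨆ k ∈ {k : ℤ | 1 ≤ k}, MeasurableSpace.comap (ξ k) inferInstance)
    (iSup₂_le fun k _ => hle k) ((innovFiltration ξ h.measurable).le 0) ?_ hind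
  exact (hg.comp (measurable_xPlus fun i hi _ => (comap_measurable (ξ i)).mono
    (le_iSup₂_of_le i hi le_rfl) le_rfl)).stronglyMeasurable

theorem hl2_xProc (h : INN P ξ θ) (h1 : LP1 P ξ a am) {σp σm : ℝ} (h6 : LP6 P ξ a am σp σm) :
    HL2 P (innovFiltration ξ h.measurable) (xPlus ξ a) (xMinus ξ am) (betaSeq P ξ a am)
      ((gaussianReal 0 (σp ^ 2).toNNReal).prod (gaussianReal 0 (σm ^ 2).toNNReal))
      Prod.fst Prod.snd := by
  have hσp : (σp ^ 2).toNNReal ≠ 0 := by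
    have := h6.1.1
    rw [Ne, Real.toNNReal_eq_zero, not_le]
    positivity
  refine ⟨measurable_fst, measurable_snd, gaussianPDFReal 0 (σp ^ 2).toNNReal, ?_, ?_,
    fun x => gaussianPDFReal_nonneg _ _ x, ?_, fun δ hδ t ht => ⟨fun g => ?_, ?_, ?_⟩⟩
  · rw [gaussianPDFReal_def]; fun_prop
  · refine ⟨(√(2 * Real.pi * (σp ^ 2).toNNReal))⁻¹, fun x => ?_⟩
    rw [gaussianPDFReal_def]
    refine mul_le_of_le_one_right (by positivity) (Real.exp_le_one_iff.2 ?_)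
    exact div_nonpos_of_nonpos_of_nonneg (neg_nonpos.2 (sq_nonneg _)) (by positivity)
  · rw [Measure.map_fst_prod, measure_univ, one_smul, gaussianReal_of_var_ne_zero _ hσp]
    rfl
  · have hm : ∀ n, Measurable fun ω => (betaSeq P ξ a am n)⁻¹ * xPlus ξ a n (t n) ω := fun n =>
      (measurable_xPlus fun i _ _ => h.measurable i).const_mul _
    have hce : ∀ n, P[fun ω => g ((betaSeq P ξ a am n)⁻¹ * xPlus ξ a n (t n) ω) |
        innovFiltration ξ h.measurable 0] =ᵐ[P]
        fun _ => ∫ ω, g ((betaSeq P ξ a am n)⁻¹ * xPlus ξ a n (t n) ω) ∂P := fun n =>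
      condExp_xPlus h (fun x => g ((betaSeq P ξ a am n)⁻¹ * x))
        (g.continuous.measurable.comp (measurable_const_mul _)) n (t n)
    refine TendstoInMeasure.congr_left (fun n => (hce n).symm) ?_
    refine tendstoInMeasure_of_tendsto_ae (fun n => aestronglyMeasurable_const)
      (Eventually.of_forall fun ω => ?_)
    have hlevy : Tendsto (β := ProbabilityMeasure ℝ) (fun n => ⟨P.map fun ω =>
        (betaSeq P ξ a am n)⁻¹ * xPlus ξ a n (t n) ω,
        Measure.isProbabilityMeasure_map (hm n).aemeasurable⟩) atTop
        (𝓝 ⟨gaussianReal 0 (σp ^ 2).toNNReal, inferInstance⟩) :=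
      ProbabilityMeasure.tendsto_iff_tendsto_charFun.2 fun u =>
        tendsto_charFun_xPlus h h1 h6 hδ ht u
    have hint := ProbabilityMeasure.tendsto_iff_forall_integral_tendsto.1 hlevy g
    have e1 : ∫ x, g x ∂(gaussianReal 0 (σp ^ 2).toNNReal) =
        ∫ x, g x * gaussianPDFReal 0 (σp ^ 2).toNNReal x := by
      rw [integral_gaussianReal_eq_integral_smul hσp]
      simp only [smul_eq_mul, mul_comm]
    simp only [ProbabilityMeasure.coe_mk] at hint
    rw [e1] at hint
    refine hint.congr fun n => ?_
    rw [integral_map (hm n).aemeasurable g.continuous.aestronglyMeasurable]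
  · have hm : ∀ n, Measurable fun ω => (betaSeq P ξ a am n)⁻¹ * xMinus ξ am n (t n) ω := fun n =>
      (measurable_xMinus (fun i _ => h.measurable i) _ _).const_mul _
    refine ⟨fun n => (hm n).aemeasurable, measurable_snd.aemeasurable, ?_⟩
    refine ProbabilityMeasure.tendsto_iff_tendsto_charFun.2 fun u => ?_
    have := tendsto_charFun_xMinus h h1 h6 hδ ht u
    simp only [ProbabilityMeasure.coe_mk]
    rw [Measure.map_snd_prod, measure_univ, one_smul]
    exact this
  · have hxm : ∀ n s, Measurable (xMinus ξ am n s) := fun n s =>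
      measurable_xMinus (fun i _ => h.measurable i) n s
    -- The normalised difference is a weighted series in the common noise; its second moment is the
    -- variance of $\xi_1$ times the expression in LP6(c).
    have hW : ∀ᶠ n in atTop, IsWeightedSum P (fun k => ξ (-(k : ℤ)))
        (fun j => (betaSeq P ξ a am n)⁻¹ * (am n n (n + j) - am n (t n) (t n + j)))
        (fun ω => (betaSeq P ξ a am n)⁻¹ * (xMinus ξ am n n ω - xMinus ξ am n (t n) ω)) := by
      filter_upwards [ht.eventually] with n hn
      exact ((isWeightedSum_xMinus h (h1 n n hn.1 le_rfl).1).sub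
        (isWeightedSum_xMinus h (h1 n (t n) hn.2.1 hn.2.2).1)).const_mul _
    have hc : ∀ᶠ n in atTop, Summable fun j =>
        ((betaSeq P ξ a am n)⁻¹ * (am n n (n + j) - am n (t n) (t n + j))) ^ 2 := by
      filter_upwards [ht.eventually] with n hn
      simp only [mul_pow]
      refine Summable.mul_left _ ?_
      refine Summable.of_nonneg_of_le (fun _ => sq_nonneg _) (fun j => ?_)
        (((h1 n n hn.1 le_rfl).1.add (h1 n (t n) hn.2.1 hn.2.2).1).mul_left 2)
      nlinarith [sq_nonneg (am n n (n + j) + am n (t n) (t n + j))]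
    refine tendstoInMeasure_zero_of_integral_sq
      (fun n => (((hxm n n).sub (hxm n (t n))).const_mul _).aestronglyMeasurable) ?_ ?_
    · filter_upwards [hW, hc] with n hWn hcn
      exact hWn.memLp h.isWhiteNoise_neg hcn
    · have h2 := (h6.2.2 δ hδ t ht).const_mul Var[ξ 1; P]
      rw [mul_zero] at h2
      refine h2.congr' ?_
      filter_upwards [hW, hc] with n hWn hcn
      rw [hWn.integral_sq h.isWhiteNoise_neg hcn, h.integral_sq_map]
      simp only [mul_pow]
      rw [tsum_mul_left, inv_pow]
      congr 2
      exact tsum_congr fun j => by ring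

end LimitLaws

/-! ### HL3: uniformly bounded densities. -/

section Densities

variable {Ω : Type*} [mΩ : MeasurableSpace Ω] {P : Measure Ω} [IsProbabilityMeasure P]
  {ξ : ℤ → Ω → ℝ} {θ : ℕ} {a : ℕ → ℕ → ℝ} {am : ℕ → ℕ → ℕ → ℝ}

lemma isWeightedSum_normalised (h : INN P ξ θ) (h1 : LP1 P ξ a am) {n t : ℕ} (ht : 1 ≤ t)
    (htn : t ≤ n) : IsWeightedSum P (fun k => ξ ((t : ℤ) - (k : ℤ)))
      (fun k => (betaSeq P ξ a am t)⁻¹ * coeff a am n t k)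
      (fun ω => (betaSeq P ξ a am t)⁻¹ * xProc ξ a am n t ω) :=
  (isWeightedSum_xProc h (h1 n t ht htn).1).const_mul _

lemma map_xProc_absolutelyContinuous (h : INN P ξ θ) (h1 : LP1 P ξ a am) {n t : ℕ} (ht : 1 ≤ t)
    (htn : t ≤ n) :
    P.map (fun ω => (betaSeq P ξ a am t)⁻¹ * xProc ξ a am n t ω) ≪ volume := by
  obtain ⟨k, hk⟩ : ∃ k, coeff a am n t k ≠ 0 := by
    by_contra! hall
    have h2 := sq_betaArr_eq_tsum (P := P) (ξ := ξ) (a := a) (h1 n t ht htn).1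
    simp only [hall] at h2
    have := (h1 n t ht htn).2
    simp at h2
    linarith
  exact (isWeightedSum_normalised h h1 ht htn).map_absolutelyContinuous (h.isWhiteNoise_sub t)
    h.absCont (j := k) (mul_ne_zero (inv_ne_zero (h1.betaSeq_pos ht).ne') hk)

/-- `HL3` follows from a uniform domination of the laws by multiples of Lebesgue measure. -/
lemma hl3_of_map_le (h : INN P ξ θ) (h1 : LP1 P ξ a am) {t₀ n₀ : ℕ} (ht₀ : 1 ≤ t₀) {K : ℝ≥0∞}
    (hK : K ≠ ⊤) (hle : ∀ n t, n₀ ≤ n → t₀ ≤ t → t ≤ n →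
      P.map (fun ω => (betaSeq P ξ a am t)⁻¹ * xProc ξ a am n t ω) ≤ K • volume) :
    HL3 P (xProc ξ a am) (betaSeq P ξ a am) t₀ := by
  have hex : ∀ n t, ∃ D : ℝ → ℝ≥0∞, (1 ≤ t → t ≤ n → Measurable D ∧
      P.map (fun ω => (betaSeq P ξ a am t)⁻¹ * xProc ξ a am n t ω) = volume.withDensity D) ∧
      (n₀ ≤ n → t₀ ≤ t → t ≤ n → ∀ x, D x ≤ K) := by
    intro n t
    have := Measure.isProbabilityMeasure_map (μ := P)
      ((measurable_xProc (a := a) (am := am) h.measurable n t).const_mul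
        (betaSeq P ξ a am t)⁻¹).aemeasurable
    by_cases hnt : n₀ ≤ n ∧ t₀ ≤ t ∧ t ≤ n
    · obtain ⟨D, hD1, hD2, hD3⟩ := exists_density_le (hle n t hnt.1 hnt.2.1 hnt.2.2)
      exact ⟨D, fun _ _ => ⟨hD1, hD2⟩, fun _ _ _ => hD3⟩
    -- Outside the uniform range only the existence of a density is required.
    · refine ⟨(P.map fun ω => (betaSeq P ξ a am t)⁻¹ * xProc ξ a am n t ω).rnDeriv volume,
        fun ht htn => ⟨Measure.measurable_rnDeriv _ _, ?_⟩,
        fun h2 h3 h4 => absurd ⟨h2, h3, h4⟩ hnt⟩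
      exact (Measure.withDensity_rnDeriv_eq _ _ (map_xProc_absolutelyContinuous h h1 ht htn)).symm
  choose D hD1 hD2 using hex
  refine ⟨ht₀, D, hD1, max n₀ t₀, le_max_right _ _, lt_of_le_of_lt ?_ hK.lt_top⟩
  refine iSup₂_le fun n hn => iSup₂_le fun t ht => iSup_le fun x => ?_
  exact hD2 n t ((le_max_left _ _).trans hn) (Finset.mem_Icc.1 ht).1 (Finset.mem_Icc.1 ht).2 x

/-- Only the first $t$ factors are used. Divided by $\beta^+_{n,t}$ their weights have unit variance
and, for late $t$, are small enough for the Hölder bound. Passing to $\beta_t^{-1}$ rescales by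
$r=\beta_t^{-1}\beta^+_{n,t}$, which LP3 keeps away from zero. -/
lemma exists_map_le_of_LP3 (h : INN P ξ θ) (h1 : LP1 P ξ a am) {t₀ : ℕ}
    (h3 : LP3 P ξ a am t₀) :
    ∃ t₁ n₁ : ℕ, 1 ≤ t₁ ∧ ∃ K : ℝ≥0∞, K ≠ ⊤ ∧ ∀ n t, n₁ ≤ n → t₁ ≤ t → t ≤ n →
      P.map (fun ω => (betaSeq P ξ a am t)⁻¹ * xProc ξ a am n t ω) ≤ K • volume := by
  obtain ⟨ht₀, hinf, hsup⟩ := h3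
  have hν := (h.isWhiteNoise_sub 0).isProbabilityMeasure
  have hv := h1.variance_pos
  obtain ⟨K, hKtop, hK⟩ := exists_bound_lintegral_prod_charFun h.absCont h.memLp_id_map
    h.integral_id_map (by rw [h.integral_sq_map]; exact hv) h.one_le h.charFun_integrable
  rw [h.integral_sq_map] at hK
  obtain ⟨c, hc0, hc⟩ := exists_between hinf
  have hctop : c ≠ ⊤ := hc.ne_top
  obtain ⟨n₁, hn₁⟩ := eventually_atTop.1 (eventually_lt_of_lt_liminf hc)
  have hη : 0 < c.toReal := ENNReal.toReal_pos hc0.ne' hctop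
  -- This choice ensures $\theta\sigma_\xi^2\varepsilon^2\le1$, the smallness condition of the
  -- Hölder bound.
  set ε : ℝ := 1 / (1 + θ * Var[ξ 1; P]) with hε
  have hε0 : 0 < ε := by positivity
  have hlim := eventually_lt_of_limsup_lt (hsup.trans_lt (ENNReal.ofReal_pos.2 hε0))
  obtain ⟨t₁, ht₁⟩ := eventually_atTop.1 hlim
  refine ⟨max t₀ t₁, n₁, ht₀.trans (le_max_left _ _), ENNReal.ofReal c.toReal⁻¹ * K,
    ENNReal.mul_ne_top ENNReal.ofReal_ne_top hKtop, fun n t hn ht htn => ?_⟩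
  have ht1 : 1 ≤ t := ht₀.trans ((le_max_left _ _).trans ht)
  have hβ := h1.betaSeq_pos ht1
  set b := betaPlus P ξ a n t with hb
  set r := (betaSeq P ξ a am t)⁻¹ * b with hr
  have hcr : c.toReal < r := by
    have h4 := (hn₁ n hn).trans_le (iInf₂_le (i := t) (j := Finset.mem_Icc.2
      ⟨(le_max_left _ _).trans ht, htn⟩))
    exact (ENNReal.lt_ofReal_iff_toReal_lt hctop).1 h4
  have hr0 : 0 < r := hη.trans hcr
  have hb0 : 0 < b := by
    have := hr0
    rw [hr] at this
    exact pos_of_mul_pos_right this (inv_pos.2 hβ).le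
  have hmax : ∀ k < t, |a n k| ≤ ε * b := fun k hk => by
    have h5 : ENNReal.ofReal |a n k| / ENNReal.ofReal b ≤ ENNReal.ofReal ε := by
      refine le_trans ?_ (ht₁ t ((le_max_right _ _).trans ht)).le
      refine le_iSup₂_of_le n htn ?_
      exact ENNReal.div_le_div_right (le_iSup₂_of_le k (Finset.mem_range.2 hk) le_rfl) _
    rw [← ENNReal.ofReal_div_of_pos hb0, ENNReal.ofReal_le_ofReal_iff hε0.le,
      div_le_iff₀ hb0] at h5
    exact h5
  refine (isWeightedSum_normalised h h1 ht1 htn).map_le_smul_volume (h.isWhiteNoise_sub t)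
    (s := Finset.range t) (ENNReal.mul_ne_top ENNReal.ofReal_ne_top hKtop) ?_
  have hsub : ∀ u : ℝ, ∏ k ∈ Finset.range t,
      ‖charFun (P.map (ξ 1)) ((betaSeq P ξ a am t)⁻¹ * coeff a am n t k * u)‖ₑ =
      ∏ k ∈ Finset.range t, ‖charFun (P.map (ξ 1)) (a n k / b * (r * u))‖ₑ := fun u => by
    refine Finset.prod_congr rfl fun k hk => ?_
    rw [coeff_of_lt (Finset.mem_range.1 hk)]
    congr 2
    rw [hr]; field_simp
  simp only [hsub]
  rw [lintegral_comp_mul_left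
    (f := fun u => ∏ k ∈ Finset.range t, ‖charFun (P.map (ξ 1)) (a n k / b * u)‖ₑ)
    (Finset.measurable_fun_prod _ fun k _ => by fun_prop) hr0.ne']
  refine mul_le_mul' (ENNReal.ofReal_le_ofReal ?_) (hK _ _ ?_ fun k hk => ?_)
  · rw [abs_inv, abs_of_pos hr0]
    exact inv_anti₀ hη hcr.le
  · simp only [div_pow]
    rw [← Finset.sum_div, ← mul_div_assoc, ← sq_betaPlus, ← hb]
    exact div_self (by positivity)
  · have h6 : (a n k / b) ^ 2 ≤ ε ^ 2 := by
      rw [← sq_abs, abs_div, abs_of_pos hb0]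
      exact pow_le_pow_left₀ (by positivity)
        ((div_le_iff₀ hb0).2 (hmax k (Finset.mem_range.1 hk))) 2
    calc θ * (Var[ξ 1; P] * (a n k / b) ^ 2) ≤ θ * (Var[ξ 1; P] * ε ^ 2) := by gcongr
      _ ≤ 1 := by
        rw [hε, div_pow, one_pow, mul_one_div, mul_div_assoc', div_le_one (by positivity)]
        nlinarith [mul_nonneg (Nat.cast_nonneg (α := ℝ) θ) hv.le]

theorem hl3_of_LP3 (h : INN P ξ θ) (h1 : LP1 P ξ a am) (h3 : ∃ t₀, LP3 P ξ a am t₀) :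
    ∃ t₀, HL3 P (xProc ξ a am) (betaSeq P ξ a am) t₀ := by
  obtain ⟨t₀, h3⟩ := h3
  obtain ⟨t₁, n₁, ht₁, K, hK, hle⟩ := exists_map_le_of_LP3 h h1 h3
  exact ⟨t₁, hl3_of_map_le h h1 ht₁ hK hle⟩

theorem hl3_one_of_LP3_LP4 (h : INN P ξ θ) (h1 : LP1 P ξ a am) (h3 : ∃ t₀, LP3 P ξ a am t₀)
    (h4 : ∀ t₀, LP4 a am θ t₀) : HL3 P (xProc ξ a am) (betaSeq P ξ a am) 1 := by
  obtain ⟨t₀, h3⟩ := h3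
  obtain ⟨t₁, n₁, ht₁, K, hK, hle⟩ := exists_map_le_of_LP3 h h1 h3
  obtain ⟨δ, hδ, n₂, hn₂⟩ := h4 t₁
  have hν := (h.isWhiteNoise_sub 0).isProbabilityMeasure
  set I := ∫⁻ u, ‖charFun (P.map (ξ 1)) u‖ₑ ^ θ with hI
  have hItop : I < ∞ := lintegral_enorm_charFun_pow_lt_top h.charFun_integrable
  -- A common bound for the finitely many $\beta_t$ with $t\le t_1$, needed because LP4 controls the
  -- coefficients before division by $\beta_t$.
  set M := ∑ t ∈ Finset.range (t₁ + 1), betaSeq P ξ a am t with hM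
  have hK'top : ENNReal.ofReal (M / δ) * I ≠ ⊤ :=
    ENNReal.mul_ne_top ENNReal.ofReal_ne_top hItop.ne
  refine hl3_of_map_le h h1 (n₀ := max n₁ n₂) le_rfl (ENNReal.add_ne_top.2 ⟨hK, hK'top⟩)
    fun n t hn ht htn => ?_
  have hsmul : ∀ A B : ℝ≥0∞, A ≤ B → A • (volume : Measure ℝ) ≤ B • volume := fun A B hAB => by
    refine Measure.le_iff.2 fun s _ => ?_
    simp only [Measure.smul_apply, smul_eq_mul]
    gcongr
  rcases le_total t₁ t with htt | htt
  · exact (hle n t ((le_max_left _ _).trans hn) htt htn).trans (hsmul _ _ le_self_add)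
  · refine le_trans ?_ (hsmul _ _ (le_add_self (a := ENNReal.ofReal (M / δ) * I)))
    obtain ⟨S, hS, hSδ⟩ := hn₂ t n ht htt ((le_max_right _ _).trans hn) htn
    have hβ := h1.betaSeq_pos ht
    refine (isWeightedSum_normalised h h1 ht htn).map_le_smul_volume (h.isWhiteNoise_sub t)
      (s := S) hK'top ?_
    refine (lintegral_prod_charFun_le_of_card h.one_le hS
      (δ := (betaSeq P ξ a am t)⁻¹ * δ) (by positivity) fun k hk => ?_).trans ?_
    · rw [abs_mul, abs_of_pos (inv_pos.2 hβ)]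
      exact mul_lt_mul_of_pos_left (hSδ k hk) (inv_pos.2 hβ)
    · refine mul_le_mul' (ENNReal.ofReal_le_ofReal ?_) le_rfl
      rw [mul_inv, inv_inv, ← div_eq_mul_inv]
      gcongr
      exact Finset.single_le_sum (f := fun t => betaSeq P ξ a am t)
        (fun t _ => betaArr_nonneg t t) (Finset.mem_range.2 (by lia))

end Densities

/-! ### HL4: conditional law of large numbers. -/

section ConditionalLawOfLargeNumbers

variable {Ω : Type*} [mΩ : MeasurableSpace Ω] {P : Measure Ω} [IsProbabilityMeasure P]
  {ξ : ℤ → Ω → ℝ} {θ : ℕ} {a : ℕ → ℕ → ℝ} {am : ℕ → ℕ → ℕ → ℝ}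

lemma innovFiltration_add_one (hξ : ∀ i, Measurable (ξ i)) (i : ℤ) :
    innovFiltration ξ hξ (i + 1) =
      innovFiltration ξ hξ i ⊔ MeasurableSpace.comap (ξ (i + 1)) inferInstance := by
  refine le_antisymm (iSup₂_le fun k hk => ?_)
    (sup_le ((innovFiltration ξ hξ).mono (by lia)) (measurable_innovFiltration hξ le_rfl).comap_le)
  rcases (show k ≤ i + 1 from hk).lt_or_eq with hlt | rfl
  · exact le_sup_of_le_left (measurable_innovFiltration hξ (by lia)).comap_le
  · exact le_sup_right

/-- The process `x_t(n)` with the innovation at date `j ≥ 1` removed. -/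
noncomputable def xProcOmit (ξ : ℤ → Ω → ℝ) (a : ℕ → ℕ → ℝ) (am : ℕ → ℕ → ℕ → ℝ) (j : ℤ)
    (n t : ℕ) (ω : Ω) : ℝ :=
  xPlus (Function.update ξ j 0) a n t ω + xMinus ξ am n t ω

/-- Since `j ≥ 1`, the innovation at date `j` never enters $x_t^-$, and zeroing it in $x_t^+$
removes it altogether. -/
lemma measurable_xProcOmit {m : MeasurableSpace Ω} {j : ℤ} (hj : 1 ≤ j)
    (hm : ∀ i ≠ j, Measurable[m] (ξ i)) (n t : ℕ) :
    Measurable[m] (xProcOmit ξ a am j n t) := by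
  refine Measurable.add (measurable_xPlus fun i _ _ => ?_)
    (measurable_xMinus (fun i hi => hm i (by lia)) n t)
  rcases eq_or_ne i j with rfl | hij
  · rw [Function.update_self]; exact measurable_const
  · rw [Function.update_of_ne hij]; exact hm i hij

lemma abs_xProc_sub_xProcOmit_le (j : ℤ) (n t : ℕ) (ω : Ω) :
    |xProc ξ a am n t ω - xProcOmit ξ a am j n t ω| ≤
      (∑ k ∈ Finset.range t, if (t : ℤ) - k = j then |a n k| else 0) * |ξ j ω| := by
  rw [xProc, xProcOmit, add_sub_add_right_eq_sub, xPlus, xPlus, ← Finset.sum_sub_distrib,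
    Finset.sum_mul]
  refine (Finset.abs_sum_le_sum_abs _ _).trans (Finset.sum_le_sum fun k _ => ?_)
  split_ifs with hk
  · rw [hk, Function.update_self, Pi.zero_apply, mul_zero, sub_zero, abs_mul]
  · rw [Function.update_of_ne hk, sub_self, abs_zero, zero_mul]

/-- For each $k$ at most one $t$ satisfies $t-k=j$, so every $|a_k|$ is counted at most once. This
is the source of the sum in LP5. -/
lemma sum_abs_coeff_le (j : ℤ) (n : ℕ) (c : ℕ → ℝ) :
    ∑ t ∈ Finset.Icc 1 n, ∑ k ∈ Finset.range t, (if (t : ℤ) - k = j then |c k| else 0) ≤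
      ∑ k ∈ Finset.range n, |c k| := by
  calc _ ≤ ∑ t ∈ Finset.Icc 1 n, ∑ k ∈ Finset.range n,
          (if (t : ℤ) - k = j then |c k| else 0) := by
        refine Finset.sum_le_sum fun t ht => Finset.sum_le_sum_of_subset_of_nonneg
          (Finset.range_mono (Finset.mem_Icc.1 ht).2) fun k _ _ => ?_
        split_ifs <;> positivity
    _ = ∑ k ∈ Finset.range n, ∑ t ∈ Finset.Icc 1 n,
          (if (t : ℤ) - k = j then |c k| else 0) := Finset.sum_comm
    _ ≤ _ := by
        refine Finset.sum_le_sum fun k _ => ?_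
        rw [← Finset.sum_filter, Finset.sum_const, nsmul_eq_mul]
        refine mul_le_of_le_one_left (abs_nonneg _) ?_
        exact_mod_cast Finset.card_le_one.2 fun s hs t ht => by
          have h1 := (Finset.mem_filter.1 hs).2
          have h2 := (Finset.mem_filter.1 ht).2
          lia

lemma abs_sum_comp_sub_le {g : ℝ → ℝ} {K : ℝ≥0} (hg : LipschitzWith K g) {b : ℝ} (hb : 0 ≤ b)
    (j : ℤ) (n : ℕ) (ω : Ω) :
    |∑ t ∈ Finset.Icc 1 n, g (b * xProc ξ a am n t ω) -
        ∑ t ∈ Finset.Icc 1 n, g (b * xProcOmit ξ a am j n t ω)| ≤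
      K * b * (∑ k ∈ Finset.range n, |a n k|) * |ξ j ω| := by
  rw [← Finset.sum_sub_distrib]
  calc _ ≤ ∑ t ∈ Finset.Icc 1 n, K * b *
          ((∑ k ∈ Finset.range t, if (t : ℤ) - k = j then |a n k| else 0) * |ξ j ω|) := by
        refine (Finset.abs_sum_le_sum_abs _ _).trans (Finset.sum_le_sum fun t _ => ?_)
        have := hg.dist_le_mul (b * xProc ξ a am n t ω) (b * xProcOmit ξ a am j n t ω)
        rw [Real.dist_eq, Real.dist_eq, ← mul_sub, abs_mul, abs_of_nonneg hb, ← mul_assoc] at this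
        exact this.trans (mul_le_mul_of_nonneg_left (abs_xProc_sub_xProcOmit_le j n t ω)
          (by positivity))
    _ = K * b * (∑ t ∈ Finset.Icc 1 n, ∑ k ∈ Finset.range t,
          if (t : ℤ) - k = j then |a n k| else 0) * |ξ j ω| := by
        rw [← Finset.mul_sum, ← Finset.sum_mul]; ring
    _ ≤ _ := by
        gcongr
        exact sum_abs_coeff_le j n (a n)

lemma memLp_sum_comp {g : ℝ → ℝ} (hg : Measurable g) {C : ℝ} (hC : ∀ x, |g x| ≤ C) {n : ℕ}
    {Y : ℕ → Ω → ℝ} (hY : ∀ t, Measurable (Y t)) :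
    MemLp (fun ω => ∑ t ∈ Finset.Icc 1 n, g (Y t ω)) 2 P :=
  memLp_finsetSum _ fun t _ => MemLp.of_bound (hg.comp (hY t)).aestronglyMeasurable C
    (Eventually.of_forall fun _ => hC _)

lemma measurable_sum_comp {m : MeasurableSpace Ω} {g : ℝ → ℝ} (hg : Measurable g) {n : ℕ} {b : ℝ}
    {Y : ℕ → Ω → ℝ} (hY : ∀ t ∈ Finset.Icc 1 n, Measurable[m] (Y t)) :
    Measurable[m] (fun ω => ∑ t ∈ Finset.Icc 1 n, g (b * Y t ω)) :=
  Finset.measurable_fun_sum _ fun t ht => hg.comp ((hY t ht).const_mul b)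

/-- Passing from $\mathcal F_i$ to $\mathcal F_{i+1}$ adjoins only $\xi_{i+1}$, which is independent
of $\mathcal F_i$ and the omitted sum jointly. -/
lemma condExp_sum_xProcOmit (h : INN P ξ θ) {g : ℝ → ℝ} (hg : Measurable g) {C : ℝ}
    (hC : ∀ x, |g x| ≤ C) (b : ℝ) (n i : ℕ) :
    P[fun ω => ∑ t ∈ Finset.Icc 1 n, g (b * xProcOmit ξ a am ((i : ℤ) + 1) n t ω) |
        innovFiltration ξ h.measurable ((i : ℤ) + 1)] =ᵐ[P]
      P[fun ω => ∑ t ∈ Finset.Icc 1 n, g (b * xProcOmit ξ a am ((i : ℤ) + 1) n t ω) |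
        innovFiltration ξ h.measurable (i : ℤ)] := by
  have hle : ∀ k, MeasurableSpace.comap (ξ k) inferInstance ≤ mΩ := fun k =>
    (h.measurable k).comap_le
  have hind := indep_iSup_of_disjoint hle h.indep (S := {(i : ℤ) + 1}ᶜ) (T := {(i : ℤ) + 1})
    disjoint_compl_left
  rw [iSup_singleton] at hind
  rw [innovFiltration_add_one]
  have h₁₃ : innovFiltration ξ h.measurable (i : ℤ) ≤
      ⨆ k ∈ ({(i : ℤ) + 1}ᶜ : Set ℤ), MeasurableSpace.comap (ξ k) inferInstance :=
    iSup₂_le fun k (hk : k ≤ i) => le_iSup₂_of_le k (show k ∈ ({(i : ℤ) + 1}ᶜ : Set ℤ) by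
      simp only [Set.mem_compl_iff, Set.mem_singleton_iff]; lia) le_rfl
  refine condExp_sup_of_indep h₁₃ (hle _) (iSup₂_le fun k _ => hle k) hind ?_ ?_
  · have hmeas : ∀ k ≠ (i : ℤ) + 1, Measurable[⨆ k ∈ ({(i : ℤ) + 1}ᶜ : Set ℤ),
        MeasurableSpace.comap (ξ k) inferInstance] (ξ k) := fun k hk =>
      (comap_measurable (ξ k)).mono (le_iSup₂_of_le k hk le_rfl) le_rfl
    exact (measurable_sum_comp hg fun t _ =>
      measurable_xProcOmit (by lia) hmeas n t).stronglyMeasurable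
  · have hmem : MemLp (fun ω => ∑ t ∈ Finset.Icc 1 n,
        g (b * xProcOmit ξ a am ((i : ℤ) + 1) n t ω)) 2 P :=
      memLp_sum_comp hg hC fun t => (measurable_xProcOmit (by lia)
        (fun k _ => h.measurable k) n t).const_mul b
    exact hmem.integrable one_le_two

/-- Efron–Stein over the $n$ dates after $0$: the comparison variable at step $i$ omits $\xi_{i+1}$,
and the Lipschitz bound controls the change. -/
lemma integral_sum_sub_condExp_sq_le (h : INN P ξ θ) {g : ℝ → ℝ} {C : ℝ} (hC : ∀ x, |g x| ≤ C)
    {K : ℝ≥0} (hg : LipschitzWith K g) {b : ℝ} (hb : 0 ≤ b) (n : ℕ) :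
    ∫ ω, (∑ t ∈ Finset.Icc 1 n, g (b * xProc ξ a am n t ω) -
        (P[fun ω => ∑ t ∈ Finset.Icc 1 n, g (b * xProc ξ a am n t ω) |
          innovFiltration ξ h.measurable 0]) ω) ^ 2 ∂P ≤
      n * ((K * b * ∑ k ∈ Finset.range n, |a n k|) ^ 2 * Var[ξ 1; P]) := by
  have hgm := hg.continuous.measurable
  have hS : MemLp (fun ω => ∑ t ∈ Finset.Icc 1 n, g (b * xProc ξ a am n t ω)) 2 P :=
    memLp_sum_comp hgm hC fun t => (measurable_xProc h.measurable n t).const_mul b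
  have hT : ∀ i : ℕ, MemLp (fun ω => ∑ t ∈ Finset.Icc 1 n,
      g (b * xProcOmit ξ a am ((i : ℤ) + 1) n t ω)) 2 P := fun i =>
    memLp_sum_comp hgm hC fun t => (measurable_xProcOmit (by lia)
      (fun k _ => h.measurable k) n t).const_mul b
  refine integral_sub_condExp_sq_le (ℱ := fun i : ℕ => innovFiltration ξ h.measurable (i : ℤ))
    (fun i j hij => (innovFiltration ξ h.measurable).mono (by exact_mod_cast hij))
    (fun i => (innovFiltration ξ h.measurable).le _) hS ?_ (fun i _ => hT i) (fun i _ => ?_)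
    fun i _ => ?_
  · exact (measurable_sum_comp hgm fun t ht => (arrayAdapted_xProc h.measurable a am n t
      (Finset.mem_Icc.1 ht).1 (Finset.mem_Icc.1 ht).2).mono ((innovFiltration ξ h.measurable).mono
        (by exact_mod_cast (Finset.mem_Icc.1 ht).2)) le_rfl).stronglyMeasurable
  · simpa only [Nat.cast_add, Nat.cast_one] using condExp_sum_xProcOmit h hgm hC b n i
  · have hξ : MemLp (ξ ((i : ℤ) + 1)) 2 P := (h.ident _).symm.memLp_snd h.memLp
    rw [← h.integral_sq_map, ← (h.ident ((i : ℤ) + 1)).map_eq,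
      integral_map (h.measurable _).aemeasurable (by fun_prop), ← integral_const_mul]
    refine integral_mono (hS.sub (hT i)).integrable_sq (hξ.integrable_sq.const_mul _) fun ω => ?_
    simp only
    rw [← sq_abs (ξ _ ω), ← mul_pow, ← sq_abs]
    exact pow_le_pow_left₀ (abs_nonneg _) (abs_sum_comp_sub_le hg hb _ n ω) 2

theorem hl4_xProc (h : INN P ξ θ) (h1 : LP1 P ξ a am) (h5 : LP5 P ξ a am) :
    HL4 P (innovFiltration ξ h.measurable) (xProc ξ a am) (betaSeq P ξ a am) := by
  rintro g ⟨C, hC⟩ ⟨K, hg⟩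
  have hgm := hg.continuous.measurable
  have hX : ∀ n t, Measurable fun ω => (betaSeq P ξ a am n)⁻¹ * xProc ξ a am n t ω := fun n t =>
    (measurable_xProc h.measurable n t).const_mul _
  have hgX : ∀ n t, MemLp (fun ω => g ((betaSeq P ξ a am n)⁻¹ * xProc ξ a am n t ω)) 2 P :=
    fun n t => MemLp.of_bound (hgm.comp (hX n t)).aestronglyMeasurable C
      (Eventually.of_forall fun ω => hC _)
  have hcX : ∀ n t, MemLp (P[fun ω => g ((betaSeq P ξ a am n)⁻¹ * xProc ξ a am n t ω) |
      innovFiltration ξ h.measurable 0]) 2 P := fun n t => (hgX n t).condExp one_le_two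
  have hmem : ∀ n : ℕ, MemLp (fun ω =>
      (n : ℝ)⁻¹ * ∑ t ∈ Finset.Icc 1 n, g ((betaSeq P ξ a am n)⁻¹ * xProc ξ a am n t ω) -
      (n : ℝ)⁻¹ * ∑ t ∈ Finset.Icc 1 n, (P[fun ω' => g ((betaSeq P ξ a am n)⁻¹ *
        xProc ξ a am n t ω') | innovFiltration ξ h.measurable 0]) ω) 2 P := fun n =>
    ((memLp_finsetSum _ fun t _ => hgX n t).const_mul _).sub
      ((memLp_finsetSum _ fun t _ => hcX n t).const_mul _)
  refine tendstoInMeasure_zero_of_integral_sq (fun n => (hmem n).1) (Eventually.of_forall hmem) ?_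
  -- The factor $n^{-2}$ from averaging times the $n$ Efron–Stein steps leaves $n^{-1}$, the square
  -- of the $n^{-1/2}$ in LP5.
  have hlim : Tendsto (fun n : ℕ => (K : ℝ) ^ 2 * Var[ξ 1; P] * ((√n)⁻¹ *
      (betaSeq P ξ a am n)⁻¹ * ∑ k ∈ Finset.range n, |a n k|) ^ 2) atTop (𝓝 0) := by
    simpa using (h5.pow 2).const_mul ((K : ℝ) ^ 2 * Var[ξ 1; P])
  refine squeeze_zero' (Eventually.of_forall fun n => integral_nonneg fun ω => sq_nonneg _) ?_ hlim
  filter_upwards [eventually_ge_atTop 1] with n hn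
  have hn0 : (0 : ℝ) < n := by exact_mod_cast hn
  have hsum := condExp_finsetSum (μ := P) (s := Finset.Icc 1 n)
    (fun t _ => (hgX n t).integrable one_le_two) (innovFiltration ξ h.measurable 0)
  have heq : (∑ t ∈ Finset.Icc 1 n, fun ω => g ((betaSeq P ξ a am n)⁻¹ * xProc ξ a am n t ω)) =
      fun ω => ∑ t ∈ Finset.Icc 1 n, g ((betaSeq P ξ a am n)⁻¹ * xProc ξ a am n t ω) := by
    ext ω; simp
  rw [heq] at hsum
  have hbound := integral_sum_sub_condExp_sq_le (a := a) (am := am) h hC hg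
    (inv_nonneg.2 (h1.betaSeq_pos hn).le) n
  calc _ = (n : ℝ)⁻¹ ^ 2 * ∫ ω, (∑ t ∈ Finset.Icc 1 n,
          g ((betaSeq P ξ a am n)⁻¹ * xProc ξ a am n t ω) -
          (P[fun ω => ∑ t ∈ Finset.Icc 1 n, g ((betaSeq P ξ a am n)⁻¹ * xProc ξ a am n t ω) |
          innovFiltration ξ h.measurable 0]) ω) ^ 2 ∂P := by
        rw [← integral_const_mul]
        refine integral_congr_ae ?_
        filter_upwards [hsum] with ω hω
        rw [hω, Finset.sum_apply]
        ring
    _ ≤ (n : ℝ)⁻¹ ^ 2 * (n * ((K * (betaSeq P ξ a am n)⁻¹ *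
          ∑ k ∈ Finset.range n, |a n k|) ^ 2 * Var[ξ 1; P])) := by gcongr
    _ = _ := by
        simp only [mul_pow, inv_pow, Real.sq_sqrt hn0.le]
        field_simp

end ConditionalLawOfLargeNumbers

end WNP

/-! ### Assembly of the proposition. -/

theorem propositionB1 {Ω : Type*} [mΩ : MeasurableSpace Ω] (P : Measure Ω)
    [IsProbabilityMeasure P] (ξ : ℤ → Ω → ℝ) (θ : ℕ) (hINN : WNP.INN P ξ θ)
    (a : ℕ → ℕ → ℝ) (am : ℕ → ℕ → ℕ → ℝ) (hLP1 : WNP.LP1 P ξ a am) :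
    -- the series defining the array converges, and `β_{n,t}²` is the variance of `x_t(n)`
    (∀ n t : ℕ, 1 ≤ t → t ≤ n →
      (∀ᵐ ω ∂P, Tendsto (fun N => WNP.xMinusPartial ξ am n t N ω) atTop
        (𝓝 (WNP.xMinus ξ am n t ω))) ∧
      MemLp (WNP.xProc ξ a am n t) 2 P ∧
      WNP.betaArr P ξ a am n t ^ 2 = Var[WNP.xProc ξ a am n t; P]) ∧
    -- HL0 (the divergence of `β_n` is the only part of it that is not automatic)
    WNP.ArrayAdapted (WNP.innovFiltration ξ hINN.measurable) (WNP.xProc ξ a am) ∧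
    (∀ n : ℕ, 1 ≤ n → 0 < WNP.betaSeq P ξ a am n) ∧
    (Tendsto (WNP.betaSeq P ξ a am) atTop atTop →
      WNP.HL0 (WNP.innovFiltration ξ hINN.measurable) (WNP.xProc ξ a am)
        (WNP.betaSeq P ξ a am)) ∧
    -- HL1, with zero remainder
    WNP.HL1 P (WNP.innovFiltration ξ hINN.measurable) (WNP.xProc ξ a am) (WNP.xPlus ξ a)
      (WNP.xMinus ξ am) (fun _ _ _ => 0) (WNP.betaSeq P ξ a am) ∧
    -- (i)
    (∀ σp σm : ℝ, WNP.LP6 P ξ a am σp σm →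
      WNP.HL2 P (WNP.innovFiltration ξ hINN.measurable) (WNP.xPlus ξ a) (WNP.xMinus ξ am)
        (WNP.betaSeq P ξ a am)
        ((gaussianReal 0 (σp ^ 2).toNNReal).prod (gaussianReal 0 (σm ^ 2).toNNReal))
        Prod.fst Prod.snd) ∧
    -- (ii)(a)
    ((∃ t₀, WNP.LP3 P ξ a am t₀) →
      ∃ t₀, WNP.HL3 P (WNP.xProc ξ a am) (WNP.betaSeq P ξ a am) t₀) ∧
    -- (ii)(b)
    ((∃ t₀, WNP.LP3 P ξ a am t₀) → (∀ t₀, WNP.LP4 a am θ t₀) →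
      WNP.HL3 P (WNP.xProc ξ a am) (WNP.betaSeq P ξ a am) 1) ∧
    -- (iii)
    (WNP.LP5 P ξ a am →
      WNP.HL4 P (WNP.innovFiltration ξ hINN.measurable) (WNP.xProc ξ a am)
        (WNP.betaSeq P ξ a am)) ∧
    -- (iv)(a)
    (∀ lam : ℝ, WNP.LP2a P ξ lam → WNP.LP7 P ξ a am →
      WNP.HL5a P (WNP.xProc ξ a am) (WNP.betaSeq P ξ a am) lam) ∧
    -- (iv)(b)
    (WNP.LP2b P ξ → WNP.LP6b P ξ a am → WNP.LP7 P ξ a am →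
      ∃ lam : ℝ, WNP.HL5b P (WNP.xProc ξ a am) (WNP.betaSeq P ξ a am) lam) := by
  refine ⟨fun n t ht htn => ?_, WNP.arrayAdapted_xProc _ _ _,
    fun n hn => hLP1.betaSeq_pos hn,
    fun hβ => ⟨WNP.arrayAdapted_xProc _ _ _, fun n hn => hLP1.betaSeq_pos hn, hβ⟩,
    WNP.hl1_xProc _ _ _ _, fun σp σm h6 => WNP.hl2_xProc hINN hLP1 h6,
    fun h3 => WNP.hl3_of_LP3 hINN hLP1 h3, fun h3 h4 => WNP.hl3_one_of_LP3_LP4 hINN hLP1 h3 h4,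
    fun h5 => WNP.hl4_xProc hINN hLP1 h5, fun lam h2 h7 => WNP.hl5a_xProc hINN hLP1 h2 h7,
    fun h2 _ h7 => WNP.hl5b_xProc hINN hLP1 h2 h7⟩
  have hs := (hLP1 n t ht htn).1
  exact ⟨WNP.ae_tendsto_xMinus hINN hs, (WNP.isWeightedSum_xProc hINN hs).memLp
    (hINN.isWhiteNoise_sub t) (WNP.summable_coeff_sq hs), WNP.variance_xProc hINN hs⟩
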